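/- For $g\ge 0$ let $H_{\mathbb Q}=\mathbb Q^{2g}$ with symplectic basis $x_1,\dots,x_g,y_1,\dots,y_g$ and intersection pairing $u\cdot v$, let $\omega_0=\sum_i x_i\wedge y_i\in\Lambda^2H_{\mathbb Q}$, and let $V_g=\Lambda^2H_{\mathbb Q}/\mathbb Q\omega_0$, regarded as an abelian Lie algebra with its action of $\mathrm{Sp}(2g,\mathbb Q)$. Let $H^*(V_g)$ be its Lie algebra cohomology with trivial coefficients $\mathbb Q$ and $H^*(V_g)^{\mathrm{Sp}}$ its $\mathrm{Sp}(2g,\mathbb Q)$-invariant part. For an isometric embedding $H_g\hookrightarrow H_m$ of symplectic spaces let $V_g\to V_m$ be the induced map $V_g\cong U_g\hookrightarrow U_m\cong V_m$, where $U_g=\ker(\Lambda^2H_{\mathbb Q}\to\mathbb Q,\ u\wedge v\mapsto u\cdot v)$, which projects isomorphically onto $V_g$. The inclusions $H_g\subset H_{g+1}$ give stabilization maps $V_g\to V_{g+1}$, and $\lim_{g}H^k(V_g)^{\mathrm{Sp}}$ denotes the space of families of invariant classes that restrict to each other under them. The orthogonal sums $H_g\oplus H_h=H_{g+h}$ give maps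 $V_g\oplus V_h\to V_{g+h}$, hence a coproduct $\Delta$ on stable cohomology (using the Künneth map), and $\lim_g PH^k(V_g)^{\mathrm{Sp}}$ denotes the space of stable classes $x$ of degree $k$ that are primitive, $\Delta x=x\otimes1+1\otimes x$. Then: 1. For every $k$ there is $g_0$ such that for all $g\ge g_0$ the canonical map $\lim_{g'}H^k(V_{g'})^{\mathrm{Sp}}\to H^k(V_g)^{\mathrm{Sp}}$ is an isomorphism. 2. The graded $\mathbb Q$-algebra $\bigoplus_k\lim_gH^k(V_g)^{\mathrm{Sp}}$ (with the cup product) is isomorphic, as a graded algebra, to the rational cohomology ring of $S^5\times S^9\times S^{13}\times\cdots$, that is, to the exterior algebra over $\mathbb Q$ on generators $e_0,e_1,e_2,\dots$ with $\deg e_i=4i+5$. 3. For every $k\ge0$, $$\lim_{g\to\infty}PH^k(V_g)^{\mathrm{Sp}}\cong\begin{cases}\mathbb Q&(k\equiv1\bmod 4,\ k\ne1),\\0&(\text{otherwise}).\end{cases}$$ -/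

import Mathlib

open scoped DirectSum TensorProduct

noncomputable section

/-! ### Cohomology of a finite-dimensional rational Lie algebra with trivial coefficients -/

namespace LieCoh

open ExteriorAlgebra (ι ι_add_mul_swap)
open CliffordAlgebra (contractLeft contractLeft_algebraMap_mul contractLeft_algebraMap
  contractLeft_ι_mul contractLeft_ι involute involute_ι involute_involute)

variable (L : Type*) [LieRing L] [LieAlgebra ℚ L] [Module.Finite ℚ L]

/-- The cochain algebra `Λ^* L^*`. -/
abbrev Cochain : Type _ := ExteriorAlgebra ℚ (Module.Dual ℚ L)

/-- The Chevalley-Eilenberg differential (trivial coefficients) on `Λ^* L^*`,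
`d = -1/2 ∑_{i,j} b^i ∧ b^j ∧ ι([b_i, b_j])` for a basis `b` of `L` with dual basis `b^*`,
where `ι` is contraction. It is the antiderivation extending `(d ξ)(x, y) = -ξ([x, y])`. -/
def d : Cochain L →ₗ[ℚ] Cochain L :=
  (-(1 / 2) : ℚ) • ∑ i, ∑ j,
    LinearMap.mulLeft ℚ (ι ℚ ((Module.finBasis ℚ L).coord i) *
        ι ℚ ((Module.finBasis ℚ L).coord j)) ∘ₗ
      contractLeft (Module.Dual.eval ℚ L ⁅Module.finBasis ℚ L i, Module.finBasis ℚ L j⁆)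

theorem ι_mul_ι_comm {M : Type*} [AddCommGroup M] [Module ℚ M] (x y : M)
    (a : ExteriorAlgebra ℚ M) : ι ℚ x * ι ℚ y * a = a * (ι ℚ x * ι ℚ y) := by
  have anti : ∀ u v : M, ι ℚ u * ι ℚ v = -(ι ℚ v * ι ℚ u) := fun u v =>
    eq_neg_of_add_eq_zero_left (ι_add_mul_swap u v)
  induction a using ExteriorAlgebra.induction with
  | algebraMap r => exact (Algebra.commutes r _).symm
  | ι z =>
    rw [mul_assoc, anti y z, mul_neg, ← mul_assoc, anti x z, neg_mul, neg_neg, mul_assoc]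
  | mul a b ha hb => rw [← mul_assoc, ha, mul_assoc, hb, mul_assoc]
  | add a b ha hb => rw [mul_add, ha, hb, add_mul]

theorem contract_mul {M : Type*} [AddCommGroup M] [Module ℚ M] (f : Module.Dual ℚ M)
    (a b : ExteriorAlgebra ℚ M) :
    contractLeft (Q := (0 : QuadraticForm ℚ M)) f (a * b) =
      contractLeft (Q := (0 : QuadraticForm ℚ M)) f a * b +
        involute a * contractLeft (Q := (0 : QuadraticForm ℚ M)) f b := by
  induction a using CliffordAlgebra.left_induction with
  | algebraMap r =>
    rw [contractLeft_algebraMap_mul, contractLeft_algebraMap, zero_mul, zero_add,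
      AlgHom.commutes]
  | add x y hx hy => rw [add_mul, map_add, map_add, map_add, hx, hy]; noncomm_ring
  | ι_mul x m hx =>
    rw [mul_assoc, contractLeft_ι_mul, hx, contractLeft_ι_mul, map_mul, involute_ι, mul_add,
      sub_mul, smul_mul_assoc]
    noncomm_ring

theorem contract_involute {M : Type*} [AddCommGroup M] [Module ℚ M] (f : Module.Dual ℚ M)
    (a : ExteriorAlgebra ℚ M) :
    contractLeft (Q := (0 : QuadraticForm ℚ M)) f (involute a) =
      -involute (contractLeft (Q := (0 : QuadraticForm ℚ M)) f a) := by
  induction a using CliffordAlgebra.left_induction with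
  | algebraMap r => simp
  | add x y hx hy => simp only [map_add, hx, hy]; abel
  | ι_mul x m hx =>
    rw [map_mul, involute_ι, neg_mul, map_neg, contractLeft_ι_mul, contractLeft_ι_mul, hx,
      map_sub, map_smul, map_mul, involute_ι]
    noncomm_ring

theorem d_apply (a : Cochain L) :
    d L a = (-(1 / 2) : ℚ) • ∑ i, ∑ j,
      (ι ℚ ((Module.finBasis ℚ L).coord i) * ι ℚ ((Module.finBasis ℚ L).coord j)) *
        contractLeft (Module.Dual.eval ℚ L ⁅Module.finBasis ℚ L i, Module.finBasis ℚ L j⁆) a := by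
  simp only [d, LinearMap.smul_apply, LinearMap.sum_apply, LinearMap.comp_apply,
    LinearMap.mulLeft_apply]

/-- The differential is an antiderivation (`involute` is `(-1)^k` in degree `k`). -/
theorem d_mul (a b : Cochain L) : d L (a * b) = d L a * b + involute a * d L b := by
  simp only [d_apply, contract_mul, mul_add, Finset.sum_add_distrib, smul_add, Finset.sum_mul,
    Finset.mul_sum, smul_mul_assoc, mul_smul_comm]
  refine congrArg₂ (· + ·) ?_ ?_
  · simp only [mul_assoc]
  · refine congrArg _ (Finset.sum_congr rfl fun i _ => Finset.sum_congr rfl fun j _ => ?_)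
    rw [← mul_assoc, ι_mul_ι_comm, mul_assoc]

theorem d_involute (a : Cochain L) : d L (involute a) = -involute (d L a) := by
  simp only [d_apply, contract_involute, map_smul, map_sum, map_mul, involute_ι,
    mul_neg, Finset.sum_neg_distrib, smul_neg, ι, neg_mul, neg_neg]

theorem d_algebraMap (r : ℚ) : d L (algebraMap ℚ _ r) = 0 := by
  simp [d_apply]

theorem d_ι (ξ : Module.Dual ℚ L) :
    d L (ι ℚ ξ) = (-(1 / 2) : ℚ) • ∑ i, ∑ j,
      ξ ⁅Module.finBasis ℚ L i, Module.finBasis ℚ L j⁆ •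
      (ι ℚ ((Module.finBasis ℚ L).coord i) * ι ℚ ((Module.finBasis ℚ L).coord j)) := by
  rw [d_apply]
  refine congrArg _ (Finset.sum_congr rfl fun i _ => Finset.sum_congr rfl fun j _ => ?_)
  rw [ExteriorAlgebra.ι, contractLeft_ι, ← Algebra.commutes, ← Algebra.smul_def]
  rfl

/-- The algebra of cocycles. -/
def cocycles : Subalgebra ℚ (Cochain L) where
  carrier := {a | d L a = 0}
  mul_mem' := by
    intro a b (ha : d L a = 0) (hb : d L b = 0)
    change d L (a * b) = 0
    rw [d_mul, ha, hb, zero_mul, mul_zero, add_zero]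
  add_mem' := by
    intro a b (ha : d L a = 0) (hb : d L b = 0)
    change d L (a + b) = 0
    rw [map_add, ha, hb, add_zero]
  algebraMap_mem' := d_algebraMap L

/-- The ideal of coboundaries in the algebra of cocycles. -/
def coboundaries : Ideal (cocycles L) where
  carrier := {a | ∃ b, d L b = (a : Cochain L)}
  add_mem' := by
    rintro a b ⟨x, hx⟩ ⟨y, hy⟩
    exact ⟨x + y, by rw [map_add, hx, hy]; rfl⟩
  zero_mem' := ⟨0, map_zero _⟩
  smul_mem' := by
    rintro ⟨c, hc⟩ a ⟨x, hx⟩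
    refine ⟨involute c * x, ?_⟩
    have hc' : d L c = 0 := hc
    rw [d_mul, d_involute, hc', map_zero, neg_zero, zero_mul, zero_add, involute_involute, hx]
    rfl

instance : (coboundaries L).IsTwoSided where
  mul_mem_of_left := by
    rintro a ⟨c, hc⟩ ⟨x, hx⟩
    refine ⟨x * c, ?_⟩
    have hc' : d L c = 0 := hc
    rw [d_mul, hc', mul_zero, add_zero, hx]
    rfl

/-- The cohomology algebra `H^*(L; ℚ)`. -/
def H : Type _ := cocycles L ⧸ coboundaries L

instance : Ring (H L) := fast_instance% Ideal.Quotient.ring (coboundaries L)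

instance : Algebra ℚ (H L) :=
  fast_instance% Ideal.Quotient.algebra ℚ (I := coboundaries L)

/-- The cohomology class of a cocycle. -/
def toH : cocycles L →ₐ[ℚ] H L := Ideal.Quotient.mkₐ ℚ (coboundaries L)

/-- The degree `k` part `H^k(L; ℚ)`: the classes of the cocycles in `Λ^k L^*`. -/
def degree (k : ℕ) : Submodule ℚ (H L) :=
  ((⋀[ℚ]^k (Module.Dual ℚ L)).comap (cocycles L).val.toLinearMap).map (toH L).toLinearMap

instance : SetLike.GradedMonoid (degree L) where
  one_mem := ⟨1, SetLike.GradedOne.one_mem (A := fun i : ℕ => ⋀[ℚ]^i (Module.Dual ℚ L)),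
    map_one (toH L)⟩
  mul_mem := by
    rintro i j _ _ ⟨a, ha, rfl⟩ ⟨b, hb, rfl⟩
    exact ⟨a * b, SetLike.GradedMul.mul_mem (A := fun i : ℕ => ⋀[ℚ]^i (Module.Dual ℚ L)) ha hb,
      map_mul (toH L) a b⟩

variable {L} {L' : Type*} [LieRing L'] [LieAlgebra ℚ L'] [Module.Finite ℚ L']

/-- Pullback of cochains along a homomorphism of Lie algebras. -/
def cochainMap (φ : L →ₗ⁅ℚ⁆ L') : Cochain L' →ₐ[ℚ] Cochain L :=
  ExteriorAlgebra.map (φ : L →ₗ[ℚ] L').dualMap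

theorem sum_change_basis {A : Type*} [Ring A] [Algebra ℚ A] {m n : ℕ} (P : Fin m → Fin n → ℚ)
    (c : Fin n → Fin n → ℚ) (u : Fin m → A) :
    ∑ i, ∑ j, (∑ k, ∑ l, (P i k * P j l) * c k l) • (u i * u j) =
      ∑ k, ∑ l, c k l • ((∑ i, P i k • u i) * ∑ j, P j l • u j) := by
  simp only [Finset.sum_mul_sum, Finset.sum_smul, Finset.smul_sum, smul_mul_smul_comm, smul_smul]
  rw [Finset.sum_congr rfl fun i _ => Finset.sum_comm, Finset.sum_comm]
  refine Finset.sum_congr rfl fun k _ => ?_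
  rw [Finset.sum_congr rfl fun i _ => Finset.sum_comm, Finset.sum_comm]
  refine Finset.sum_congr rfl fun l _ => Finset.sum_congr rfl fun i _ =>
    Finset.sum_congr rfl fun j _ => ?_
  rw [mul_comm]

theorem d_cochainMap (φ : L →ₗ⁅ℚ⁆ L') (a : Cochain L') :
    d L (cochainMap φ a) = cochainMap φ (d L' a) := by
  have hinv : ∀ a : Cochain L', involute (cochainMap φ a) = cochainMap φ (involute a) := by
    have h : involute.comp (cochainMap φ) = (cochainMap φ).comp involute := by
      refine ExteriorAlgebra.hom_ext (LinearMap.ext fun ξ => ?_)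
      simp [cochainMap, ι, CliffordAlgebra.map, ExteriorAlgebra.map]
    exact fun a => DFunLike.congr_fun h a
  induction a using ExteriorAlgebra.induction with
  | algebraMap r => rw [AlgHom.commutes, d_algebraMap, d_algebraMap, map_zero]
  | mul a b ha hb => rw [map_mul, d_mul, d_mul, map_add, map_mul, map_mul, ha, hb, hinv]
  | add a b ha hb => simp only [map_add, ha, hb]
  | ι ξ =>
    set b := Module.finBasis ℚ L
    set b' := Module.finBasis ℚ L'
    have h1 : cochainMap φ (ι ℚ ξ) = ι ℚ ((φ : L →ₗ[ℚ] L').dualMap ξ) :=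
      ExteriorAlgebra.map_apply_ι _ _
    have h2 : ∀ k, cochainMap φ (ι ℚ (b'.coord k)) = ∑ i, b'.repr (φ (b i)) k • ι ℚ (b.coord i) := by
      intro k
      rw [cochainMap, ExteriorAlgebra.map_apply_ι]
      simp only [← map_smul, ← map_sum]
      congr 1
      refine b.ext fun i => ?_
      simp [Module.Basis.coord_apply, Finsupp.single_apply]
    have h3 : ∀ i j, ξ (φ ⁅b i, b j⁆) =
        ∑ k, ∑ l, (b'.repr (φ (b i)) k * b'.repr (φ (b j)) l) * ξ ⁅b' k, b' l⁆ := by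
      intro i j
      conv_lhs => rw [LieHom.map_lie, ← b'.sum_repr (φ (b i)), ← b'.sum_repr (φ (b j))]
      rw [sum_lie, map_sum]
      refine Finset.sum_congr rfl fun k _ => ?_
      rw [lie_sum, map_sum]
      refine Finset.sum_congr rfl fun l _ => ?_
      rw [smul_lie, lie_smul, smul_smul, map_smul, smul_eq_mul]
    rw [h1, d_ι, d_ι, map_smul]
    refine congrArg _ ?_
    simp only [map_sum, map_smul, map_mul]
    have h4 : ∀ i j, (φ : L →ₗ[ℚ] L').dualMap ξ ⁅b i, b j⁆ = ξ (φ ⁅b i, b j⁆) := fun _ _ => rfl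
    change ∑ i, ∑ j, (φ : L →ₗ[ℚ] L').dualMap ξ ⁅b i, b j⁆ • (ι ℚ (b.coord i) * ι ℚ (b.coord j)) =
      ∑ k, ∑ l, ξ ⁅b' k, b' l⁆ •
        (cochainMap φ (ι ℚ (b'.coord k)) * cochainMap φ (ι ℚ (b'.coord l)))
    simp only [h4, h3, h2]
    exact sum_change_basis (fun i k => b'.repr (φ (b i)) k) (fun k l => ξ ⁅b' k, b' l⁆)
      fun i => ι ℚ (b.coord i)

/-- Pullback of cocycles. -/
def cocycleMap (φ : L →ₗ⁅ℚ⁆ L') : cocycles L' →ₐ[ℚ] cocycles L :=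
  ((cochainMap φ).comp (cocycles L').val).codRestrict (cocycles L) fun a => by
    have ha : d L' a = 0 := a.2
    change d L (cochainMap φ a) = 0
    rw [d_cochainMap, ha, map_zero]

/-- The homomorphism `φ^* : H^*(L') → H^*(L)` induced by a homomorphism `φ : L → L'`. -/
def map (φ : L →ₗ⁅ℚ⁆ L') : H L' →ₐ[ℚ] H L :=
  Ideal.quotientMapₐ (coboundaries L) (cocycleMap φ) <| by
    rintro a ⟨x, hx⟩
    exact ⟨cochainMap φ x, by rw [d_cochainMap, hx]; rfl⟩

/-- The cohomology cross product `x ⊗ y ↦ pr₁^* x ∪ pr₂^* y` (the Künneth map). -/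
def cross (L L' : Type*) [LieRing L] [LieAlgebra ℚ L] [Module.Finite ℚ L]
    [LieRing L'] [LieAlgebra ℚ L'] [Module.Finite ℚ L'] :
    H L ⊗[ℚ] H L' →ₗ[ℚ] H (L × L') :=
  TensorProduct.lift ((LinearMap.mul ℚ (H (L × L'))).compl₁₂
    (map (LieHom.fst ℚ L L')).toLinearMap (map (LieHom.snd ℚ L L')).toLinearMap)

end LieCoh

/-! ### The symplectic modules -/

namespace Symp

/-- `H_ℚ = ℚ^{2g}` with symplectic basis `x_i = e_{inl i}`, `y_i = e_{inr i}`. -/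
abbrev Hyp (g : ℕ) : Type := Fin g ⊕ Fin g → ℚ

/-- The intersection pairing, `x_i · y_j = δ_{ij} = - y_j · x_i`, `x_i · x_j = y_i · y_j = 0`. -/
def pairing (g : ℕ) (u v : Hyp g) : ℚ :=
  ∑ i, (u (Sum.inl i) * v (Sum.inr i) - u (Sum.inr i) * v (Sum.inl i))

/-- The symplectic class `ω₀ = ∑ x_i ∧ y_i`. -/
def omega (g : ℕ) : ⋀[ℚ]^2 (Hyp g) :=
  ∑ i, exteriorPower.ιMulti ℚ 2 ![Pi.single (Sum.inl i) 1, Pi.single (Sum.inr i) 1]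

/-- The contraction `Λ² H_ℚ → ℚ`, `u ∧ v ↦ u · v`. -/
def contraction (g : ℕ) : ⋀[ℚ]^2 (Hyp g) →ₗ[ℚ] ℚ :=
  exteriorPower.alternatingMapLinearEquiv
    { toFun := fun w => pairing g (w 0) (w 1)
      map_update_add' := by
        intro _ w i u v
        fin_cases i
        all_goals
          simp only [pairing, Function.update, ← Finset.sum_add_distrib]
          refine Finset.sum_congr rfl fun i _ => by simp; ring
      map_update_smul' := by
        intro _ w i c v
        fin_cases i
        all_goals
          simp only [pairing, Function.update, smul_eq_mul, Finset.mul_sum]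
          refine Finset.sum_congr rfl fun i _ => by simp; ring
      map_eq_zero_of_eq' := by
        intro w i j hij hne
        have h : w 0 = w 1 := by
          fin_cases i <;> fin_cases j <;> simp_all
        simp only [pairing, h]
        exact Finset.sum_eq_zero fun i _ => by ring }

theorem contraction_omega (g : ℕ) : contraction g (omega g) = g := by
  simp [contraction, omega, pairing, Pi.single_apply]

/-- `V_g = Λ² H_ℚ / ℚ ω₀`. -/
def V (g : ℕ) : Type := (⋀[ℚ]^2 (Hyp g)) ⧸ Submodule.span ℚ {omega g}

instance (g : ℕ) : AddCommGroup (V g) :=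
  fast_instance% Submodule.Quotient.addCommGroup (Submodule.span ℚ {omega g})

instance (g : ℕ) : Module ℚ (V g) :=
  fast_instance% Submodule.Quotient.module (Submodule.span ℚ {omega g})

instance (g : ℕ) : Module.Finite ℚ (V g) :=
  Module.Finite.of_surjective (Submodule.span ℚ {omega g}).mkQ (Submodule.mkQ_surjective _)

/-- `V_g` is considered as an abelian Lie algebra. -/
instance (g : ℕ) : LieRing (V g) where
  bracket _ _ := 0
  add_lie _ _ _ := (add_zero 0).symm
  lie_add _ _ _ := (add_zero 0).symm
  lie_self _ := rfl
  leibniz_lie _ _ _ := (add_zero 0).symm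

theorem V.lie_eq_zero {g : ℕ} (x y : V g) : ⁅x, y⁆ = 0 := rfl

instance (g : ℕ) : LieAlgebra ℚ (V g) where
  lie_smul c _ _ := (smul_zero c).symm

/-- The projection `Λ² H_ℚ → V_g`. -/
def proj (g : ℕ) : ⋀[ℚ]^2 (Hyp g) →ₗ[ℚ] V g := (Submodule.span ℚ {omega g}).mkQ

theorem map_omega_aux {g : ℕ} (A : Matrix (Fin g ⊕ Fin g) (Fin g ⊕ Fin g) ℚ) :
    (2 : ℚ) • (exteriorPower.map 2 A.mulVecLin (omega g) : ExteriorAlgebra ℚ (Hyp g)) =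
      -∑ p, ∑ q, (A * Matrix.J (Fin g) ℚ * A.transpose) p q •
        (ExteriorAlgebra.ι ℚ (Pi.single p 1 : Hyp g) *
          ExteriorAlgebra.ι ℚ (Pi.single q 1 : Hyp g)) := by
  have hcol : ∀ i, A.mulVecLin (Pi.single i 1) = ∑ p, A p i • (Pi.single p 1 : Hyp g) := by
    intro i
    ext q
    simp [Finset.sum_apply, Pi.single_apply]
  have hJ : ∀ p q, (A * Matrix.J (Fin g) ℚ * A.transpose) p q =
      ∑ i, (A p (Sum.inr i) * A q (Sum.inl i) - A p (Sum.inl i) * A q (Sum.inr i)) := by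
    intro p q
    simp [Matrix.mul_apply, Matrix.J, Matrix.one_apply, Finset.sum_sub_distrib]
    ring
  have hw : (exteriorPower.map 2 A.mulVecLin (omega g) : ExteriorAlgebra ℚ (Hyp g)) =
      ∑ i, ExteriorAlgebra.ι ℚ (A.mulVecLin (Pi.single (Sum.inl i) 1)) *
        ExteriorAlgebra.ι ℚ (A.mulVecLin (Pi.single (Sum.inr i) 1)) := by
    simp only [omega, map_sum, exteriorPower.map_apply_ιMulti, Submodule.coe_sum,
      exteriorPower.ιMulti_apply_coe, ExteriorAlgebra.ιMulti_apply]
    simp [List.ofFn_succ, -Matrix.mulVecLin_apply]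
  have hcross : ∀ k l, ExteriorAlgebra.ι ℚ (A.mulVecLin (Pi.single k 1)) *
        ExteriorAlgebra.ι ℚ (A.mulVecLin (Pi.single l 1)) =
      ∑ p, ∑ q, (A p k * A q l) • (ExteriorAlgebra.ι ℚ (Pi.single p 1 : Hyp g) *
          ExteriorAlgebra.ι ℚ (Pi.single q 1 : Hyp g)) := by
    intro k l
    simp only [hcol, map_sum, map_smul, Finset.sum_mul_sum, smul_mul_smul_comm]
  have hanti : ∀ u v : Hyp g, (2 : ℚ) • (ExteriorAlgebra.ι ℚ u * ExteriorAlgebra.ι ℚ v) =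
      ExteriorAlgebra.ι ℚ u * ExteriorAlgebra.ι ℚ v -
        ExteriorAlgebra.ι ℚ v * ExteriorAlgebra.ι ℚ u := by
    intro u v
    rw [eq_neg_of_add_eq_zero_right (ExteriorAlgebra.ι_add_mul_swap (R := ℚ) u v), sub_neg_eq_add,
      two_smul]
  rw [hw, Finset.smul_sum]
  have hterm : ∀ i, (2 : ℚ) • (ExteriorAlgebra.ι ℚ (A.mulVecLin (Pi.single (Sum.inl i) 1)) *
        ExteriorAlgebra.ι ℚ (A.mulVecLin (Pi.single (Sum.inr i) 1))) =
      ∑ p, ∑ q, (A p (Sum.inl i) * A q (Sum.inr i) - A p (Sum.inr i) * A q (Sum.inl i)) •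
        (ExteriorAlgebra.ι ℚ (Pi.single p 1 : Hyp g) *
          ExteriorAlgebra.ι ℚ (Pi.single q 1 : Hyp g)) := by
    intro i
    rw [hanti, hcross, hcross, ← Finset.sum_sub_distrib]
    simp only [← Finset.sum_sub_distrib, ← sub_smul]
  rw [Finset.sum_congr rfl fun i _ => hterm i, ← Finset.sum_neg_distrib, Finset.sum_comm]
  refine Finset.sum_congr rfl fun p _ => ?_
  rw [← Finset.sum_neg_distrib, Finset.sum_comm]
  refine Finset.sum_congr rfl fun q _ => ?_
  rw [hJ, ← neg_smul, ← Finset.sum_smul, ← Finset.sum_neg_distrib]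
  simp only [neg_sub]

/-- Symplectic matrices fix `ω₀`. -/
theorem map_omega {g : ℕ} (A : Matrix.symplecticGroup (Fin g) ℚ) :
    exteriorPower.map 2 (A : Matrix (Fin g ⊕ Fin g) (Fin g ⊕ Fin g) ℚ).mulVecLin (omega g) =
      omega g := by
  have h1 := map_omega_aux (A : Matrix (Fin g ⊕ Fin g) (Fin g ⊕ Fin g) ℚ)
  have h2 := map_omega_aux (1 : Matrix (Fin g ⊕ Fin g) (Fin g ⊕ Fin g) ℚ)
  rw [SymplecticGroup.mem_iff.mp A.2] at h1
  rw [SymplecticGroup.mem_iff.mp (one_mem _), ← h1, Matrix.mulVecLin_one,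
    exteriorPower.map_id] at h2
  exact (Subtype.ext (smul_right_injective _ (two_ne_zero' ℚ) h2)).symm

/-- The action of a symplectic matrix on `V_g`, induced by `u ∧ v ↦ A u ∧ A v`. -/
def act {g : ℕ} (A : Matrix.symplecticGroup (Fin g) ℚ) : V g →ₗ⁅ℚ⁆ V g where
  toLinearMap := Submodule.mapQ (Submodule.span ℚ {omega g}) (Submodule.span ℚ {omega g})
    (exteriorPower.map 2 (A : Matrix (Fin g ⊕ Fin g) (Fin g ⊕ Fin g) ℚ).mulVecLin) <| by
      rw [Submodule.span_singleton_le_iff_mem, Submodule.mem_comap, map_omega]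
      exact Submodule.mem_span_singleton_self _
  map_lie' := map_zero _

/-- `H^k(V_g)^{Sp}`. -/
def invariants (g k : ℕ) : Submodule ℚ (LieCoh.H (V g)) :=
  LieCoh.degree (V g) k ⊓
    ⨅ A : Matrix.symplecticGroup (Fin g) ℚ,
      LinearMap.eqLocus (LieCoh.map (act A)).toLinearMap LinearMap.id

/-- The `Sp`-equivariant section `V_g → Λ² H_ℚ` of the projection, `[a] ↦ a - (C(a) / g) ω₀`,
whose image is the kernel of the contraction `C` (for `g = 0` both sides vanish). -/
def splitting (g : ℕ) : V g →ₗ[ℚ] ⋀[ℚ]^2 (Hyp g) :=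
  (Submodule.span ℚ {omega g}).liftQ
    (LinearMap.id - ((g : ℚ)⁻¹ • contraction g).smulRight (omega g)) <| by
      rw [Submodule.span_singleton_le_iff_mem, LinearMap.mem_ker]
      rcases Nat.eq_zero_or_pos g with rfl | hg
      · simp [omega]
      · have : (g : ℚ) ≠ 0 := by positivity
        simp [contraction_omega, this]

/-- The isometric embedding `H_g → H_{g+h} = H_g ⊕ H_h` of the first summand. -/
def inclL (g h : ℕ) : Hyp g →ₗ[ℚ] Hyp (g + h) :=
  (Pi.basisFun ℚ (Fin g ⊕ Fin g)).constr ℚ fun i =>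
    Pi.single (Sum.map (Fin.castAdd h) (Fin.castAdd h) i) 1

/-- The isometric embedding `H_h → H_{g+h} = H_g ⊕ H_h` of the second summand. -/
def inclR (g h : ℕ) : Hyp h →ₗ[ℚ] Hyp (g + h) :=
  (Pi.basisFun ℚ (Fin h ⊕ Fin h)).constr ℚ fun i =>
    Pi.single (Sum.map (Fin.natAdd g) (Fin.natAdd g) i) 1

/-- The map `V_g ≅ ker C_g → ker C_m ≅ V_m` induced by an isometric embedding `H_g → H_m`. -/
def induced {g m : ℕ} (f : Hyp g →ₗ[ℚ] Hyp m) : V g →ₗ[ℚ] V m :=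
  proj m ∘ₗ exteriorPower.map 2 f ∘ₗ splitting g

/-- The stabilization map `V_g → V_{g+1}`. -/
def stab (g : ℕ) : V g →ₗ⁅ℚ⁆ V (g + 1) where
  toLinearMap := induced (inclL g 1)
  map_lie' := map_zero (induced (inclL g 1))

/-- The orthogonal sum map `V_g ⊕ V_h → V_{g+h}`. -/
def orthogonalSum (g h : ℕ) : V g × V h →ₗ⁅ℚ⁆ V (g + h) where
  toLinearMap := (induced (inclL g h)).coprod (induced (inclR g h))
  map_lie' := map_zero ((induced (inclL g h)).coprod (induced (inclR g h)))

/-! ### Stable cohomology -/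

/-- `lim_g H^k(V_g)^{Sp}`: the families of invariant classes, one for each `g`, that restrict to
each other under stabilization. -/
def stable (k : ℕ) : Submodule ℚ (∀ g, LieCoh.H (V g)) where
  carrier := {x | ∀ g, x g ∈ invariants g k ∧ LieCoh.map (stab g) (x (g + 1)) = x g}
  add_mem' hx hy g := ⟨add_mem (hx g).1 (hy g).1, by
    rw [Pi.add_apply, map_add, (hx g).2, (hy g).2, Pi.add_apply]⟩
  zero_mem' _ := ⟨zero_mem _, map_zero _⟩
  smul_mem' c x hx g := ⟨Submodule.smul_mem _ c (hx g).1, by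
    rw [Pi.smul_apply, map_smul, (hx g).2, Pi.smul_apply]⟩

/-- The stable cohomology `⨁ k, stable k` is a graded algebra under the cup product. -/
instance : SetLike.GradedMonoid stable where
  one_mem g := ⟨⟨SetLike.GradedOne.one_mem (A := LieCoh.degree (V g)),
    (Submodule.mem_iInf _).2 fun A => map_one (LieCoh.map (act A))⟩, map_one _⟩
  mul_mem i j x y hx hy g := ⟨⟨SetLike.GradedMul.mul_mem (A := LieCoh.degree (V g))
      (hx g).1.1 (hy g).1.1, (Submodule.mem_iInf _).2 fun A => by
        have h1 : LieCoh.map (act A) (x g) = x g := (Submodule.mem_iInf _).1 (hx g).1.2 A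
        have h2 : LieCoh.map (act A) (y g) = y g := (Submodule.mem_iInf _).1 (hy g).1.2 A
        change LieCoh.map (act A) (x g * y g) = x g * y g
        rw [map_mul, h1, h2]⟩, by
    rw [Pi.mul_apply, map_mul, (hx g).2, (hy g).2, Pi.mul_apply]⟩

/-- The canonical map `lim_g H^k(V_g)^{Sp} → H^k(V_g)^{Sp}`. -/
def eval (k g : ℕ) : stable k →ₗ[ℚ] invariants g k :=
  (LinearMap.proj g ∘ₗ (stable k).subtype).codRestrict _ fun x => (x.2 g).1

/-- `lim_g PH^k(V_g)^{Sp}`: the stable classes `x` with `Δ x = x ⊗ 1 + 1 ⊗ x` for the coproduct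
`Δ` induced by the orthogonal sum maps `V_g ⊕ V_h → V_{g+h}`, the cohomology of `V_g ⊕ V_h` being
identified with the tensor product by the cross product. -/
def primitive (k : ℕ) : Submodule ℚ (stable k) where
  carrier := {x | ∀ g h, LieCoh.map (orthogonalSum g h) (x.1 (g + h)) =
    LieCoh.cross (V g) (V h) (x.1 g ⊗ₜ 1 + 1 ⊗ₜ x.1 h)}
  add_mem' {x y} hx hy g h := by
    simp only [Set.mem_ofPred_eq, map_add] at hx hy
    simp only [Submodule.coe_add, Pi.add_apply, map_add, hx g h, hy g h, TensorProduct.add_tmul,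
      TensorProduct.tmul_add]
    abel
  zero_mem' g h := by simp
  smul_mem' c x hx g h := by
    simp only [Set.mem_ofPred_eq] at hx
    simp only [Submodule.coe_smul, Pi.smul_apply, map_smul, hx g h, TensorProduct.tmul_smul,
      ← TensorProduct.smul_tmul', ← smul_add]

end Symp

/-! ### The cohomology of `S⁵ × S⁹ × S¹³ × ⋯` -/

/-- The rational cohomology ring of `S⁵ × S⁹ × S¹³ × ⋯`: the exterior algebra on generators
`e_0, e_1, e_2, …`, with `e_i` (the fundamental class of the sphere `S^{4i+5}`) in
degree `4i + 5`. -/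
abbrev SphereProduct : Type := ExteriorAlgebra ℚ (ℕ →₀ ℚ)

/-- The degree `k` part of the cohomology ring of `S⁵ × S⁹ × S¹³ × ⋯`: the span of the products
of generators of total degree `k`. -/
def SphereProduct.degree (k : ℕ) : Submodule ℚ SphereProduct :=
  Submodule.span ℚ {a | ∃ l : List ℕ, (l.map fun i => 4 * i + 5).sum = k ∧
    a = (l.map fun i => ExteriorAlgebra.ι ℚ (Finsupp.single i 1)).prod}

end

/-!
# Stable symplectic invariants in the cohomology of `Λ²H / ω₀`

Since `V_g` is abelian, `H^*(V_g)` is the exterior algebra `Λ^* V_g^*`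
(`LieCoh.abelianEquiv`), so the invariant cohomology consists of the alternating invariants of
bivectors. Identify `V_g` with the traceless bivectors, let `Θ` be the generic skew-symmetric matrix,
whose entries are linear forms on `V_g` regarded as elements of degree 1 of `Λ^* V_g^*`, and let `Ω`
be the matrix of the intersection pairing. The basic invariants are the trace forms `tr (ΘΩ)ⁿ`.
Cyclicity of the trace kills those of even `n`, transposition those with `n ≡ 3 mod 4`
(`ExteriorMatrix.trace_pow_eq_zero`), and `tr ΘΩ` vanishes on traceless bivectors. The others, of
degrees `5, 9, 13, …`, anticommute and define a homomorphism `Symp.traceHom` from the exterior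
algebra on `e_0, e_1, …` to `Λ^* V_g^*`. Trace forms are preserved by the maps induced by isometric
embeddings and are additive for orthogonal sums (`Symp.map_induced_traceForm`,
`Symp.map_coprod_traceForm`).

*The trace forms generate the invariants of degree `k` for `g ≥ 2k`* (`Symp.mem_map_traceHom`). By
the iterated Euler identity (`Symp.factorial_smul_eq_sum`), a form is a combination of products of
entries of `Θ` with the values of its polarization as coefficients. If the form is invariant, its
polarization is an invariant multilinear form in `2k` vectors, hence a combination of products of
pairings along perfect matchings (`Symp.mem_span_matchings`). This stable case of the first
fundamental theorem has a direct proof: a generic family of at most `g` vectors is moved by the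
symplectic group to a normal form that depends only on its Gram matrix; expanding the normal form in
the symplectic basis, invariance under the diagonal torus leaves only the terms that belong to perfect
matchings. Finally, contracting the entries of `Θ` along a perfect matching gives a product of traces
(`ExteriorMatrix.contraction_mem`).

*The trace forms are independent for large `g`.* In the exterior algebra on `e_0, …, e_{r-1}` every
nonzero element has a multiple equal to the top product (`SphereProduct.exists_mul_eq_top`), so it
suffices that the product of the first `r` trace forms does not vanish
(`Symp.traceHom_top_ne_zero`). Restrict it to the subspace spanned by the bivectors
`x_p ∧ y_{next p}`, for a permutation `next` with disjoint cycles of lengths `5, 9, …, 4r + 1`. There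
`ΘΩ` becomes a weighted permutation matrix and the trace form of degree `4j + 5` a nonzero multiple of
the product of the coordinates along the `j`-th cycle.

Thus the trace forms identify the exterior algebra with the stable invariant cohomology. *Primitive
classes:* the generators are primitive by additivity of the trace forms. Conversely, restriction
along the diagonal `V_g → V_g ⊕ V_g → V_{2g}` doubles every generator, hence multiplies words of
length `j` by `2 ^ j`, whereas it sends a primitive class `x` to `2x`. So a primitive class is a
combination of generators.
-/

noncomputable section

/-! ### Graded commutativity and contractions in exterior algebras -/

namespace ExteriorAux

open ExteriorAlgebra (ι)
open CliffordAlgebra (contractLeft involute involute_ι contractLeft_ι_mul)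

variable {M : Type*} [AddCommGroup M] [Module ℚ M]

theorem mul_ι (x : ExteriorAlgebra ℚ M) (v : M) : x * ι ℚ v = ι ℚ v * involute x := by
  induction x using CliffordAlgebra.left_induction with
  | algebraMap r => rw [AlgHom.commutes, Algebra.commutes]
  | add x y hx hy => rw [add_mul, hx, hy, map_add, mul_add]
  | ι_mul x m hx =>
    have h := eq_neg_of_add_eq_zero_left (ExteriorAlgebra.ι_add_mul_swap (R := ℚ) m v)
    change ι ℚ m * x * ι ℚ v = ι ℚ v * involute (ι ℚ m * x)
    rw [map_mul, mul_assoc, hx, ← mul_assoc, h]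
    change _ = ι ℚ v * (involute (CliffordAlgebra.ι _ m) * _)
    rw [involute_ι]
    simp only [neg_mul, mul_neg, mul_assoc]

theorem mem_succ_induction {k : ℕ} {p : ExteriorAlgebra ℚ M → Prop}
    (hmul : ∀ v, ∀ x ∈ ⋀[ℚ]^k M, p (ι ℚ v * x)) (hadd : ∀ x y, p x → p y → p (x + y))
    {x : ExteriorAlgebra ℚ M} (hx : x ∈ ⋀[ℚ]^(k + 1) M) : p x := by
  change x ∈ LinearMap.range (ι ℚ) ^ (k + 1) at hx
  rw [pow_succ'] at hx
  refine Submodule.mul_induction_on hx ?_ hadd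
  rintro _ ⟨v, rfl⟩ y hy
  exact hmul v y hy

theorem ι_mem (v : M) : ι ℚ v ∈ ⋀[ℚ]^1 M := by
  change _ ∈ LinearMap.range (ι ℚ) ^ 1
  rw [pow_one]
  exact ⟨v, rfl⟩

theorem mul_mem_exteriorPower {i j : ℕ} {x y : ExteriorAlgebra ℚ M} (hx : x ∈ ⋀[ℚ]^i M)
    (hy : y ∈ ⋀[ℚ]^j M) : x * y ∈ ⋀[ℚ]^(i + j) M :=
  SetLike.GradedMul.mul_mem (A := fun i : ℕ => ⋀[ℚ]^i M) hx hy

theorem mem_exteriorPower_zero {x : ExteriorAlgebra ℚ M} (hx : x ∈ ⋀[ℚ]^0 M) :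
    algebraMap ℚ _ (ExteriorAlgebra.algebraMapInv x) = x := by
  change x ∈ LinearMap.range (ι ℚ) ^ 0 at hx
  rw [pow_zero] at hx
  obtain ⟨r, rfl⟩ := Submodule.mem_one.1 hx
  rw [ExteriorAlgebra.algebraMap_leftInverse M r]

theorem involute_of_mem {k : ℕ} {x : ExteriorAlgebra ℚ M} (hx : x ∈ ⋀[ℚ]^k M) :
    involute x = (-1 : ℚ) ^ k • x := by
  induction k generalizing x with
  | zero => rw [← mem_exteriorPower_zero hx, AlgHom.commutes, pow_zero, one_smul]
  | succ k ih =>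
    refine mem_succ_induction (p := fun x => involute x = (-1 : ℚ) ^ (k + 1) • x) ?_ ?_ hx
    · intro v x hx
      rw [map_mul, ih hx, pow_succ]
      erw [involute_ι]
      simp
    · intro x y hx hy
      rw [map_add, hx, hy, smul_add]

/-- Graded commutativity of the exterior algebra. -/
theorem graded_comm {i j : ℕ} {x y : ExteriorAlgebra ℚ M} (hx : x ∈ ⋀[ℚ]^i M)
    (hy : y ∈ ⋀[ℚ]^j M) : x * y = (-1 : ℚ) ^ (i * j) • (y * x) := by
  induction j generalizing y with
  | zero => rw [← mem_exteriorPower_zero hy, ← Algebra.commutes]; simp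
  | succ j ih =>
    refine mem_succ_induction (p := fun y => x * y = (-1 : ℚ) ^ (i * (j + 1)) • (y * x)) ?_ ?_ hy
    · intro v y hy
      rw [← mul_assoc, mul_ι, involute_of_mem hx, mul_smul_comm, smul_mul_assoc, mul_assoc, ih hy,
        mul_smul_comm, smul_smul, mul_assoc, ← pow_add]
      congr 2
      ring
    · intro a b ha hb
      rw [mul_add, ha, hb, add_mul, smul_add]

theorem contractLeft_ι_mul' (φ : Module.Dual ℚ M) (v : M) (x : ExteriorAlgebra ℚ M) :
    contractLeft (Q := (0 : QuadraticForm ℚ M)) φ (ι ℚ v * x) =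
      φ v • x - ι ℚ v * contractLeft (Q := (0 : QuadraticForm ℚ M)) φ x :=
  contractLeft_ι_mul φ v x

theorem contractLeft_zero_degree (φ : Module.Dual ℚ M) {x : ExteriorAlgebra ℚ M}
    (hx : x ∈ ⋀[ℚ]^0 M) : contractLeft (Q := (0 : QuadraticForm ℚ M)) φ x = 0 := by
  rw [← mem_exteriorPower_zero hx]
  exact CliffordAlgebra.contractLeft_algebraMap ..

theorem contractLeft_mem (φ : Module.Dual ℚ M) {k : ℕ} {x : ExteriorAlgebra ℚ M}
    (hx : x ∈ ⋀[ℚ]^(k + 1) M) :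
    contractLeft (Q := (0 : QuadraticForm ℚ M)) φ x ∈ ⋀[ℚ]^k M := by
  induction k generalizing x with
  | zero =>
    refine mem_succ_induction
      (p := fun x => contractLeft (Q := (0 : QuadraticForm ℚ M)) φ x ∈ ⋀[ℚ]^0 M) ?_ ?_ hx
    · intro v x hx
      rw [contractLeft_ι_mul', contractLeft_zero_degree φ hx, mul_zero, sub_zero]
      exact Submodule.smul_mem _ _ hx
    · intro x y hx hy
      rw [map_add]
      exact add_mem hx hy
  | succ k ih =>
    refine mem_succ_induction
      (p := fun x => contractLeft (Q := (0 : QuadraticForm ℚ M)) φ x ∈ ⋀[ℚ]^(k + 1) M) ?_ ?_ hx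
    · intro v x hx
      rw [contractLeft_ι_mul']
      refine sub_mem (Submodule.smul_mem _ _ hx) ?_
      rw [add_comm]
      exact mul_mem_exteriorPower (ι_mem v) (ih hx)
    · intro x y hx hy
      rw [map_add]
      exact add_mem hx hy

/-- Euler's identity: for a resolution `∑ φᵢ ⊗ ξᵢ` of the identity, `∑ ξᵢ ∧ (φᵢ ⌋ x)` is the
degree of `x` times `x`. -/
theorem euler {σ : Type*} [Fintype σ] (ξ : σ → M) (φ : σ → Module.Dual ℚ M)
    (h : ∀ η, ∑ i, φ i η • ξ i = η) {k : ℕ} {x : ExteriorAlgebra ℚ M} (hx : x ∈ ⋀[ℚ]^k M) :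
    ∑ i, ι ℚ (ξ i) * contractLeft (Q := (0 : QuadraticForm ℚ M)) (φ i) x = (k : ℚ) • x := by
  induction k generalizing x with
  | zero => simp [contractLeft_zero_degree _ hx]
  | succ k ih =>
    refine mem_succ_induction (p := fun x => ∑ i, ι ℚ (ξ i) *
      contractLeft (Q := (0 : QuadraticForm ℚ M)) (φ i) x = ((k + 1 : ℕ) : ℚ) • x) ?_ ?_ hx
    · intro v x hx
      have h1 : ∀ i, ι ℚ (ξ i) * contractLeft (Q := (0 : QuadraticForm ℚ M)) (φ i) (ι ℚ v * x) =
          ι ℚ (φ i v • ξ i) * x +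
            ι ℚ v * (ι ℚ (ξ i) * contractLeft (Q := (0 : QuadraticForm ℚ M)) (φ i) x) := by
        intro i
        have h2 := eq_neg_of_add_eq_zero_left (ExteriorAlgebra.ι_add_mul_swap (R := ℚ) (ξ i) v)
        rw [contractLeft_ι_mul', mul_sub, ← mul_assoc, h2, map_smul]
        simp [mul_assoc]
      rw [Finset.sum_congr rfl fun i _ => h1 i, Finset.sum_add_distrib, ← Finset.sum_mul,
        ← map_sum, h, ← Finset.mul_sum, ih hx, mul_smul_comm]
      push_cast
      rw [add_smul, one_smul, add_comm]
    · intro x y hx hy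
      simp only [map_add, mul_add, Finset.sum_add_distrib, hx, hy, smul_add]

/-- The iterated contraction `x ↦ φₙ₋₁ ⌋ (⋯ ⌋ (φ₀ ⌋ x))`, as a multilinear map in the `φᵢ`. -/
def contractMulti : (n : ℕ) → ExteriorAlgebra ℚ M →ₗ[ℚ]
    MultilinearMap ℚ (fun _ : Fin n => Module.Dual ℚ M) (ExteriorAlgebra ℚ M)
  | 0 => (MultilinearMap.constLinearEquivOfIsEmpty ℚ ℚ
      (fun _ : Fin 0 => Module.Dual ℚ M) (ExteriorAlgebra ℚ M)).toLinearMap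
  | n + 1 =>
    { toFun := fun x => LinearMap.uncurryLeft (M := fun _ : Fin (n + 1) => Module.Dual ℚ M)
        (contractMulti n ∘ₗ (contractLeft (Q := (0 : QuadraticForm ℚ M))).flip x)
      map_add' := by intro x y; ext v; simp
      map_smul' := by intro c x; ext v; simp }

theorem contractMulti_succ (n : ℕ) (x : ExteriorAlgebra ℚ M) (v : Fin (n + 1) → Module.Dual ℚ M) :
    contractMulti (n + 1) x v =
      contractMulti n (contractLeft (Q := (0 : QuadraticForm ℚ M)) (v 0) x) (Fin.tail v) := rfl

theorem contractMulti_mem {k : ℕ} {x : ExteriorAlgebra ℚ M} (hx : x ∈ ⋀[ℚ]^k M)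
    (v : Fin k → Module.Dual ℚ M) : contractMulti k x v ∈ ⋀[ℚ]^0 M := by
  induction k generalizing x with
  | zero => exact hx
  | succ k ih => exact ih (contractLeft_mem _ hx) _

/-- Iterated Euler identity: an element of degree `k` is recovered from its full contractions. -/
theorem euler_multi {σ : Type*} [Fintype σ] (ξ : σ → M) (φ : σ → Module.Dual ℚ M)
    (h : ∀ η, ∑ i, φ i η • ξ i = η) {k : ℕ} {x : ExteriorAlgebra ℚ M} (hx : x ∈ ⋀[ℚ]^k M) :
    ∑ s : Fin k → σ, (List.ofFn fun a => ι ℚ (ξ (s a))).prod *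
      contractMulti k x (fun a => φ (s a)) = (k.factorial : ℚ) • x := by
  induction k generalizing x with
  | zero => simp [contractMulti]
  | succ k ih =>
    rw [← (Fin.consEquiv fun _ : Fin (k + 1) => σ).sum_comp, Fintype.sum_prod_type]
    simp only [Fin.consEquiv, Equiv.coe_fn_mk, List.ofFn_succ, Fin.cons_zero, Fin.cons_succ,
      List.prod_cons, contractMulti_succ, mul_assoc, ← Finset.mul_sum]
    have h1 : ∀ i, ι ℚ (ξ i) * ∑ s : Fin k → σ, (List.ofFn fun a => ι ℚ (ξ (s a))).prod *
        contractMulti k (contractLeft (Q := (0 : QuadraticForm ℚ M)) (φ i) x) (fun a => φ (s a)) =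
        (k.factorial : ℚ) •
          (ι ℚ (ξ i) * contractLeft (Q := (0 : QuadraticForm ℚ M)) (φ i) x) := by
      intro i
      rw [ih (contractLeft_mem _ hx), mul_smul_comm]
    refine (Finset.sum_congr rfl fun i _ => h1 i).trans ?_
    rw [← Finset.smul_sum, euler ξ φ h hx, smul_smul, Nat.factorial_succ]
    congr 1
    push_cast
    ring

variable {N : Type*} [AddCommGroup N] [Module ℚ N]

theorem contractLeft_map (f : M →ₗ[ℚ] N) (φ : Module.Dual ℚ N) (x : ExteriorAlgebra ℚ M) :
    contractLeft (Q := (0 : QuadraticForm ℚ N)) φ (ExteriorAlgebra.map f x) =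
      ExteriorAlgebra.map f (contractLeft (Q := (0 : QuadraticForm ℚ M)) (φ ∘ₗ f) x) := by
  induction x using CliffordAlgebra.left_induction with
  | algebraMap r =>
    rw [AlgHom.commutes]
    erw [CliffordAlgebra.contractLeft_algebraMap, CliffordAlgebra.contractLeft_algebraMap]
    rw [map_zero]
  | add x y hx hy => simp only [map_add, hx, hy]
  | ι_mul x m hx =>
    change contractLeft (Q := (0 : QuadraticForm ℚ N)) φ (ExteriorAlgebra.map f (ι ℚ m * x)) =
      ExteriorAlgebra.map f (contractLeft (Q := (0 : QuadraticForm ℚ M)) (φ ∘ₗ f) (ι ℚ m * x))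
    rw [map_mul, ExteriorAlgebra.map_apply_ι, contractLeft_ι_mul', contractLeft_ι_mul', hx]
    simp

theorem contractMulti_map (f : M →ₗ[ℚ] N) {k : ℕ} (v : Fin k → Module.Dual ℚ N)
    (x : ExteriorAlgebra ℚ M) :
    contractMulti k (ExteriorAlgebra.map f x) v =
      ExteriorAlgebra.map f (contractMulti k x fun a => v a ∘ₗ f) := by
  induction k generalizing x with
  | zero => rfl
  | succ k ih =>
    rw [contractMulti_succ, contractMulti_succ, contractLeft_map, ih]
    rfl

/-- A product of distinct members of a family with a dual family does not vanish. -/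
theorem prod_ι_ne_zero {P : Type*} (w : P → M) (φ : P → Module.Dual ℚ M)
    (h1 : ∀ p, φ p (w p) = 1) (h0 : ∀ p q, p ≠ q → φ p (w q) = 0) (l : List P) (hl : l.Nodup) :
    (l.map fun p => ι ℚ (w p)).prod ≠ 0 := by
  induction l with
  | nil => simp
  | cons p l ih =>
    rw [List.nodup_cons] at hl
    -- contraction with the dual vector of `p` removes the first factor
    have h2 : ∀ l' : List P, p ∉ l' → contractLeft (Q := (0 : QuadraticForm ℚ M))
        (φ p) (l'.map fun p => ι ℚ (w p)).prod = 0 := by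
      intro l' hp
      induction l' with
      | nil => exact CliffordAlgebra.contractLeft_one ..
      | cons q l' ih' =>
        rw [List.mem_cons, not_or] at hp
        rw [List.map_cons, List.prod_cons, contractLeft_ι_mul', ih' hp.2, h0 p q hp.1]
        simp
    intro h
    apply ih hl.2
    have h3 := congrArg (contractLeft (Q := (0 : QuadraticForm ℚ M)) (φ p)) h
    rw [List.map_cons, List.prod_cons, contractLeft_ι_mul', h2 l hl.1, h1] at h3
    simpa using h3

end ExteriorAux

/-! ### The exterior algebra on generators of degrees `5, 9, 13, …` -/

namespace SphereProduct

open ExteriorAux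
open CliffordAlgebra (involute)

/-- The generator `e_i` of degree `4i + 5`. -/
def gen (i : ℕ) : SphereProduct := ExteriorAlgebra.ι ℚ (Finsupp.single i 1)

theorem gen_mul_self (i : ℕ) : gen i * gen i = 0 := ExteriorAlgebra.ι_sq_zero _

theorem mul_gen (x : SphereProduct) (i : ℕ) : x * gen i = gen i * involute x := mul_ι _ _

theorem involute_gen (i : ℕ) : involute (gen i) = -gen i := CliffordAlgebra.involute_ι _

/-- The subalgebra generated by `e_i`, `i < r`. -/
def below (r : ℕ) : Subalgebra ℚ SphereProduct := Algebra.adjoin ℚ (gen '' Set.Iio r)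

theorem gen_mem_below {i r : ℕ} (h : i < r) : gen i ∈ below r :=
  Algebra.subset_adjoin ⟨i, h, rfl⟩

theorem below_mono {r s : ℕ} (h : r ≤ s) : below r ≤ below s :=
  Algebra.adjoin_mono (Set.image_mono (Set.Iio_subset_Iio h))

theorem involute_mem_below {r : ℕ} {x : SphereProduct} (hx : x ∈ below r) :
    involute x ∈ below r := by
  refine Algebra.adjoin_induction (p := fun x _ => involute x ∈ below r) ?_ ?_ ?_ ?_ hx
  · rintro _ ⟨i, hi, rfl⟩
    rw [involute_gen]
    exact neg_mem (gen_mem_below hi)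
  · intro c
    rw [AlgHom.commutes]
    exact Subalgebra.algebraMap_mem _ c
  · intro x y _ _ hx hy
    rw [map_add]
    exact add_mem hx hy
  · intro x y _ _ hx hy
    rw [map_mul]
    exact mul_mem hx hy

theorem exists_eq_gen_mul_add {r : ℕ} {x : SphereProduct} (hx : x ∈ below (r + 1)) :
    ∃ y ∈ below r, ∃ z ∈ below r, x = gen r * y + z := by
  refine Algebra.adjoin_induction
    (p := fun x _ => ∃ y ∈ below r, ∃ z ∈ below r, x = gen r * y + z) ?_ ?_ ?_ ?_ hx
  · rintro _ ⟨i, hi, rfl⟩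
    rcases (Nat.lt_succ_iff_lt_or_eq.1 hi) with h | rfl
    · exact ⟨0, zero_mem _, gen i, gen_mem_below h, by simp⟩
    · exact ⟨1, one_mem _, 0, zero_mem _, by simp⟩
  · intro c
    exact ⟨0, zero_mem _, _, Subalgebra.algebraMap_mem _ c, by simp⟩
  · rintro _ _ _ _ ⟨y, hy, z, hz, rfl⟩ ⟨y', hy', z', hz', rfl⟩
    exact ⟨y + y', add_mem hy hy', z + z', add_mem hz hz', by rw [mul_add]; abel⟩
  · rintro _ _ _ _ ⟨y, hy, z, hz, rfl⟩ ⟨y', hy', z', hz', rfl⟩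
    refine ⟨y * z' + involute z * y',
      add_mem (mul_mem hy hz') (mul_mem (involute_mem_below hz) hy'),
      z * z', mul_mem hz hz', ?_⟩
    have h1 : gen r * y * (gen r * y') = 0 := by
      rw [← mul_assoc, mul_assoc (gen r) y, mul_gen, ← mul_assoc, gen_mul_self]
      simp
    have h2 : z * (gen r * y') = gen r * (involute z * y') := by
      rw [← mul_assoc, mul_gen, mul_assoc]
    rw [add_mul, mul_add, mul_add, h1, h2, mul_add, mul_assoc]
    abel

/-- The product `e_{r-1} ⋯ e_1 e_0`. -/
def top : ℕ → SphereProduct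
  | 0 => 1
  | r + 1 => gen r * top r

theorem exists_mul_eq_top {r : ℕ} {x : SphereProduct} (hx : x ∈ below r) (h0 : x ≠ 0) :
    ∃ u ∈ below r, u * x = top r := by
  induction r generalizing x with
  | zero =>
    have : below 0 = ⊥ := by simp [below]
    rw [this, Algebra.mem_bot] at hx
    obtain ⟨c, rfl⟩ := hx
    have hc : c ≠ 0 := by rintro rfl; simp at h0
    refine ⟨algebraMap ℚ _ c⁻¹, Subalgebra.algebraMap_mem _ _, ?_⟩
    rw [← map_mul, inv_mul_cancel₀ hc, map_one, top]
  | succ r ih =>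
    obtain ⟨y, hy, z, hz, rfl⟩ := exists_eq_gen_mul_add hx
    have hr := below_mono r.le_succ
    have hg : gen r ∈ below (r + 1) := gen_mem_below r.lt_succ_self
    by_cases h : z = 0
    · subst h
      have hy0 : y ≠ 0 := by rintro rfl; simp at h0
      obtain ⟨u, hu, h1⟩ := ih hy hy0
      refine ⟨involute u, hr (involute_mem_below hu), ?_⟩
      rw [add_zero, ← mul_assoc, mul_gen, CliffordAlgebra.involute_involute, mul_assoc, h1, top]
    · obtain ⟨u, hu, h1⟩ := ih hz h
      refine ⟨gen r * u, mul_mem hg (hr hu), ?_⟩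
      have h2 : gen r * u * (gen r * y) = 0 := by
        rw [← mul_assoc, mul_assoc (gen r) u, mul_gen, ← mul_assoc, gen_mul_self]
        simp
      rw [mul_add, h2, zero_add, mul_assoc, h1, top]

/-- A homomorphism that does not kill the top product of `e_i`, `i < r`, is injective on the
subalgebra generated by these elements, since the top product lies in
every nonzero left ideal of this subalgebra. -/
theorem eq_zero_of_map_eq_zero {R : Type*} [Ring R] [Algebra ℚ R] (φ : SphereProduct →ₐ[ℚ] R)
    {r : ℕ} (h : φ (top r) ≠ 0) {x : SphereProduct} (hx : x ∈ below r) (h0 : φ x = 0) : x = 0 := by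
  by_contra hne
  obtain ⟨u, _, hu⟩ := exists_mul_eq_top hx hne
  apply h
  rw [← hu, map_mul, h0, mul_zero]

theorem prod_mem_degree (l : List ℕ) :
    (l.map gen).prod ∈ degree (l.map fun i => 4 * i + 5).sum :=
  Submodule.subset_span ⟨l, rfl, rfl⟩

theorem gen_mem_degree (i : ℕ) : gen i ∈ degree (4 * i + 5) := by
  simpa using prod_mem_degree [i]

theorem one_mem_degree : (1 : SphereProduct) ∈ degree 0 := by simpa using prod_mem_degree []

theorem mul_mem_degree {i j : ℕ} {x y : SphereProduct} (hx : x ∈ degree i) (hy : y ∈ degree j) :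
    x * y ∈ degree (i + j) := by
  have h : degree i * degree j ≤ degree (i + j) := by
    rw [degree, degree, Submodule.span_mul_span, Submodule.span_le]
    rintro _ ⟨_, ⟨l, hl, rfl⟩, _, ⟨l', hl', rfl⟩, rfl⟩
    have h := prod_mem_degree (l ++ l')
    rw [List.map_append, List.map_append, List.sum_append, List.prod_append, hl, hl'] at h
    exact h
  exact h (Submodule.mul_mem_mul hx hy)

theorem degree_le_below (k : ℕ) {x : SphereProduct} (hx : x ∈ degree k) : x ∈ below k := by
  have h : degree k ≤ Subalgebra.toSubmodule (below k) := by
    rw [degree, Submodule.span_le]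
    rintro _ ⟨l, hl, rfl⟩
    change _ ∈ below k
    refine list_prod_mem ?_
    intro a ha
    obtain ⟨i, hi, rfl⟩ := List.mem_map.1 ha
    refine gen_mem_below ?_
    have : 4 * i + 5 ≤ (l.map fun i => 4 * i + 5).sum :=
      List.single_le_sum (fun _ _ => Nat.zero_le _) _ (List.mem_map.2 ⟨i, hi, rfl⟩)
    omega
  exact h hx

theorem iSup_degree : ⨆ k, degree k = ⊤ := by
  rw [eq_top_iff]
  rintro x -
  have key : ∀ x y : SphereProduct, x ∈ ⨆ k, degree k → y ∈ ⨆ k, degree k →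
      x * y ∈ ⨆ k, degree k := by
    intro x y hx hy
    induction hx using Submodule.iSup_induction' with
    | mem i x hx =>
      induction hy using Submodule.iSup_induction' with
      | mem j y hy => exact Submodule.mem_iSup_of_mem _ (mul_mem_degree hx hy)
      | zero => simp
      | add y y' _ _ hy hy' => rw [mul_add]; exact add_mem hy hy'
    | zero => simp
    | add x x' _ _ hx hx' => rw [add_mul]; exact add_mem hx hx'
  induction x using ExteriorAlgebra.induction with
  | algebraMap r =>
    rw [Algebra.algebraMap_eq_smul_one]
    exact Submodule.smul_mem _ _ (Submodule.mem_iSup_of_mem 0 one_mem_degree)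
  | ι v =>
    induction v using Finsupp.induction_linear with
    | zero => simp
    | add v w hv hw => rw [map_add]; exact add_mem hv hw
    | single i c =>
      have : Finsupp.single i c = c • Finsupp.single i (1 : ℚ) := by simp
      rw [this, map_smul]
      exact Submodule.smul_mem _ _ (Submodule.mem_iSup_of_mem _ (gen_mem_degree i))
  | mul a b ha hb => exact key a b ha hb
  | add a b ha hb => exact add_mem ha hb

theorem exists_mem_below (x : SphereProduct) : ∃ r, x ∈ below r := by
  have hx : x ∈ ⨆ k, degree k := by rw [iSup_degree]; trivial
  induction hx using Submodule.iSup_induction' with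
  | mem i x hx => exact ⟨i, degree_le_below i hx⟩
  | zero => exact ⟨0, zero_mem _⟩
  | add x y _ _ hx hy =>
    obtain ⟨r, hr⟩ := hx
    obtain ⟨s, hs⟩ := hy
    exact ⟨max r s, add_mem (below_mono (le_max_left _ _) hr) (below_mono (le_max_right _ _) hs)⟩

/-- The homomorphism that doubles every generator. -/
def double : SphereProduct →ₐ[ℚ] SphereProduct :=
  ExteriorAlgebra.map ((2 : ℚ) • LinearMap.id)

theorem double_gen (i : ℕ) : double (gen i) = (2 : ℚ) • gen i := by
  rw [double, gen, ExteriorAlgebra.map_apply_ι, LinearMap.smul_apply, map_smul, LinearMap.id_apply]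

theorem double_of_mem {j : ℕ} {x : SphereProduct} (hx : x ∈ ⋀[ℚ]^j (ℕ →₀ ℚ)) :
    double x = (2 : ℚ) ^ j • x := by
  induction j generalizing x with
  | zero => rw [← mem_exteriorPower_zero hx, AlgHom.commutes, pow_zero, one_smul]
  | succ j ih =>
    refine mem_succ_induction (p := fun x => double x = (2 : ℚ) ^ (j + 1) • x) ?_ ?_ hx
    · intro v x hx
      rw [map_mul, ih hx, double, ExteriorAlgebra.map_apply_ι, LinearMap.smul_apply, map_smul,
        LinearMap.id_apply, smul_mul_smul_comm, pow_succ']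
    · intro x y hx hy
      rw [map_add, hx, hy, smul_add]

/-- The word-length component of an element. -/
def lengthComponent (j : ℕ) : SphereProduct →ₗ[ℚ] SphereProduct :=
  GradedAlgebra.proj (fun i : ℕ => ⋀[ℚ]^i (ℕ →₀ ℚ)) j

theorem lengthComponent_of_mem {j : ℕ} {x : SphereProduct} (hx : x ∈ ⋀[ℚ]^j (ℕ →₀ ℚ)) :
    lengthComponent j x = x := by
  rw [lengthComponent, GradedAlgebra.proj_apply,
    DirectSum.decompose_of_mem_same (fun i : ℕ => ⋀[ℚ]^i (ℕ →₀ ℚ)) hx]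

theorem lengthComponent_of_mem_ne {i j : ℕ} {x : SphereProduct} (hx : x ∈ ⋀[ℚ]^i (ℕ →₀ ℚ))
    (h : i ≠ j) : lengthComponent j x = 0 := by
  rw [lengthComponent, GradedAlgebra.proj_apply,
    DirectSum.decompose_of_mem_ne (fun i : ℕ => ⋀[ℚ]^i (ℕ →₀ ℚ)) hx h]

theorem lengthComponent_double (j : ℕ) (x : SphereProduct) :
    lengthComponent j (double x) = (2 : ℚ) ^ j • lengthComponent j x := by
  induction x using DirectSum.Decomposition.inductionOn (fun i : ℕ => ⋀[ℚ]^i (ℕ →₀ ℚ)) with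
  | zero => simp
  | @homogeneous i m =>
    rw [double_of_mem m.2, map_smul]
    by_cases h : i = j
    · subst h; rfl
    · rw [lengthComponent_of_mem_ne m.2 h, smul_zero, smul_zero]
  | add x y hx hy => simp only [map_add, hx, hy, smul_add]

/-- The doubling map acts on words of length `j` as `2 ^ j`, so its eigenvectors of eigenvalue `2`
have length `1`. -/
theorem eq_lengthComponent_one {x : SphereProduct} (h : double x = (2 : ℚ) • x) :
    lengthComponent 1 x = x := by
  have h0 : ∀ j, j ≠ 1 → lengthComponent j x = 0 := by
    intro j hj
    have h1 := lengthComponent_double j x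
    rw [h, map_smul] at h1
    have h2 : ((2 : ℚ) - 2 ^ j) • lengthComponent j x = 0 := by rw [sub_smul, h1, sub_self]
    refine (smul_eq_zero.1 h2).resolve_left fun h3 => hj ?_
    have h4 : (2 : ℕ) ^ j = 2 ^ 1 := by
      have : (2 : ℚ) ^ j = 2 := by linarith
      exact_mod_cast this
    exact Nat.pow_right_injective le_rfl h4
  classical
  conv_rhs => rw [← DirectSum.sum_support_decompose (fun i : ℕ => ⋀[ℚ]^i (ℕ →₀ ℚ)) x]
  have h5 : ∀ j, ((DirectSum.decompose (fun i : ℕ => ⋀[ℚ]^i (ℕ →₀ ℚ)) x j : _) : SphereProduct) =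
      lengthComponent j x := fun j => rfl
  simp only [h5]
  rw [Finset.sum_eq_single 1 (fun j _ hj => h0 j hj)]
  intro h1
  rw [← h5, DFinsupp.notMem_support_iff.1 h1]
  rfl

theorem prod_mem_exteriorPower (l : List ℕ) :
    (l.map gen).prod ∈ ⋀[ℚ]^l.length (ℕ →₀ ℚ) := by
  induction l with
  | nil => exact SetLike.GradedOne.one_mem (A := fun i : ℕ => ⋀[ℚ]^i (ℕ →₀ ℚ))
  | cons i l ih =>
    rw [List.map_cons, List.prod_cons, List.length_cons, add_comm]
    exact mul_mem_exteriorPower (ι_mem _) ih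

/-- The eigenvectors of eigenvalue `2` of the doubling map are the combinations of generators. -/
theorem mem_span_gen_of_double {k : ℕ} {x : SphereProduct} (hx : x ∈ degree k)
    (h : double x = (2 : ℚ) • x) : x ∈ Submodule.span ℚ {a | ∃ i, 4 * i + 5 = k ∧ a = gen i} := by
  rw [← eq_lengthComponent_one h]
  clear h
  induction hx using Submodule.span_induction with
  | mem x hx =>
    obtain ⟨l, hl, rfl⟩ := hx
    by_cases h1 : l.length = 1
    · obtain ⟨i, rfl⟩ := List.length_eq_one_iff.1 h1
      refine Submodule.subset_span ⟨i, by simpa using hl, ?_⟩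
      exact (lengthComponent_of_mem (h1 ▸ prod_mem_exteriorPower [i])).trans (by simp [gen])
    · have := lengthComponent_of_mem_ne (prod_mem_exteriorPower l) h1
      change lengthComponent 1 (l.map gen).prod ∈ _
      rw [this]
      exact zero_mem _
  | zero => rw [map_zero]; exact zero_mem _
  | add x y _ _ hx hy => rw [map_add]; exact add_mem hx hy
  | smul c x _ hx => rw [map_smul]; exact Submodule.smul_mem _ _ hx

end SphereProduct

/-! ### Matrices with entries in an exterior algebra -/

namespace ExteriorMatrix

open ExteriorAux

variable {M : Type*} [AddCommGroup M] [Module ℚ M]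
variable {I J K : Type*} [Fintype I] [Fintype J]

/-- All entries of the matrix are homogeneous of degree `k`. -/
def Homogeneous (k : ℕ) (N : Matrix I J (ExteriorAlgebra ℚ M)) : Prop :=
  ∀ i j, N i j ∈ ⋀[ℚ]^k M

/-- A rational matrix, considered as a matrix over the exterior algebra. -/
def const (M : Type*) [AddCommGroup M] [Module ℚ M] {I J : Type*} (B : Matrix I J ℚ) :
    Matrix I J (ExteriorAlgebra ℚ M) :=
  B.map (algebraMap ℚ _)

omit [Fintype I] [Fintype J] in
theorem const_homogeneous (B : Matrix I J ℚ) : Homogeneous 0 (const M B) := by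
  intro i j
  rw [const, Matrix.map_apply, Algebra.algebraMap_eq_smul_one]
  exact Submodule.smul_mem _ _ (SetLike.GradedOne.one_mem (A := fun i : ℕ => ⋀[ℚ]^i M))

omit [Fintype I] in
theorem const_mul (B : Matrix I J ℚ) (C : Matrix J K ℚ) :
    const M (B * C) = const M B * const M C := by
  ext i j
  simp [const, Matrix.mul_apply]

theorem const_mul_mul_const_apply {L : Type*} (B : Matrix L I ℚ)
    (N : Matrix I J (ExteriorAlgebra ℚ M)) (C : Matrix J K ℚ) (x : L) (y : K) :
    (const M B * N * const M C) x y = ∑ p, ∑ q, (B x p * C q y) • N p q := by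
  rw [Matrix.mul_apply, Finset.sum_comm]
  refine Finset.sum_congr rfl fun q _ => ?_
  rw [Matrix.mul_apply, Finset.sum_mul]
  refine Finset.sum_congr rfl fun p _ => ?_
  rw [const, const, Matrix.map_apply, Matrix.map_apply, ← Algebra.commutes, ← Algebra.smul_def,
    ← Algebra.smul_def, smul_smul, mul_comm]

omit [Fintype I] [Fintype J] in
theorem const_transpose (B : Matrix I J ℚ) : (const M B).transpose = const M B.transpose := rfl

omit [Fintype I] in
theorem Homogeneous.mul {i j : ℕ} {N : Matrix I J (ExteriorAlgebra ℚ M)}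
    {N' : Matrix J K (ExteriorAlgebra ℚ M)} (h : Homogeneous i N) (h' : Homogeneous j N') :
    Homogeneous (i + j) (N * N') := fun a b => by
  rw [Matrix.mul_apply]
  exact sum_mem fun c _ => mul_mem_exteriorPower (h a c) (h' c b)

theorem Homogeneous.pow [DecidableEq I] {N : Matrix I I (ExteriorAlgebra ℚ M)}
    (h : Homogeneous 1 N) (n : ℕ) : Homogeneous n (N ^ n) := by
  induction n with
  | zero =>
    intro i j
    rw [pow_zero, Matrix.one_apply]
    split_ifs
    · exact SetLike.GradedOne.one_mem (A := fun i : ℕ => ⋀[ℚ]^i M)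
    · exact zero_mem _
  | succ n ih =>
    rw [pow_succ]
    exact ih.mul h

omit [Fintype I] in
theorem transpose_mul {i j : ℕ} {N : Matrix I J (ExteriorAlgebra ℚ M)}
    {N' : Matrix J K (ExteriorAlgebra ℚ M)} (h : Homogeneous i N) (h' : Homogeneous j N') :
    (N * N').transpose = (-1 : ℚ) ^ (i * j) • (N'.transpose * N.transpose) := by
  ext a b
  rw [Matrix.transpose_apply, Matrix.mul_apply, Matrix.smul_apply, Matrix.mul_apply,
    Finset.smul_sum]
  exact Finset.sum_congr rfl fun c _ => graded_comm (h b c) (h' c a)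

theorem trace_mul {i j : ℕ} {N : Matrix I J (ExteriorAlgebra ℚ M)}
    {N' : Matrix J I (ExteriorAlgebra ℚ M)} (h : Homogeneous i N) (h' : Homogeneous j N') :
    (N * N').trace = (-1 : ℚ) ^ (i * j) • (N' * N).trace := by
  simp only [Matrix.trace, Matrix.diag_apply, Matrix.mul_apply, Finset.smul_sum]
  rw [Finset.sum_comm]
  exact Finset.sum_congr rfl fun a _ => Finset.sum_congr rfl fun b _ => graded_comm (h b a) (h' a b)

theorem transpose_pow [DecidableEq I] {N : Matrix I I (ExteriorAlgebra ℚ M)}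
    (h : Homogeneous 1 N) (n : ℕ) :
    (N ^ n).transpose = (-1 : ℚ) ^ n.choose 2 • N.transpose ^ n := by
  induction n with
  | zero => simp
  | succ n ih =>
    rw [pow_succ, transpose_mul (h.pow n) h, ih, pow_succ' N.transpose, Matrix.mul_smul, smul_smul,
      ← pow_add, mul_one, Nat.choose_succ_succ' n 1, Nat.choose_one_right]

/-- A constant factor can be moved cyclically under the trace without a sign. -/
theorem trace_pow_const_comm [DecidableEq I] [DecidableEq J]
    {N : Matrix I J (ExteriorAlgebra ℚ M)} (h : Homogeneous 1 N) (C : Matrix J I ℚ)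
    {n : ℕ} (hn : n ≠ 0) :
    ((N * const M C) ^ n).trace = ((const M C * N) ^ n).trace := by
  obtain ⟨n, rfl⟩ := Nat.exists_eq_succ_of_ne_zero hn
  have h1 : ∀ n, (N * const M C) ^ n * N = N * (const M C * N) ^ n := by
    intro n
    induction n with
    | zero => simp
    | succ n ih => rw [pow_succ', pow_succ', Matrix.mul_assoc, ih]; simp only [Matrix.mul_assoc]
  have h2 : Homogeneous 1 (const M C * N) := by
    simpa using (const_homogeneous C).mul h
  rw [pow_succ, ← Matrix.mul_assoc, h1, trace_mul (h.mul (h2.pow n)) (const_homogeneous C),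
    mul_zero, pow_zero, one_smul, ← Matrix.mul_assoc, pow_succ']

theorem Homogeneous.trace_mem {k : ℕ} {N : Matrix I I (ExteriorAlgebra ℚ M)}
    (h : Homogeneous k N) : N.trace ∈ ⋀[ℚ]^k M :=
  sum_mem fun i _ => h i i

/-! ### Traces of powers of `ΘΩ` for skew-symmetric `Θ`, `Ω` -/

variable [DecidableEq I]

section Skew

variable {Θ : Matrix I I (ExteriorAlgebra ℚ M)} {Ω : Matrix I I ℚ}

omit [DecidableEq I] in
theorem mul_const_homogeneous (h : Homogeneous 1 Θ) (Ω : Matrix I I ℚ) :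
    Homogeneous 1 (Θ * const M Ω) := h.mul (const_homogeneous Ω)

omit [DecidableEq I] in
theorem transpose_mul_const (h : Homogeneous 1 Θ) (hΘ : Θ.transpose = -Θ)
    (hΩ : Ω.transpose = -Ω) : (Θ * const M Ω).transpose = const M Ω * Θ := by
  have h1 : const M (-Ω) = -const M Ω := by ext; simp [const]
  rw [transpose_mul h (const_homogeneous Ω), hΘ, const_transpose, hΩ, h1]
  simp

/-- The trace of `(ΘΩ)ⁿ` vanishes for even `n` by cyclicity, and for `n ≡ 3 mod 4` by
transposition. -/
theorem trace_pow_eq_zero (h : Homogeneous 1 Θ) (hΘ : Θ.transpose = -Θ)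
    (hΩ : Ω.transpose = -Ω) {n : ℕ} (hn : n ≠ 0) (h4 : n % 4 ≠ 1) :
    ((Θ * const M Ω) ^ n).trace = 0 := by
  have key : ∀ x : ExteriorAlgebra ℚ M, x = -x → x = 0 := fun x hx => by
    have h2 : (2 : ℚ) • x = 0 := by
      rw [two_smul]
      nth_rewrite 1 [hx]
      exact neg_add_cancel x
    exact (smul_eq_zero.1 h2).resolve_left two_ne_zero
  have hX := mul_const_homogeneous h Ω
  rcases Nat.even_or_odd n with he | ho
  · obtain ⟨m, rfl⟩ := Nat.exists_eq_succ_of_ne_zero hn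
    have hm : Odd m := by
      rw [Nat.even_add_one, Nat.not_even_iff_odd] at he
      exact he
    apply key
    conv_lhs => rw [pow_succ, trace_mul (hX.pow m) hX, mul_one, hm.neg_one_pow, neg_smul,
      one_smul, ← pow_succ']
  · have hodd : Odd (n.choose 2) := by
      have h3 : n % 4 = 3 := by
        have := Nat.odd_iff.1 ho
        omega
      have h5 : n.choose 2 = (2 * (n / 4) + 1) * n := by
        obtain ⟨q, hq⟩ : ∃ q, n = 4 * q + 3 := ⟨n / 4, by omega⟩
        subst hq
        rw [Nat.choose_two_right, show 4 * q + 3 - 1 = 2 * (2 * q + 1) by omega,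
          show (4 * q + 3) / 4 = q by omega]
        rw [show (4 * q + 3) * (2 * (2 * q + 1)) = 2 * ((2 * q + 1) * (4 * q + 3)) by ring]
        simp
      rw [h5]
      exact Odd.mul ⟨n / 4, rfl⟩ ho
    apply key
    conv_lhs => rw [← Matrix.trace_transpose, transpose_pow hX, hodd.neg_one_pow, neg_smul,
      one_smul, Matrix.trace_neg, transpose_mul_const h hΘ hΩ, ← trace_pow_const_comm h Ω hn]

/-- The matrix `(ΘΩ)ᵐΘ`, of degree `m + 1`. -/
def link (Θ : Matrix I I (ExteriorAlgebra ℚ M)) (Ω : Matrix I I ℚ) (m : ℕ) :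
    Matrix I I (ExteriorAlgebra ℚ M) := (Θ * const M Ω) ^ m * Θ

theorem link_homogeneous (h : Homogeneous 1 Θ) (Ω : Matrix I I ℚ) (m : ℕ) :
    Homogeneous (m + 1) (link Θ Ω m) :=
  ((mul_const_homogeneous h Ω).pow m).mul h

theorem link_mul_link (Θ : Matrix I I (ExteriorAlgebra ℚ M)) (Ω : Matrix I I ℚ) (m n : ℕ) :
    link Θ Ω m * const M Ω * link Θ Ω n = link Θ Ω (m + n + 1) := by
  simp only [link]
  rw [show m + n + 1 = m + 1 + n by ring, pow_add, pow_succ]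
  simp only [Matrix.mul_assoc]

theorem exists_link_swap (h : Homogeneous 1 Θ) (hΘ : Θ.transpose = -Θ)
    (hΩ : Ω.transpose = -Ω) (m : ℕ) :
    ∃ ε : ℚ, ∀ x y, link Θ Ω m x y = ε • link Θ Ω m y x := by
  have h1 : Θ * (const M Ω * Θ) ^ m = link Θ Ω m := by
    rw [link]
    induction m with
    | zero => simp
    | succ m ih => rw [pow_succ', pow_succ', Matrix.mul_assoc (Θ * _), ← ih]
                   simp only [Matrix.mul_assoc]
  refine ⟨(-1) ^ (m * 1) * (-1) ^ m.choose 2 * (-1), fun x y => ?_⟩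
  have h2 : (link Θ Ω m).transpose =
      ((-1 : ℚ) ^ (m * 1) * (-1) ^ m.choose 2 * (-1)) • link Θ Ω m := by
    conv_lhs => rw [link, transpose_mul ((mul_const_homogeneous h Ω).pow m) h, hΘ,
      transpose_pow (mul_const_homogeneous h Ω), transpose_mul_const h hΘ hΩ, Matrix.mul_smul,
      Matrix.neg_mul, h1]
    rw [smul_smul, mul_neg_one, neg_smul, smul_neg]
  exact congrFun (congrFun h2 y) x

end Skew

/-! ### Contraction of words -/

section Words

variable {α : Type*}

/-- The labels of the ends of a list of edges, with multiplicity. -/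
def edgeLabels (E : List (α × α)) : Multiset α :=
  (E.map fun e => e.1 ::ₘ e.2 ::ₘ 0).sum

/-- The labels of a word, with multiplicity. A word is a list of triples `(m, a, b)`, each standing
for the `(a, b)` entry of `(ΘΩ)ᵐΘ`. -/
def wordLabels (L : List (ℕ × α × α)) : Multiset α :=
  (L.map fun w => w.2.1 ::ₘ w.2.2 ::ₘ 0).sum

/-- The degree of the product described by a word. -/
def wordDegree (L : List (ℕ × α × α)) : ℕ := (L.map fun w => w.1 + 1).sum

/-- The product described by a word, for an assignment `p` of indices to the labels. -/
def wordProd (Θ : Matrix I I (ExteriorAlgebra ℚ M)) (Ω : Matrix I I ℚ) (L : List (ℕ × α × α))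
    (p : α → I) : ExteriorAlgebra ℚ M :=
  (L.map fun w => link Θ Ω w.1 (p w.2.1) (p w.2.2)).prod

/-- The product of the entries of `Ω` along a list of edges. -/
def edgeProd (Ω : Matrix I I ℚ) (E : List (α × α)) (p : α → I) : ℚ :=
  (E.map fun e => Ω (p e.1) (p e.2)).prod

variable {Θ : Matrix I I (ExteriorAlgebra ℚ M)} {Ω : Matrix I I ℚ}

theorem edgeLabels_cons (a b : α) (E : List (α × α)) :
    edgeLabels ((a, b) :: E) = a ::ₘ b ::ₘ edgeLabels E := by simp [edgeLabels]

theorem wordLabels_cons (m : ℕ) (a b : α) (L : List (ℕ × α × α)) :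
    wordLabels ((m, a, b) :: L) = a ::ₘ b ::ₘ wordLabels L := by simp [wordLabels]

theorem wordDegree_cons (m : ℕ) (a b : α) (L : List (ℕ × α × α)) :
    wordDegree ((m, a, b) :: L) = m + 1 + wordDegree L := by simp [wordDegree]

theorem wordProd_cons (m : ℕ) (a b : α) (L : List (ℕ × α × α)) (p : α → I) :
    wordProd Θ Ω ((m, a, b) :: L) p = link Θ Ω m (p a) (p b) * wordProd Θ Ω L p := by
  simp [wordProd]

omit [Fintype I] [DecidableEq I] in
theorem edgeProd_cons (a b : α) (E : List (α × α)) (p : α → I) :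
    edgeProd Ω ((a, b) :: E) p = Ω (p a) (p b) * edgeProd Ω E p := by simp [edgeProd]

omit [Fintype I] [DecidableEq I] in
theorem edgeProd_congr (E : List (α × α)) {p q : α → I} (h : ∀ a ∈ edgeLabels E, p a = q a) :
    edgeProd Ω E p = edgeProd Ω E q := by
  induction E with
  | nil => rfl
  | cons e E ih =>
    obtain ⟨a, b⟩ := e
    simp only [edgeLabels_cons, Multiset.mem_cons, forall_eq_or_imp] at h
    rw [edgeProd_cons, edgeProd_cons, h.1, h.2.1, ih h.2.2]

theorem wordProd_congr (L : List (ℕ × α × α)) {p q : α → I} (h : ∀ a ∈ wordLabels L, p a = q a) :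
    wordProd Θ Ω L p = wordProd Θ Ω L q := by
  induction L with
  | nil => rfl
  | cons w L ih =>
    obtain ⟨m, a, b⟩ := w
    simp only [wordLabels_cons, Multiset.mem_cons, forall_eq_or_imp] at h
    rw [wordProd_cons, wordProd_cons, h.1, h.2.1, ih h.2.2]

/-- A word containing the label `a` can be rewritten, up to a scalar, as a word that starts with
an entry whose second label is `a`. -/
theorem exists_word_front (h : Homogeneous 1 Θ) (hΘ : Θ.transpose = -Θ) (hΩ : Ω.transpose = -Ω)
    (L : List (ℕ × α × α)) {a : α} (ha : a ∈ wordLabels L) :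
    ∃ (m : ℕ) (c : α) (L' : List (ℕ × α × α)) (ε : ℚ),
      (∀ p : α → I, wordProd Θ Ω L p = ε • wordProd Θ Ω ((m, c, a) :: L') p) ∧
      wordLabels L = wordLabels ((m, c, a) :: L') ∧ wordDegree L = wordDegree ((m, c, a) :: L') := by
  induction L with
  | nil => simp [wordLabels] at ha
  | cons w L ih =>
    obtain ⟨m, x, y⟩ := w
    rw [wordLabels_cons, Multiset.mem_cons, Multiset.mem_cons] at ha
    rcases ha with rfl | rfl | ha
    · obtain ⟨ε, hε⟩ := exists_link_swap h hΘ hΩ m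
      refine ⟨m, y, L, ε, fun p => ?_, ?_, ?_⟩
      · rw [wordProd_cons, wordProd_cons, hε, smul_mul_assoc]
      · rw [wordLabels_cons, wordLabels_cons, Multiset.cons_swap]
      · rw [wordDegree_cons, wordDegree_cons]
    · exact ⟨m, x, L, 1, fun p => by rw [one_smul], rfl, rfl⟩
    · obtain ⟨n, c, L', ε, h1, h2, h3⟩ := ih ha
      refine ⟨n, c, (m, x, y) :: L', ε * (-1) ^ ((m + 1) * (n + 1)), fun p => ?_, ?_, ?_⟩
      · rw [wordProd_cons, h1, wordProd_cons, wordProd_cons, wordProd_cons, mul_smul_comm,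
          ← mul_assoc, graded_comm (link_homogeneous h Ω m _ _) (link_homogeneous h Ω n _ _),
          smul_mul_assoc, smul_smul, mul_assoc]
      · rw [wordLabels_cons, h2]
        simp only [wordLabels_cons]
        rw [Multiset.cons_swap y, Multiset.cons_swap x, Multiset.cons_swap y, Multiset.cons_swap x]
      · simp only [wordDegree_cons, h3]
        ring

omit [DecidableEq I] in
theorem sum_sum_update [DecidableEq α] [Fintype α] {A : Type*} [AddCommGroup A] [Module ℚ A]
    (a : α) (G : (α → I) → A) :
    ∑ p : α → I, ∑ x, G (Function.update p a x) = (Fintype.card I : ℚ) • ∑ p, G p := by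
  classical
  let e : (α → I) × I ≃ (α → I) × I :=
    { toFun := fun q => (Function.update q.1 a q.2, q.1 a)
      invFun := fun q => (Function.update q.1 a q.2, q.1 a)
      left_inv := fun q => by simp
      right_inv := fun q => by simp }
  rw [← Fintype.sum_prod_type' (f := fun p x => G (Function.update p a x))]
  rw [show (∑ x : (α → I) × I, G (Function.update x.1 a x.2)) = ∑ x, G (e x).1 from rfl,
    e.sum_comp (fun x => G x.1), Fintype.sum_prod_type, Finset.smul_sum]
  exact Finset.sum_congr rfl fun p _ => by simp [Nat.cast_smul_eq_nsmul]

/-- Contracting a word in the entries of `Θ` along a perfect matching of its labels gives a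
product of traces: each edge either closes up a factor `(ΘΩ)ᵐΘ` to a trace or joins two such
factors to a longer one. -/
theorem contraction_mem [DecidableEq α] [Fintype α] [Nonempty I] (h : Homogeneous 1 Θ)
    (hΘ : Θ.transpose = -Θ) (hΩ : Ω.transpose = -Ω)
    (T : ℕ → Submodule ℚ (ExteriorAlgebra ℚ M)) (hT1 : 1 ∈ T 0)
    (hTmul : ∀ {i j x y}, x ∈ T i → y ∈ T j → x * y ∈ T (i + j))
    (htr : ∀ n, n ≠ 0 → ((Θ * const M Ω) ^ n).trace ∈ T n)
    (E : List (α × α)) (L : List (ℕ × α × α)) (hEL : edgeLabels E = wordLabels L)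
    (hE : (edgeLabels E).Nodup) :
    ∑ p : α → I, edgeProd Ω E p • wordProd Θ Ω L p ∈ T (wordDegree L) := by
  induction E generalizing L with
  | nil =>
    have : L = [] := by
      cases L with
      | nil => rfl
      | cons w L =>
        obtain ⟨m, a, b⟩ := w
        rw [wordLabels_cons] at hEL
        simp [edgeLabels] at hEL
    subst this
    refine sum_mem fun p _ => Submodule.smul_mem _ _ ?_
    simpa [wordProd, wordDegree] using hT1
  | cons e E ih =>
    obtain ⟨a, b⟩ := e
    rw [edgeLabels_cons] at hEL hE
    have hcard : (Fintype.card I : ℚ) ≠ 0 := by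
      exact_mod_cast Fintype.card_ne_zero
    have hab : a ≠ b ∧ a ∉ edgeLabels E ∧ b ∉ edgeLabels E ∧ (edgeLabels E).Nodup := by
      simp only [Multiset.nodup_cons, Multiset.mem_cons, not_or] at hE
      exact ⟨hE.1.1, hE.1.2, hE.2.1, hE.2.2⟩
    -- it suffices to sum over the two labels of the edge first
    have reduce : ∀ L' : List (ℕ × α × α), (∑ p : α → I, ∑ x, ∑ y,
        (Ω x y * edgeProd Ω E p) •
          wordProd Θ Ω L' (Function.update (Function.update p a x) b y)) ∈ T (wordDegree L') →
        ∑ p : α → I, edgeProd Ω ((a, b) :: E) p • wordProd Θ Ω L' p ∈ T (wordDegree L') := by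
      intro L' hL'
      have h1 : ((Fintype.card I : ℚ) * (Fintype.card I : ℚ)) •
          ∑ p : α → I, edgeProd Ω ((a, b) :: E) p • wordProd Θ Ω L' p = ∑ p : α → I, ∑ x, ∑ y,
          (Ω x y * edgeProd Ω E p) •
            wordProd Θ Ω L' (Function.update (Function.update p a x) b y) := by
        rw [← smul_smul, ← sum_sum_update b, ← sum_sum_update a]
        refine Finset.sum_congr rfl fun p _ => Finset.sum_congr rfl fun x _ =>
          Finset.sum_congr rfl fun y _ => ?_
        rw [edgeProd_cons, Function.update_self, Function.update_of_ne hab.1, Function.update_self]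
        congr 2
        refine edgeProd_congr E fun c hc => ?_
        rw [Function.update_of_ne (by rintro rfl; exact hab.2.2.1 hc),
          Function.update_of_ne (by rintro rfl; exact hab.2.1 hc)]
      rw [← h1] at hL'
      exact (Submodule.smul_mem_iff _ (mul_ne_zero hcard hcard)).1 hL'
    have upd : ∀ L' : List (ℕ × α × α), a ∉ wordLabels L' → b ∉ wordLabels L' →
        ∀ (p : α → I) x y, wordProd Θ Ω L' (Function.update (Function.update p a x) b y) =
          wordProd Θ Ω L' p := by
      intro L' ha hb p x y
      refine wordProd_congr L' fun c hc => ?_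
      rw [Function.update_of_ne (by rintro rfl; exact hb hc),
        Function.update_of_ne (by rintro rfl; exact ha hc)]
    obtain ⟨m, c, L₁, ε, h1, h2, h3⟩ := exists_word_front (I := I) h hΘ hΩ L (a := a)
      (by rw [← hEL]; exact Multiset.mem_cons_self _ _)
    rw [h3]
    simp only [h1]
    have comm : ∀ L' : List (ℕ × α × α), ∀ ε : ℚ,
        ∑ p : α → I, edgeProd Ω ((a, b) :: E) p • ε • wordProd Θ Ω L' p =
        ε • ∑ p : α → I, edgeProd Ω ((a, b) :: E) p • wordProd Θ Ω L' p := by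
      intro L' ε
      rw [Finset.smul_sum]
      exact Finset.sum_congr rfl fun p _ => smul_comm _ _ _
    rw [comm]
    refine Submodule.smul_mem _ _ ?_
    rw [h2, wordLabels_cons, Multiset.cons_swap c, Multiset.cons_inj_right] at hEL
    by_cases hcb : c = b
    · subst hcb
      rw [Multiset.cons_inj_right] at hEL
      refine reduce _ ?_
      have h4 : ∀ p : α → I, (∑ x, ∑ y, (Ω x y * edgeProd Ω E p) •
          wordProd Θ Ω ((m, c, a) :: L₁) (Function.update (Function.update p a x) c y)) =
          ((Θ * const M Ω) ^ (m + 1)).trace * (edgeProd Ω E p • wordProd Θ Ω L₁ p) := by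
        intro p
        have h5 : ((Θ * const M Ω) ^ (m + 1)).trace = ∑ x, ∑ y, Ω x y • link Θ Ω m y x := by
          rw [pow_succ, ← Matrix.mul_assoc]
          change (link Θ Ω m * const M Ω).trace = _
          rw [trace_mul (link_homogeneous h Ω m) (const_homogeneous Ω), mul_zero, pow_zero,
            one_smul]
          simp [Matrix.trace, Matrix.mul_apply, const, Algebra.smul_def]
        rw [h5, Finset.sum_mul]
        refine Finset.sum_congr rfl fun x _ => ?_
        rw [Finset.sum_mul]
        refine Finset.sum_congr rfl fun y _ => ?_
        rw [wordProd_cons, upd L₁ (hEL ▸ hab.2.1) (hEL ▸ hab.2.2.1), Function.update_self,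
          Function.update_of_ne hab.1, Function.update_self, smul_mul_smul_comm]
      simp only [h4]
      rw [← Finset.mul_sum, wordDegree_cons]
      exact hTmul (htr _ m.succ_ne_zero) (ih L₁ hEL hab.2.2.2)
    · have hb1 : b ∈ wordLabels L₁ := by
        have : b ∈ c ::ₘ wordLabels L₁ := hEL ▸ Multiset.mem_cons_self _ _
        exact (Multiset.mem_cons.1 this).resolve_left (Ne.symm hcb)
      obtain ⟨n, d, L₂, ε', h4, h5, h6⟩ := exists_word_front (I := I) h hΘ hΩ L₁ hb1
      obtain ⟨ε'', h7⟩ := exists_link_swap h hΘ hΩ n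
      -- rewrite the word so that it starts with the entries `(c, a)` and `(b, d)`
      have h8 : ∀ p : α → I, wordProd Θ Ω ((m, c, a) :: L₁) p =
          (ε' * ε'') • wordProd Θ Ω ((m, c, a) :: (n, b, d) :: L₂) p := by
        intro p
        rw [wordProd_cons, h4, wordProd_cons, wordProd_cons, wordProd_cons, h7, smul_mul_assoc,
          smul_smul, mul_smul_comm]
      simp only [h8]
      rw [comm]
      refine Submodule.smul_mem _ _ ?_
      rw [h5, wordLabels_cons, Multiset.cons_swap d b, Multiset.cons_swap c b,
        Multiset.cons_inj_right] at hEL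
      have hdeg : wordDegree ((m, c, a) :: L₁) = wordDegree ((m, c, a) :: (n, b, d) :: L₂) := by
        rw [wordDegree_cons, h6, wordDegree_cons, wordDegree_cons, wordDegree_cons]
      rw [hdeg]
      refine reduce _ ?_
      have hmem : ∀ z, z ∉ edgeLabels E → z ≠ c ∧ z ≠ d ∧ z ∉ wordLabels L₂ := by
        intro z hz
        rw [hEL, Multiset.mem_cons, Multiset.mem_cons, not_or, not_or] at hz
        exact hz
      have hma := hmem a hab.2.1
      have hmb := hmem b hab.2.2.1
      have h9 : ∀ p : α → I, (∑ x, ∑ y, (Ω x y * edgeProd Ω E p) •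
          wordProd Θ Ω ((m, c, a) :: (n, b, d) :: L₂)
            (Function.update (Function.update p a x) b y)) =
          edgeProd Ω E p • wordProd Θ Ω ((m + n + 1, c, d) :: L₂) p := by
        intro p
        have h10 : link Θ Ω (m + n + 1) (p c) (p d) = ∑ x, ∑ y,
            Ω x y • (link Θ Ω m (p c) x * link Θ Ω n y (p d)) := by
          rw [← link_mul_link, Matrix.mul_apply, Finset.sum_comm]
          refine Finset.sum_congr rfl fun y _ => ?_
          rw [Matrix.mul_apply, Finset.sum_mul]
          refine Finset.sum_congr rfl fun x _ => ?_
          rw [const, Matrix.map_apply, ← Algebra.commutes, ← Algebra.smul_def, smul_mul_assoc]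
        rw [wordProd_cons, h10, Finset.sum_mul, Finset.smul_sum]
        refine Finset.sum_congr rfl fun x _ => ?_
        rw [Finset.sum_mul, Finset.smul_sum]
        refine Finset.sum_congr rfl fun y _ => ?_
        rw [wordProd_cons, wordProd_cons, upd L₂ hma.2.2 hmb.2.2, Function.update_self,
          Function.update_of_ne hab.1, Function.update_self, Function.update_of_ne (Ne.symm hmb.1),
          Function.update_of_ne (Ne.symm hma.1), Function.update_of_ne (Ne.symm hmb.2.1),
          Function.update_of_ne (Ne.symm hma.2.1), smul_mul_assoc, smul_smul, mul_assoc,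
          mul_comm (Ω x y)]
      simp only [h9]
      have hdeg' : wordDegree ((m, c, a) :: (n, b, d) :: L₂) =
          wordDegree ((m + n + 1, c, d) :: L₂) := by
        simp only [wordDegree_cons]
        ring
      rw [hdeg']
      refine ih _ ?_ hab.2.2.2
      rw [hEL, wordLabels_cons]

end Words

end ExteriorMatrix

/-! ### Invariant multilinear forms of the symplectic group -/

namespace Symp

open ExteriorMatrix (edgeLabels)

theorem pairing_add_left {g : ℕ} (u v w : Hyp g) :
    pairing g (u + v) w = pairing g u w + pairing g v w := by
  simp only [pairing, ← Finset.sum_add_distrib, Pi.add_apply]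
  exact Finset.sum_congr rfl fun i _ => by ring

theorem pairing_add_right {g : ℕ} (u v w : Hyp g) :
    pairing g u (v + w) = pairing g u v + pairing g u w := by
  simp only [pairing, ← Finset.sum_add_distrib, Pi.add_apply]
  exact Finset.sum_congr rfl fun i _ => by ring

theorem pairing_smul_left {g : ℕ} (c : ℚ) (u v : Hyp g) :
    pairing g (c • u) v = c * pairing g u v := by
  simp only [pairing, Finset.mul_sum, Pi.smul_apply, smul_eq_mul]
  exact Finset.sum_congr rfl fun i _ => by ring

theorem pairing_smul_right {g : ℕ} (c : ℚ) (u v : Hyp g) :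
    pairing g u (c • v) = c * pairing g u v := by
  simp only [pairing, Finset.mul_sum, Pi.smul_apply, smul_eq_mul]
  exact Finset.sum_congr rfl fun i _ => by ring

/-- `x_i + ∑ⱼ C j • y_j`. -/
def graphVector {g : ℕ} (i : Fin g) (C : Fin g → ℚ) : Hyp g := Sum.elim (Pi.single i 1) C

/-- The normal form of a family of `g` vectors under the symplectic group: the family
`x_i + ½ ∑ⱼ (v_j · v_i) y_j`, which has the same Gram matrix. -/
def normalForm {g : ℕ} (V : Fin g → Hyp g) (i : Fin g) : Hyp g :=
  graphVector i fun j => 1 / 2 * pairing g (V j) (V i)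

/-- If the `x`-components of a family of `g` vectors are linearly independent, then the family is
equivalent to its normal form under the symplectic group. -/
theorem exists_symplectic_normalForm {g : ℕ} (V : Fin g → Hyp g)
    (h : IsUnit (Matrix.of fun l i => V i (Sum.inl l)).det) :
    ∃ A : Matrix.symplecticGroup (Fin g) ℚ, ∀ i,
      (A : Matrix (Fin g ⊕ Fin g) (Fin g ⊕ Fin g) ℚ).mulVecLin (normalForm V i) = V i := by
  set P : Matrix (Fin g) (Fin g) ℚ := Matrix.of fun l i => V i (Sum.inl l) with hP
  set Q : Matrix (Fin g) (Fin g) ℚ := Matrix.of fun l i => V i (Sum.inr l) with hQ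
  have h1 : P⁻¹ * P = 1 := Matrix.nonsing_inv_mul P h
  have h2 : P.transpose * P⁻¹.transpose = 1 := by
    rw [← Matrix.transpose_mul, h1, Matrix.transpose_one]
  have h3 : P⁻¹.transpose * P.transpose = 1 := by
    rw [← Matrix.transpose_mul, Matrix.mul_nonsing_inv P h, Matrix.transpose_one]
  set R : Matrix (Fin g) (Fin g) ℚ :=
    (1 / 2 : ℚ) • (Q + P⁻¹.transpose * (Q.transpose * P)) with hR
  have hA : Matrix.fromBlocks P 0 R P⁻¹.transpose ∈ Matrix.symplecticGroup (Fin g) ℚ := by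
    rw [SymplecticGroup.fromBlocks_mem_iff]
    refine ⟨?_, by simp, by simp [h2]⟩
    have h4 : P.transpose * R =
        (1 / 2 : ℚ) • (P.transpose * Q + Q.transpose * P) := by
      rw [hR, Matrix.mul_smul, Matrix.mul_add, ← Matrix.mul_assoc P.transpose, h2, Matrix.one_mul]
    have h5 : R.transpose * P = (P.transpose * R).transpose := by
      rw [Matrix.transpose_mul, Matrix.transpose_transpose]
    rw [h5, h4, Matrix.transpose_smul, Matrix.transpose_add, Matrix.transpose_mul,
      Matrix.transpose_mul, Matrix.transpose_transpose, Matrix.transpose_transpose, add_comm]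
  refine ⟨⟨_, hA⟩, fun i => ?_⟩
  have hC : ∀ i j, 1 / 2 * pairing g (V j) (V i) =
      ((1 / 2 : ℚ) • (P.transpose * Q - Q.transpose * P)) j i := by
    intro i j
    simp [pairing, P, Q, Matrix.mul_apply, Finset.sum_sub_distrib]
  have hRC : R + P⁻¹.transpose * ((1 / 2 : ℚ) • (P.transpose * Q - Q.transpose * P)) = Q := by
    rw [Matrix.mul_smul, Matrix.mul_sub, ← Matrix.mul_assoc _ P.transpose, h3, Matrix.one_mul,
      hR, ← smul_add]
    have : Q + P⁻¹.transpose * (Q.transpose * P) + (Q - P⁻¹.transpose * (Q.transpose * P)) =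
        (2 : ℚ) • Q := by rw [two_smul]; abel
    rw [this, smul_smul]
    norm_num
  have hcol : normalForm V i = Sum.elim (Pi.single i 1)
      (fun j => ((1 / 2 : ℚ) • (P.transpose * Q - Q.transpose * P)) j i) := by
    rw [normalForm, graphVector]
    congr 1
    funext j
    exact hC i j
  rw [hcol]
  ext p
  rw [Matrix.mulVecLin_apply]
  simp only [Matrix.fromBlocks_mulVec]
  rcases p with l | l
  · simp [P]
  · have := congrFun (congrFun hRC l) i
    rw [Matrix.add_apply, Matrix.mul_apply] at this
    simp only [Sum.elim_inr, Pi.add_apply, Sum.elim_comp_inl, Sum.elim_comp_inr]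
    rw [Matrix.mulVec_single_one]
    exact this

theorem exists_polynomial_multilinear {ι E : Type*} [Fintype ι] [AddCommGroup E] [Module ℚ E]
    (f : MultilinearMap ℚ (fun _ : ι => E) ℚ) (u w : ι → E) :
    ∃ p : Polynomial ℚ, ∀ t : ℚ, f (fun i => u i + t • w i) = p.eval t := by
  classical
  refine ⟨∑ s : Finset ι, Polynomial.C (f (s.piecewise w u)) * Polynomial.X ^ s.card, fun t => ?_⟩
  have h := f.map_add_univ (fun i => t • w i) u
  have h2 : (fun i => u i + t • w i) = (fun i => t • w i) + u := by
    funext i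
    rw [Pi.add_apply, add_comm]
  rw [h2, h, Polynomial.eval_finsetSum]
  refine Finset.sum_congr rfl fun s _ => ?_
  have h3 : s.piecewise (fun i => t • w i) u =
      s.piecewise (fun i => t • s.piecewise w u i) (s.piecewise w u) := by
    funext i
    by_cases hi : i ∈ s <;> simp [hi]
  rw [h3, f.map_piecewise_smul (fun _ => t)]
  rw [Finset.prod_const, Polynomial.eval_mul, Polynomial.eval_C, Polynomial.eval_pow,
    Polynomial.eval_X, smul_eq_mul, mul_comm]

variable {ι : Type*} [Fintype ι] {g : ℕ}

/-- An invariant form in at most `g` variables depends on the Gram matrix only. The case of linearly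
independent `x`-components suffices by density. -/
theorem apply_eq_apply_normalForm (e : ι ↪ Fin g) (f : MultilinearMap ℚ (fun _ : ι => Hyp g) ℚ)
    (hf : ∀ (A : Matrix.symplecticGroup (Fin g) ℚ) v,
      f (fun i => (A : Matrix (Fin g ⊕ Fin g) (Fin g ⊕ Fin g) ℚ).mulVecLin (v i)) = f v)
    (V : Fin g → Hyp g) : f (fun i => V (e i)) = f (fun i => normalForm V (e i)) := by
  let x : Fin g → Hyp g := fun i => Pi.single (Sum.inl i) 1
  obtain ⟨p, hp⟩ := exists_polynomial_multilinear f (fun i => V (e i)) (fun i => x (e i))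
  obtain ⟨q, hq⟩ := exists_polynomial_multilinear f (fun i => normalForm V (e i))
    (fun i => (Sum.elim 0 fun j =>
      1 / 2 * (pairing g (x j) (V (e i)) + pairing g (V j) (x (e i))) : Hyp g))
  have hxx : ∀ i j, pairing g (x i) (x j) = 0 := by
    intro i j
    simp [pairing, x]
  have hnf : ∀ (t : ℚ) i, normalForm (fun i => V i + t • x i) i = normalForm V i + t •
      (Sum.elim 0 fun j => 1 / 2 * (pairing g (x j) (V i) + pairing g (V j) (x i)) : Hyp g) := by
    intro t i
    ext a
    rcases a with l | l
    · simp [normalForm, graphVector]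
    · simp only [normalForm, graphVector, Sum.elim_inr, Pi.add_apply, Pi.smul_apply, smul_eq_mul,
        pairing_add_left, pairing_add_right, pairing_smul_left, pairing_smul_right, hxx]
      ring
  set P : Matrix (Fin g) (Fin g) ℚ := Matrix.of fun l i => V i (Sum.inl l) with hP
  have hdet : ∀ t : ℚ, (Matrix.of fun l i => (V i + t • x i) (Sum.inl l)).det =
      (-P).charpoly.eval t := by
    intro t
    rw [Matrix.eval_charpoly]
    congr 1
    ext l i
    simp [P, x, Matrix.scalar_apply, Matrix.diagonal_apply, Pi.single_apply, add_comm]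
  have heq : ∀ t : ℚ, (-P).charpoly.eval t ≠ 0 → p.eval t = q.eval t := by
    intro t ht
    obtain ⟨A, hA⟩ := exists_symplectic_normalForm (fun i => V i + t • x i)
      (by rw [hdet]; exact isUnit_iff_ne_zero.2 ht)
    rw [← hp, ← hq, ← hf A fun i => normalForm V (e i) + _]
    congr 1
    funext i
    rw [← hnf, hA]
  have hpq : p = q := by
    refine Polynomial.eq_of_infinite_eval_eq p q ?_
    refine Set.Infinite.mono (s := {t | (-P).charpoly.eval t = 0}ᶜ) (fun t ht => heq t ht) ?_
    refine Set.Finite.infinite_compl ?_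
    exact Polynomial.finite_setOfPred_isRoot (Matrix.charpoly_monic _).ne_zero
  have h0 := hp 0
  have h1 := hq 0
  simp only [zero_smul, add_zero] at h0 h1
  rw [h0, h1, hpq]

/-- The basis vectors occurring in the expansion of the normal form. -/
def expansionVector (i : Fin g) : Option (Fin g) → Hyp g
  | none => Pi.single (Sum.inl i) 1
  | some j => Pi.single (Sum.inr j) 1

/-- The coefficients occurring in the expansion of the normal form. -/
def expansionCoeff (V : Fin g → Hyp g) (i : Fin g) : Option (Fin g) → ℚ
  | none => 1
  | some j => 1 / 2 * pairing g (V j) (V i)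

theorem normalForm_eq_sum (V : Fin g → Hyp g) (i : Fin g) :
    normalForm V i = ∑ r, expansionCoeff V i r • expansionVector i r := by
  rw [Fintype.sum_option]
  ext a
  rcases a with l | l
  · simp [normalForm, graphVector, expansionCoeff, expansionVector, Pi.single_apply]
  · simp [normalForm, graphVector, expansionCoeff, expansionVector, Pi.single_apply]

/-- Torus invariance: if the coefficient at a choice `r` of basis vectors does not vanish, then
`x_l` and `y_l` are chosen equally often. -/
theorem card_eq_card_of_ne_zero (e : ι ↪ Fin g) (f : MultilinearMap ℚ (fun _ : ι => Hyp g) ℚ)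
    (hf : ∀ (A : Matrix.symplecticGroup (Fin g) ℚ) v,
      f (fun i => (A : Matrix (Fin g ⊕ Fin g) (Fin g ⊕ Fin g) ℚ).mulVecLin (v i)) = f v)
    (r : ι → Option (Fin g)) (hr : f (fun i => expansionVector (e i) (r i)) ≠ 0) (l : Fin g) :
    (Finset.univ.filter fun i => r i = none ∧ e i = l).card =
      (Finset.univ.filter fun i => r i = some l).card := by
  let a : Fin g → ℚ := Function.update 1 l 2
  have ha : ∀ j, a j ≠ 0 := by
    intro j
    by_cases h : j = l <;> simp [a, h]
  have hA : Matrix.fromBlocks (Matrix.diagonal a) 0 0 (Matrix.diagonal fun j => (a j)⁻¹) ∈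
      Matrix.symplecticGroup (Fin g) ℚ := by
    rw [SymplecticGroup.fromBlocks_mem_iff]
    refine ⟨by simp, by simp, ?_⟩
    simp [ha]
  have h1 := hf ⟨_, hA⟩ fun i => expansionVector (e i) (r i)
  have h2 : ∀ i, (Matrix.fromBlocks (Matrix.diagonal a) 0 0
      (Matrix.diagonal fun j => (a j)⁻¹)).mulVecLin (expansionVector (e i) (r i)) =
      ((if r i = none ∧ e i = l then 2 else 1) * (if r i = some l then 2⁻¹ else 1) : ℚ) •
        expansionVector (e i) (r i) := by
    intro i
    rw [Matrix.mulVecLin_apply, Matrix.fromBlocks_mulVec]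
    ext b
    rcases hri : r i with _ | j <;> rcases b with b | b
    · simp only [expansionVector, Sum.elim_inl, Pi.add_apply, Matrix.mulVec_diagonal,
        Function.comp_apply, Matrix.zero_mulVec, Pi.zero_apply, Pi.smul_apply, Pi.single_apply, a,
        Function.update_apply]
      by_cases h : b = e i
      · subst h; simp
      · simp [h]
    · simp [expansionVector, Matrix.mulVec_diagonal]
    · simp [expansionVector, Matrix.mulVec_diagonal]
    · simp only [expansionVector, Sum.elim_inr, Pi.add_apply, Matrix.mulVec_diagonal,
        Function.comp_apply, Matrix.zero_mulVec, Pi.zero_apply, Pi.smul_apply, Pi.single_apply, a,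
        Function.update_apply]
      by_cases h : b = j
      · subst h
        by_cases h' : b = l <;> simp [h']
      · simp [h]
  simp only [h2] at h1
  rw [f.map_smul_univ, smul_eq_mul] at h1
  have h3 := mul_right_cancel₀ hr (h1.trans (one_mul _).symm)
  simp only [Finset.prod_mul_distrib, Finset.prod_ite, Finset.prod_const, one_pow, mul_one,
    inv_pow] at h3
  have h4 := (mul_inv_eq_one₀ (by positivity)).1 h3
  exact Nat.pow_right_injective (le_refl 2) (by exact_mod_cast h4)

/-- A choice of basis vectors with nonvanishing coefficient describes a perfect matching. -/
theorem exists_matching [DecidableEq ι] (e : ι ↪ Fin g) (r : ι → Option (Fin g))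
    (hr : ∀ l, (Finset.univ.filter fun i => r i = none ∧ e i = l).card =
      (Finset.univ.filter fun i => r i = some l).card) :
    ∃ E : List (ι × ι), edgeLabels E = Finset.univ.val ∧ ∃ c : ℚ, ∀ v : ι → Hyp g,
      ∏ i, expansionCoeff (Function.extend e v 0) (e i) (r i) =
        c * (E.map fun b => pairing g (v b.1) (v b.2)).prod := by
  have hpartner : ∀ i, r i ≠ none → ∃ j, r j = none ∧ r i = some (e j) := by
    intro i hi
    obtain ⟨l, hl⟩ := Option.ne_none_iff_exists'.1 hi
    have h1 : 0 < (Finset.univ.filter fun i => r i = some l).card :=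
      Finset.card_pos.2 ⟨i, by simp [hl]⟩
    rw [← hr, Finset.card_pos] at h1
    obtain ⟨j, hj⟩ := h1
    rw [Finset.mem_filter] at hj
    exact ⟨j, hj.2.1, by rw [hl, hj.2.2]⟩
  choose! j hj1 hj2 using hpartner
  set S : Finset ι := Finset.univ.filter fun i => r i ≠ none with hS
  have hmem : ∀ i, i ∈ S ↔ r i ≠ none := fun i => by simp [hS]
  have hinj : Set.InjOn j S := by
    intro a ha b hb hab
    have ha' := hj2 a ((hmem a).1 ha)
    have hb' := hj2 b ((hmem b).1 hb)
    have h1 : (Finset.univ.filter fun i => r i = some (e (j a))).card ≤ 1 := by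
      rw [← hr, Finset.card_le_one]
      intro x hx y hy
      rw [Finset.mem_filter] at hx hy
      exact e.injective (hx.2.2.trans hy.2.2.symm)
    rw [Finset.card_le_one] at h1
    exact h1 a (by simpa using ha') b (by simpa [hab] using hb')
  have himage : S.image j = Sᶜ := by
    ext i
    rw [Finset.mem_image, Finset.mem_compl, hmem, not_not]
    constructor
    · rintro ⟨a, ha, rfl⟩
      exact hj1 a ((hmem a).1 ha)
    · intro hi
      have h1 : 0 < (Finset.univ.filter fun b => r b = none ∧ e b = e i).card :=
        Finset.card_pos.2 ⟨i, by simp [hi]⟩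
      rw [hr, Finset.card_pos] at h1
      obtain ⟨a, ha⟩ := h1
      rw [Finset.mem_filter] at ha
      have ha0 : r a ≠ none := by simp [ha.2]
      refine ⟨a, (hmem a).2 ha0, ?_⟩
      have := hj2 a ha0
      rw [ha.2, Option.some_inj] at this
      exact e.injective this.symm
  refine ⟨S.toList.map fun i => (j i, i), ?_, (1 / 2) ^ S.card, fun v => ?_⟩
  · have h1 : ∀ l : List ι, edgeLabels (l.map fun i => (j i, i)) =
        (Multiset.map j (l : Multiset ι)) + (l : Multiset ι) := by
      intro l
      induction l with
      | nil => rfl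
      | cons a l ih =>
        rw [List.map_cons, ExteriorMatrix.edgeLabels_cons, ih, ← Multiset.cons_coe,
          Multiset.map_cons, Multiset.cons_add, Multiset.add_cons]
    rw [h1, Finset.coe_toList, ← Finset.image_val_of_injOn hinj, himage,
      ← Finset.union_compl Sᶜ, compl_compl,
      ← Finset.disjUnion_eq_union _ _ disjoint_compl_left]
    rfl
  · have h1 : ∏ i, expansionCoeff (Function.extend e v 0) (e i) (r i) =
        ∏ i ∈ S, (1 / 2 * pairing g (v (j i)) (v i)) := by
      rw [← Finset.prod_subset (Finset.subset_univ S)]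
      · refine Finset.prod_congr rfl fun i hi => ?_
        rw [hj2 i ((hmem i).1 hi), expansionCoeff, e.injective.extend_apply,
          e.injective.extend_apply]
      · intro i _ hi
        rw [hmem, not_not] at hi
        rw [hi, expansionCoeff]
    rw [h1, Finset.prod_mul_distrib, Finset.prod_const, List.map_map]
    congr 1
    exact (Finset.prod_map_toList S _).symm

/-- The first fundamental theorem of invariant theory for the symplectic group, in the stable
range: an invariant multilinear form in at most `g` variables is a linear combination of products
of pairings along perfect matchings of the variables. -/
theorem mem_span_matchings [DecidableEq ι] (e : ι ↪ Fin g)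
    (f : MultilinearMap ℚ (fun _ : ι => Hyp g) ℚ)
    (hf : ∀ (A : Matrix.symplecticGroup (Fin g) ℚ) v,
      f (fun i => (A : Matrix (Fin g ⊕ Fin g) (Fin g ⊕ Fin g) ℚ).mulVecLin (v i)) = f v) :
    (f : (ι → Hyp g) → ℚ) ∈ Submodule.span ℚ {h : (ι → Hyp g) → ℚ | ∃ E : List (ι × ι),
      edgeLabels E = Finset.univ.val ∧
        h = fun v => (E.map fun b => pairing g (v b.1) (v b.2)).prod} := by
  have h1 : (f : (ι → Hyp g) → ℚ) = ∑ r : ι → Option (Fin g),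
      f (fun i => expansionVector (e i) (r i)) •
        fun v => ∏ i, expansionCoeff (Function.extend e v 0) (e i) (r i) := by
    funext v
    have h2 := apply_eq_apply_normalForm e f hf (Function.extend e v 0)
    simp only [e.injective.extend_apply] at h2
    rw [show (fun i => v i) = v from rfl] at h2
    simp only [normalForm_eq_sum, f.map_sum, f.map_smul_univ] at h2
    rw [h2, Finset.sum_apply]
    exact Finset.sum_congr rfl fun r _ => mul_comm _ _
  rw [h1]
  refine sum_mem fun r _ => ?_
  by_cases hr : f (fun i => expansionVector (e i) (r i)) = 0
  · rw [hr, zero_smul]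
    exact zero_mem _
  · obtain ⟨E, hE, c, hc⟩ := exists_matching e r (card_eq_card_of_ne_zero e f hf r hr)
    refine Submodule.smul_mem _ _ ?_
    have h3 : (fun v : ι → Hyp g => ∏ i, expansionCoeff (Function.extend e v 0) (e i) (r i)) =
        c • fun v => (E.map fun b => pairing g (v b.1) (v b.2)).prod := by
      funext v
      rw [hc]
      rfl
    rw [h3]
    exact Submodule.smul_mem _ _ (Submodule.subset_span ⟨E, hE, rfl⟩)

end Symp

/-! ### The generic skew-symmetric matrix and its trace forms -/

namespace Symp

open ExteriorMatrix ExteriorAux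
open Matrix (transpose)

/-- The skew-symmetric matrix of a bivector, `u ∧ v ↦ u vᵀ - v uᵀ`. -/
def skewMatrix (g : ℕ) : ⋀[ℚ]^2 (Hyp g) →ₗ[ℚ] Matrix (Fin g ⊕ Fin g) (Fin g ⊕ Fin g) ℚ :=
  exteriorPower.alternatingMapLinearEquiv
    { toFun := fun w => Matrix.of fun p q => w 0 p * w 1 q - w 1 p * w 0 q
      map_update_add' := by
        intro _ w i u v
        ext p q
        fin_cases i <;> simp [Function.update] <;> ring
      map_update_smul' := by
        intro _ w i c v
        ext p q
        fin_cases i <;> simp [Function.update] <;> ring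
      map_eq_zero_of_eq' := by
        intro w i j hij hne
        have h : w 0 = w 1 := by
          fin_cases i <;> fin_cases j <;> simp_all
        ext p q
        simp [h] }

/-- The bivector `u ∧ v`. -/
def wedge {g : ℕ} (u v : Hyp g) : ⋀[ℚ]^2 (Hyp g) := exteriorPower.ιMulti ℚ 2 ![u, v]

theorem skewMatrix_wedge {g : ℕ} (u v : Hyp g) (p q : Fin g ⊕ Fin g) :
    skewMatrix g (wedge u v) p q = u p * v q - v p * u q := by
  simp [skewMatrix, wedge]

theorem contraction_wedge {g : ℕ} (u v : Hyp g) : contraction g (wedge u v) = pairing g u v := by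
  simp [contraction, wedge]

theorem map_wedge {g m : ℕ} (f : Hyp g →ₗ[ℚ] Hyp m) (u v : Hyp g) :
    exteriorPower.map 2 f (wedge u v) = wedge (f u) (f v) := by
  rw [wedge, exteriorPower.map_apply_ιMulti, wedge]
  congr 1
  ext i : 1
  fin_cases i <;> rfl

theorem wedge_ext {g : ℕ} {N : Type*} [AddCommGroup N] [Module ℚ N]
    {F G : ⋀[ℚ]^2 (Hyp g) →ₗ[ℚ] N} (h : ∀ u v, F (wedge u v) = G (wedge u v)) : F = G := by
  refine exteriorPower.linearMap_ext (AlternatingMap.ext fun w => ?_)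
  have : w = ![w 0, w 1] := by ext i : 1; fin_cases i <;> rfl
  rw [this]
  exact h _ _

theorem skewMatrix_transpose {g : ℕ} (a : ⋀[ℚ]^2 (Hyp g)) :
    (skewMatrix g a).transpose = -skewMatrix g a := by
  ext p q
  have h : Matrix.entryLinearMap ℚ ℚ q p ∘ₗ skewMatrix g =
      -(Matrix.entryLinearMap ℚ ℚ p q ∘ₗ skewMatrix g) := by
    refine wedge_ext fun u v => ?_
    simp only [LinearMap.comp_apply, Matrix.entryLinearMap_apply, skewMatrix_wedge,
      LinearMap.neg_apply]
    ring
  exact DFunLike.congr_fun h a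

/-- The matrix of the intersection pairing. -/
def pairingMatrix (g : ℕ) : Matrix (Fin g ⊕ Fin g) (Fin g ⊕ Fin g) ℚ :=
  Matrix.of fun p q => pairing g (Pi.single p 1) (Pi.single q 1)

theorem pairingMatrix_eq (g : ℕ) : pairingMatrix g = -Matrix.J (Fin g) ℚ := by
  ext p q
  rcases p with p | p <;> rcases q with q | q <;>
    simp [pairingMatrix, pairing, Matrix.J, Pi.single_apply, Matrix.one_apply, eq_comm]

theorem pairingMatrix_transpose (g : ℕ) : (pairingMatrix g).transpose = -pairingMatrix g := by
  rw [pairingMatrix_eq, Matrix.transpose_neg, Matrix.J_transpose]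

theorem pairing_eq_sum {g : ℕ} (u v : Hyp g) :
    pairing g u v = ∑ p, ∑ q, u p * pairingMatrix g p q * v q := by
  rw [pairingMatrix_eq]
  simp [pairing, Matrix.J, Matrix.one_apply, Finset.sum_sub_distrib]
  ring

/-- The Gram matrix of two families of vectors, given as the columns of matrices. -/
theorem transpose_mul_pairingMatrix_mul {g g' m : ℕ} (f : Hyp g →ₗ[ℚ] Hyp m)
    (f' : Hyp g' →ₗ[ℚ] Hyp m) :
    (LinearMap.toMatrix' f).transpose * pairingMatrix m * LinearMap.toMatrix' f' =
      Matrix.of fun p q => pairing m (f (Pi.single p 1)) (f' (Pi.single q 1)) := by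
  ext p q
  rw [Matrix.of_apply, pairing_eq_sum, Finset.sum_comm, Matrix.mul_apply]
  refine Finset.sum_congr rfl fun b _ => ?_
  rw [Matrix.mul_apply, Finset.sum_mul]
  refine Finset.sum_congr rfl fun a _ => ?_
  simp [LinearMap.toMatrix'_apply]

theorem sum_skewMatrix {g : ℕ} (a : ⋀[ℚ]^2 (Hyp g)) :
    ∑ p, ∑ q, pairingMatrix g p q * skewMatrix g a p q = 2 * contraction g a := by
  have h : ∑ p, ∑ q, pairingMatrix g p q • (Matrix.entryLinearMap ℚ ℚ p q ∘ₗ skewMatrix g) =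
      (2 : ℚ) • contraction g := by
    refine wedge_ext fun u v => ?_
    simp only [LinearMap.sum_apply, LinearMap.smul_apply, LinearMap.comp_apply,
      Matrix.entryLinearMap_apply, skewMatrix_wedge, contraction_wedge, smul_eq_mul, mul_sub,
      Finset.sum_sub_distrib]
    have h1 : ∀ u v : Hyp g, ∑ p, ∑ q, pairingMatrix g p q * (u p * v q) = pairing g u v := by
      intro u v
      rw [pairing_eq_sum]
      exact Finset.sum_congr rfl fun p _ => Finset.sum_congr rfl fun q _ => by ring
    rw [h1, h1]
    simp only [pairing, Finset.mul_sum, ← Finset.sum_sub_distrib]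
    exact Finset.sum_congr rfl fun i _ => by ring
  have := DFunLike.congr_fun h a
  simpa using this

theorem skewMatrix_map {g m : ℕ} (f : Hyp g →ₗ[ℚ] Hyp m) (a : ⋀[ℚ]^2 (Hyp g)) :
    skewMatrix m (exteriorPower.map 2 f a) =
      LinearMap.toMatrix' f * skewMatrix g a * (LinearMap.toMatrix' f).transpose := by
  have h1 : ∀ (u : Hyp g) p, f u p = ∑ a, LinearMap.toMatrix' f p a * u a := by
    intro u p
    conv_lhs => rw [← LinearMap.toMatrix'_mulVec f u]
    rfl
  ext p q
  have h : Matrix.entryLinearMap ℚ ℚ p q ∘ₗ skewMatrix m ∘ₗ exteriorPower.map 2 f =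
      ∑ b, ∑ a, (LinearMap.toMatrix' f p a * LinearMap.toMatrix' f q b) •
        (Matrix.entryLinearMap ℚ ℚ a b ∘ₗ skewMatrix g) := by
    refine wedge_ext fun u v => ?_
    simp only [LinearMap.comp_apply, Matrix.entryLinearMap_apply, map_wedge, skewMatrix_wedge,
      LinearMap.sum_apply, LinearMap.smul_apply, smul_eq_mul, h1, Finset.sum_mul_sum]
    rw [← Finset.sum_sub_distrib, Finset.sum_comm]
    refine Finset.sum_congr rfl fun b _ => ?_
    rw [← Finset.sum_sub_distrib]
    exact Finset.sum_congr rfl fun a _ => by ring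
  have h2 := DFunLike.congr_fun h a
  simp only [LinearMap.comp_apply, Matrix.entryLinearMap_apply, LinearMap.sum_apply,
    LinearMap.smul_apply, smul_eq_mul] at h2
  rw [h2, Matrix.mul_apply]
  refine Finset.sum_congr rfl fun b _ => ?_
  rw [Matrix.mul_apply, Finset.sum_mul]
  exact Finset.sum_congr rfl fun a _ => by rw [Matrix.transpose_apply]; ring

theorem coe_wedge {g : ℕ} (u v : Hyp g) : (wedge u v : ExteriorAlgebra ℚ (Hyp g)) =
    ExteriorAlgebra.ι ℚ u * ExteriorAlgebra.ι ℚ v := by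
  simp [wedge, ExteriorAlgebra.ιMulti_apply]

theorem wedge_swap {g : ℕ} (u v : Hyp g) : wedge v u = -wedge u v := by
  refine Subtype.ext ?_
  rw [Submodule.coe_neg, coe_wedge, coe_wedge]
  exact eq_neg_of_add_eq_zero_right (ExteriorAlgebra.ι_add_mul_swap (R := ℚ) u v)

theorem wedge_eq_sum {g : ℕ} (u v : Hyp g) :
    ∑ p, ∑ q, (u p * v q) • wedge (Pi.single p 1 : Hyp g) (Pi.single q 1) = wedge u v := by
  have hu : ∀ u : Hyp g, ExteriorAlgebra.ι ℚ u =
      ∑ p, u p • ExteriorAlgebra.ι ℚ (Pi.single p 1 : Hyp g) := by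
    intro u
    simp only [← map_smul, ← map_sum]
    congr 1
    ext q
    simp [Finset.sum_apply, Pi.single_apply]
  refine Subtype.ext ?_
  simp only [Submodule.coe_sum, Submodule.coe_smul, coe_wedge]
  conv_rhs => rw [hu u, hu v, Finset.sum_mul_sum]
  simp only [smul_mul_smul_comm]

theorem eq_sum_skewMatrix {g : ℕ} (a : ⋀[ℚ]^2 (Hyp g)) :
    ∑ p, ∑ q, (1 / 2 * skewMatrix g a p q) • wedge (Pi.single p 1) (Pi.single q 1) = a := by
  have h : ∑ p, ∑ q, ((1 / 2 : ℚ) • Matrix.entryLinearMap ℚ ℚ p q ∘ₗ skewMatrix g).smulRight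
      (wedge (Pi.single p 1) (Pi.single q 1) : ⋀[ℚ]^2 (Hyp g)) = LinearMap.id := by
    refine wedge_ext fun u v => ?_
    simp only [LinearMap.sum_apply, LinearMap.smulRight_apply, LinearMap.smul_apply,
      LinearMap.comp_apply, Matrix.entryLinearMap_apply, skewMatrix_wedge, LinearMap.id_apply,
      smul_eq_mul, mul_sub, sub_smul, Finset.sum_sub_distrib]
    simp only [mul_smul (1 / 2 : ℚ), ← Finset.smul_sum, wedge_eq_sum]
    rw [wedge_swap u v, smul_neg, sub_neg_eq_add, ← add_smul]
    norm_num
  have := DFunLike.congr_fun h a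
  simpa [LinearMap.sum_apply] using this

theorem splitting_proj {g : ℕ} (a : ⋀[ℚ]^2 (Hyp g)) :
    splitting g (proj g a) = a - ((g : ℚ)⁻¹ * contraction g a) • omega g := rfl

theorem proj_omega (g : ℕ) : proj g (omega g) = 0 :=
  (Submodule.Quotient.mk_eq_zero _).2 (Submodule.mem_span_singleton_self _)

theorem proj_surjective (g : ℕ) : Function.Surjective (proj g) := Submodule.mkQ_surjective _

theorem proj_splitting {g : ℕ} (v : V g) : proj g (splitting g v) = v := by
  obtain ⟨a, rfl⟩ := proj_surjective g v
  rw [splitting_proj, map_sub, map_smul, proj_omega, smul_zero, sub_zero]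

theorem contraction_splitting {g : ℕ} (v : V g) : contraction g (splitting g v) = 0 := by
  rcases Nat.eq_zero_or_pos g with rfl | hg
  · have h : contraction 0 = 0 := wedge_ext fun u v => by simp [contraction_wedge, pairing]
    rw [h, LinearMap.zero_apply]
  · obtain ⟨a, rfl⟩ := proj_surjective g v
    have : (g : ℚ) ≠ 0 := by positivity
    rw [splitting_proj, map_sub, map_smul, contraction_omega, smul_eq_mul]
    field_simp
    ring

theorem splitting_proj_of_contraction {g : ℕ} {a : ⋀[ℚ]^2 (Hyp g)} (h : contraction g a = 0) :
    splitting g (proj g a) = a := by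
  rw [splitting_proj, h, mul_zero, zero_smul, sub_zero]

/-- A linear map that preserves the intersection pairing. -/
def IsIsometric {g m : ℕ} (f : Hyp g →ₗ[ℚ] Hyp m) : Prop :=
  ∀ u v, pairing m (f u) (f v) = pairing g u v

theorem contraction_map {g m : ℕ} {f : Hyp g →ₗ[ℚ] Hyp m} (hf : IsIsometric f)
    (a : ⋀[ℚ]^2 (Hyp g)) : contraction m (exteriorPower.map 2 f a) = contraction g a := by
  have h : contraction m ∘ₗ exteriorPower.map 2 f = contraction g :=
    wedge_ext fun u v => by
      rw [LinearMap.comp_apply, map_wedge, contraction_wedge, contraction_wedge, hf]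
  exact DFunLike.congr_fun h a

theorem splitting_induced {g m : ℕ} {f : Hyp g →ₗ[ℚ] Hyp m} (hf : IsIsometric f) (v : V g) :
    splitting m (induced f v) = exteriorPower.map 2 f (splitting g v) :=
  splitting_proj_of_contraction (by
    rw [LinearMap.comp_apply, contraction_map hf, contraction_splitting])

/-- The `(p, q)` matrix entry, as a linear form on `V_g ≅ ker C_g`. -/
def entryForm (g : ℕ) (p q : Fin g ⊕ Fin g) : Module.Dual ℚ (V g) :=
  Matrix.entryLinearMap ℚ ℚ p q ∘ₗ skewMatrix g ∘ₗ splitting g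

theorem entryForm_apply {g : ℕ} (p q : Fin g ⊕ Fin g) (v : V g) :
    entryForm g p q v = skewMatrix g (splitting g v) p q := rfl

/-- The generic skew-symmetric matrix over `Λ^* V_g^*`, with entries the linear forms
`entryForm`. -/
def generic (g : ℕ) : Matrix (Fin g ⊕ Fin g) (Fin g ⊕ Fin g) (LieCoh.Cochain (V g)) :=
  Matrix.of fun p q => ExteriorAlgebra.ι ℚ (entryForm g p q)

theorem generic_homogeneous (g : ℕ) : Homogeneous 1 (generic g) := fun _ _ => ι_mem _

theorem generic_transpose (g : ℕ) : (generic g).transpose = -generic g := by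
  ext p q
  rw [Matrix.transpose_apply, Matrix.neg_apply, generic, Matrix.of_apply, Matrix.of_apply,
    ← map_neg]
  congr 1
  ext v
  exact congrFun (congrFun (skewMatrix_transpose (splitting g v)) p) q

/-- The invariant form `tr (ΘΩ)ⁿ` of degree `n`, for the generic skew-symmetric matrix `Θ` and the
matrix `Ω` of the pairing. -/
def traceForm (g n : ℕ) : LieCoh.Cochain (V g) :=
  ((generic g * const (Module.Dual ℚ (V g)) (pairingMatrix g)) ^ n).trace

theorem traceForm_mem (g n : ℕ) : traceForm g n ∈ ⋀[ℚ]^n (Module.Dual ℚ (V g)) :=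
  ((mul_const_homogeneous (generic_homogeneous g) _).pow n).trace_mem

theorem traceForm_eq_zero (g : ℕ) {n : ℕ} (hn : n ≠ 0) (h : n % 4 ≠ 1) : traceForm g n = 0 :=
  trace_pow_eq_zero (generic_homogeneous g) (generic_transpose g) (pairingMatrix_transpose g) hn h

/-- The linear trace form vanishes since `V_g` is identified with the kernel of the contraction. -/
theorem traceForm_one (g : ℕ) : traceForm g 1 = 0 := by
  rw [traceForm, pow_one, trace_mul (generic_homogeneous g) (const_homogeneous _), mul_zero,
    pow_zero, one_smul, Matrix.trace]
  have h : ∀ p, (const _ (pairingMatrix g) * generic g).diag p = ExteriorAlgebra.ι ℚ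
      (∑ q, pairingMatrix g p q • entryForm g q p) := by
    intro p
    simp [Matrix.mul_apply, const, generic, Algebra.smul_def]
  rw [Finset.sum_congr rfl fun p _ => h p, ← map_sum]
  refine (ExteriorAlgebra.ι_eq_zero_iff _).2 ?_
  ext v
  have h1 := sum_skewMatrix (splitting g v)
  rw [contraction_splitting, mul_zero, ← neg_eq_zero, ← Finset.sum_neg_distrib] at h1
  rw [LinearMap.zero_apply, ← h1, LinearMap.sum_apply]
  refine Finset.sum_congr rfl fun p _ => ?_
  rw [LinearMap.sum_apply, ← Finset.sum_neg_distrib]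
  refine Finset.sum_congr rfl fun q _ => ?_
  rw [LinearMap.smul_apply, entryForm_apply, smul_eq_mul, ← mul_neg]
  congr 1
  exact congrFun (congrFun (skewMatrix_transpose (splitting g v)) p) q

theorem add_pow_of_mul_eq_zero {A : Type*} [Ring A] {x y : A} (hxy : x * y = 0) (hyx : y * x = 0)
    {n : ℕ} (hn : n ≠ 0) : (x + y) ^ n = x ^ n + y ^ n := by
  obtain ⟨n, rfl⟩ := Nat.exists_eq_succ_of_ne_zero hn
  induction n with
  | zero => simp
  | succ n ih =>
    rw [pow_succ, ih n.succ_ne_zero, add_mul, mul_add, mul_add, pow_succ x n, pow_succ y n,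
      mul_assoc _ x y, hxy, mul_assoc _ y x, hyx, pow_succ x (n + 1), pow_succ y (n + 1),
      pow_succ x n, pow_succ y n]
    simp

theorem map_trace_pow {A B : Type*} [Ring A] [Algebra ℚ A] [Ring B] [Algebra ℚ B] (φ : A →ₐ[ℚ] B)
    {I : Type*} [Fintype I] [DecidableEq I] (N : Matrix I I A) (n : ℕ) :
    φ (N ^ n).trace = ((N.map φ) ^ n).trace := by
  have h : (N ^ n).map φ = (N.map φ) ^ n := map_pow φ.mapMatrix N n
  rw [← h]
  simp [Matrix.trace]

/-- The pullback of the generic skew-symmetric matrix along a linear map `ψ : L → V_g`. -/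
def genericOn {g : ℕ} {L : Type*} [AddCommGroup L] [Module ℚ L] (ψ : L →ₗ[ℚ] V g) :
    Matrix (Fin g ⊕ Fin g) (Fin g ⊕ Fin g) (ExteriorAlgebra ℚ (Module.Dual ℚ L)) :=
  Matrix.of fun p q => ExteriorAlgebra.ι ℚ (entryForm g p q ∘ₗ ψ)

theorem genericOn_homogeneous {g : ℕ} {L : Type*} [AddCommGroup L] [Module ℚ L]
    (ψ : L →ₗ[ℚ] V g) : Homogeneous 1 (genericOn ψ) := fun _ _ => ι_mem _

theorem genericOn_add {g : ℕ} {L : Type*} [AddCommGroup L] [Module ℚ L] (ψ ψ' : L →ₗ[ℚ] V g) :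
    genericOn (ψ + ψ') = genericOn ψ + genericOn ψ' := by
  ext p q
  simp [genericOn, LinearMap.comp_add]

theorem map_traceForm {g : ℕ} {L : Type*} [AddCommGroup L] [Module ℚ L] (ψ : L →ₗ[ℚ] V g)
    (n : ℕ) : ExteriorAlgebra.map ψ.dualMap (traceForm g n) =
      ((genericOn ψ * const (Module.Dual ℚ L) (pairingMatrix g)) ^ n).trace := by
  rw [traceForm, map_trace_pow]
  congr 2
  ext p q
  simp [Matrix.mul_apply, const, generic, genericOn, LinearMap.dualMap_apply']

/-- Congruences that are compatible with the pairings preserve the trace forms. -/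
theorem trace_congruence_pow {M I J : Type*} [AddCommGroup M] [Module ℚ M] [Fintype I] [Fintype J]
    [DecidableEq I] [DecidableEq J] {Θ : Matrix I I (ExteriorAlgebra ℚ M)} (h : Homogeneous 1 Θ)
    {B : Matrix J I ℚ} {Ω : Matrix J J ℚ} {Ω' : Matrix I I ℚ} (hB : B.transpose * Ω * B = Ω')
    {n : ℕ} (hn : n ≠ 0) :
    ((const M B * Θ * const M B.transpose * const M Ω) ^ n).trace =
      ((Θ * const M Ω') ^ n).trace := by
  rw [Matrix.mul_assoc (const M B * Θ), ← const_mul,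
    trace_pow_const_comm ((zero_add 1) ▸ (const_homogeneous B).mul h) _ hn, ← Matrix.mul_assoc,
    ← const_mul, hB, ← trace_pow_const_comm h _ hn]

variable {g m : ℕ}

theorem genericOn_induced {f : Hyp g →ₗ[ℚ] Hyp m} (hf : IsIsometric f) {L : Type*}
    [AddCommGroup L] [Module ℚ L] (ψ : L →ₗ[ℚ] V g) :
    genericOn (induced f ∘ₗ ψ) =
      const (Module.Dual ℚ L) (LinearMap.toMatrix' f) * genericOn ψ *
        const (Module.Dual ℚ L) (LinearMap.toMatrix' f).transpose := by
  ext p q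
  have h : entryForm m p q ∘ₗ induced f ∘ₗ ψ = ∑ b, ∑ a,
      (LinearMap.toMatrix' f p a * LinearMap.toMatrix' f q b) • (entryForm g a b ∘ₗ ψ) := by
    ext x
    simp only [LinearMap.comp_apply, entryForm_apply, splitting_induced hf, skewMatrix_map,
      LinearMap.sum_apply, LinearMap.smul_apply, smul_eq_mul]
    rw [Matrix.mul_apply]
    refine Finset.sum_congr rfl fun b _ => ?_
    rw [Matrix.mul_apply, Finset.sum_mul]
    exact Finset.sum_congr rfl fun a _ => by rw [Matrix.transpose_apply]; ring
  rw [genericOn, Matrix.of_apply, h, const_mul_mul_const_apply, Finset.sum_comm, map_sum]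
  refine Finset.sum_congr rfl fun b _ => ?_
  rw [map_sum]
  exact Finset.sum_congr rfl fun a _ => map_smul _ _ _

theorem IsIsometric.transpose_mul {f : Hyp g →ₗ[ℚ] Hyp m} (hf : IsIsometric f) :
    (LinearMap.toMatrix' f).transpose * pairingMatrix m * LinearMap.toMatrix' f =
      pairingMatrix g := by
  rw [transpose_mul_pairingMatrix_mul]
  ext p q
  exact hf _ _

theorem trace_genericOn_induced {f : Hyp g →ₗ[ℚ] Hyp m} (hf : IsIsometric f) {L : Type*}
    [AddCommGroup L] [Module ℚ L] (ψ : L →ₗ[ℚ] V g) {n : ℕ} (hn : n ≠ 0) :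
    ((genericOn (induced f ∘ₗ ψ) * const (Module.Dual ℚ L) (pairingMatrix m)) ^ n).trace =
      ((genericOn ψ * const (Module.Dual ℚ L) (pairingMatrix g)) ^ n).trace := by
  rw [genericOn_induced hf, trace_congruence_pow (genericOn_homogeneous ψ) hf.transpose_mul hn]

/-- The trace forms are compatible with the maps induced by isometric embeddings. -/
theorem map_induced_traceForm {f : Hyp g →ₗ[ℚ] Hyp m} (hf : IsIsometric f) {n : ℕ} (hn : n ≠ 0) :
    ExteriorAlgebra.map (induced f).dualMap (traceForm m n) = traceForm g n := by
  have h := trace_genericOn_induced hf LinearMap.id hn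
  rwa [LinearMap.comp_id, ← map_traceForm, ← map_traceForm, LinearMap.dualMap_id,
    ExteriorAlgebra.map_id, AlgHom.id_apply] at h

/-- The trace forms are additive for orthogonal sums: the generic matrices of the two summands
become matrices `U`, `W` with `UW = WU = 0`, so `(U + W)ⁿ = Uⁿ + Wⁿ`. -/
theorem map_coprod_traceForm {h : ℕ} {f : Hyp g →ₗ[ℚ] Hyp m} {f' : Hyp h →ₗ[ℚ] Hyp m}
    (hf : IsIsometric f) (hf' : IsIsometric f') (hff' : ∀ u v, pairing m (f u) (f' v) = 0)
    {n : ℕ} (hn : n ≠ 0) :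
    ExteriorAlgebra.map ((induced f).coprod (induced f')).dualMap (traceForm m n) =
      ExteriorAlgebra.map (LinearMap.fst ℚ (V g) (V h)).dualMap (traceForm g n) +
        ExteriorAlgebra.map (LinearMap.snd ℚ (V g) (V h)).dualMap (traceForm h n) := by
  have h1 : (induced f).coprod (induced f') = induced f ∘ₗ LinearMap.fst ℚ (V g) (V h) +
      induced f' ∘ₗ LinearMap.snd ℚ (V g) (V h) := by
    ext <;> simp
  rw [h1, map_traceForm, map_traceForm, map_traceForm, ← trace_genericOn_induced hf _ hn,
    ← trace_genericOn_induced hf' _ hn, genericOn_add, Matrix.add_mul, ← Matrix.trace_add]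
  congr 1
  have hswap : ∀ u v : Hyp m, pairing m u v = -pairing m v u := by
    intro u v
    simp only [pairing, ← Finset.sum_neg_distrib]
    exact Finset.sum_congr rfl fun i _ => by ring
  have zero : ∀ {a b : ℕ} {k : Hyp a →ₗ[ℚ] Hyp m} {k' : Hyp b →ₗ[ℚ] Hyp m} (hk : IsIsometric k)
      (hk' : IsIsometric k') (_ : ∀ u v, pairing m (k u) (k' v) = 0)
      (ψ : V g × V h →ₗ[ℚ] V a) (ψ' : V g × V h →ₗ[ℚ] V b),
      genericOn (induced k ∘ₗ ψ) * const (Module.Dual ℚ (V g × V h)) (pairingMatrix m) *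
        (genericOn (induced k' ∘ₗ ψ') * const (Module.Dual ℚ (V g × V h)) (pairingMatrix m)) = 0 := by
    intro a b k k' hk hk' h0 ψ ψ'
    have h2 : (LinearMap.toMatrix' k).transpose * pairingMatrix m * LinearMap.toMatrix' k' = 0 := by
      rw [transpose_mul_pairingMatrix_mul]
      ext p q
      exact h0 _ _
    rw [genericOn_induced hk, genericOn_induced hk']
    have h3 := congrArg (const (Module.Dual ℚ (V g × V h))) h2
    rw [const_mul, const_mul] at h3
    have h4 : const (Module.Dual ℚ (V g × V h)) (0 : Matrix (Fin a ⊕ Fin a) (Fin b ⊕ Fin b) ℚ) =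
        0 := by ext; simp [const]
    rw [h4] at h3
    simp only [Matrix.mul_assoc] at h3 ⊢
    have h5 : ∀ X : Matrix (Fin b ⊕ Fin b) (Fin m ⊕ Fin m)
        (ExteriorAlgebra ℚ (Module.Dual ℚ (V g × V h))),
        const (Module.Dual ℚ (V g × V h)) (LinearMap.toMatrix' k).transpose *
          (const (Module.Dual ℚ (V g × V h)) (pairingMatrix m) *
            (const (Module.Dual ℚ (V g × V h)) (LinearMap.toMatrix' k') * X)) = 0 := by
      intro X
      rw [← Matrix.mul_assoc (const _ (pairingMatrix m)), ← Matrix.mul_assoc, h3, Matrix.zero_mul]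
    rw [h5]
    simp
  have hUV := zero hf hf' hff' (LinearMap.fst ℚ (V g) (V h)) (LinearMap.snd ℚ (V g) (V h))
  have hVU := zero hf' hf (fun u v => by rw [hswap, hff', neg_zero])
    (LinearMap.snd ℚ (V g) (V h)) (LinearMap.fst ℚ (V g) (V h))
  generalize genericOn (induced f ∘ₗ LinearMap.fst ℚ (V g) (V h)) *
      const (Module.Dual ℚ (V g × V h)) (pairingMatrix m) = U
    at hUV hVU ⊢
  generalize genericOn (induced f' ∘ₗ LinearMap.snd ℚ (V g) (V h)) *
      const (Module.Dual ℚ (V g × V h)) (pairingMatrix m) = W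
    at hUV hVU ⊢
  exact add_pow_of_mul_eq_zero hUV hVU hn

end Symp

/-! ### The homomorphism from the exterior algebra to the invariants -/

namespace Symp

open ExteriorMatrix ExteriorAux

theorem traceForm_anticomm (g i j : ℕ) : traceForm g (4 * i + 5) * traceForm g (4 * j + 5) =
    -(traceForm g (4 * j + 5) * traceForm g (4 * i + 5)) := by
  rw [graded_comm (traceForm_mem g _) (traceForm_mem g _), Odd.neg_one_pow, neg_one_smul]
  exact Odd.mul ⟨2 * i + 2, by ring⟩ ⟨2 * j + 2, by ring⟩

/-- The homomorphism that sends the generator of degree `4i + 5` to the trace form of this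
degree. -/
def traceHom (g : ℕ) : SphereProduct →ₐ[ℚ] LieCoh.Cochain (V g) :=
  ExteriorAlgebra.lift ℚ ⟨Finsupp.linearCombination ℚ fun i => traceForm g (4 * i + 5), by
    have h : ∀ v w : ℕ →₀ ℚ,
        Finsupp.linearCombination ℚ (fun i => traceForm g (4 * i + 5)) v *
          Finsupp.linearCombination ℚ (fun i => traceForm g (4 * i + 5)) w =
        -(Finsupp.linearCombination ℚ (fun i => traceForm g (4 * i + 5)) w *
          Finsupp.linearCombination ℚ (fun i => traceForm g (4 * i + 5)) v) := by
      intro v w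
      induction v using Finsupp.induction_linear with
      | zero => simp
      | add v v' hv hv' => rw [map_add, add_mul, mul_add, hv, hv', neg_add]
      | single i c =>
        induction w using Finsupp.induction_linear with
        | zero => simp
        | add w w' hw hw' => rw [map_add, add_mul, mul_add, hw, hw', neg_add]
        | single j c' =>
          rw [Finsupp.linearCombination_single, Finsupp.linearCombination_single,
            smul_mul_smul_comm, smul_mul_smul_comm, traceForm_anticomm, smul_neg, mul_comm]
    intro v
    have h2 := h v v
    rw [← add_eq_zero_iff_eq_neg, ← two_smul ℚ] at h2
    exact (smul_eq_zero.1 h2).resolve_left two_ne_zero⟩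

theorem traceHom_gen (g i : ℕ) : traceHom g (SphereProduct.gen i) = traceForm g (4 * i + 5) := by
  rw [traceHom, SphereProduct.gen, ExteriorAlgebra.lift_ι_apply, Finsupp.linearCombination_single,
    one_smul]

theorem sphereProduct_hom_ext {A : Type*} [Ring A] [Algebra ℚ A] {φ ψ : SphereProduct →ₐ[ℚ] A}
    (h : ∀ i, φ (SphereProduct.gen i) = ψ (SphereProduct.gen i)) : φ = ψ := by
  refine ExteriorAlgebra.hom_ext (Finsupp.lhom_ext' fun i => LinearMap.ext_ring ?_)
  exact h i

theorem traceHom_mem (g : ℕ) {k : ℕ} {s : SphereProduct} (hs : s ∈ SphereProduct.degree k) :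
    traceHom g s ∈ ⋀[ℚ]^k (Module.Dual ℚ (V g)) := by
  induction hs using Submodule.span_induction with
  | mem x hx =>
    obtain ⟨l, rfl, rfl⟩ := hx
    induction l with
    | nil =>
      rw [List.map_nil, List.map_nil, List.prod_nil, map_one]
      exact SetLike.GradedOne.one_mem (A := fun i : ℕ => ⋀[ℚ]^i (Module.Dual ℚ (V g)))
    | cons i l ih =>
      rw [List.map_cons, List.map_cons, List.prod_cons, map_mul, List.sum_cons]
      refine mul_mem_exteriorPower ?_ ih
      exact (traceHom_gen g i).symm ▸ traceForm_mem g _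
  | zero => rw [map_zero]; exact zero_mem _
  | add x y _ _ hx hy => rw [map_add]; exact add_mem hx hy
  | smul c x _ hx => rw [map_smul]; exact Submodule.smul_mem _ _ hx

/-- The trace forms lie in the image of the exterior algebra. -/
theorem traceForm_mem_map (g : ℕ) {n : ℕ} (hn : n ≠ 0) :
    traceForm g n ∈ (SphereProduct.degree n).map (traceHom g).toLinearMap := by
  by_cases h : n % 4 = 1
  · by_cases h1 : n = 1
    · rw [h1, traceForm_one]
      exact zero_mem _
    · obtain ⟨i, rfl⟩ : ∃ i, n = 4 * i + 5 := ⟨(n - 5) / 4, by omega⟩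
      exact ⟨_, SphereProduct.gen_mem_degree i, traceHom_gen g i⟩
  · rw [traceForm_eq_zero g hn h]
    exact zero_mem _

theorem map_induced_traceHom {g m : ℕ} {f : Hyp g →ₗ[ℚ] Hyp m} (hf : IsIsometric f)
    (s : SphereProduct) :
    ExteriorAlgebra.map (induced f).dualMap (traceHom m s) = traceHom g s := by
  have h : (ExteriorAlgebra.map (induced f).dualMap).comp (traceHom m) = traceHom g :=
    sphereProduct_hom_ext fun i => by
      rw [AlgHom.comp_apply, traceHom_gen, traceHom_gen, map_induced_traceForm hf (by omega)]
  exact DFunLike.congr_fun h s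

theorem pairing_eq_mulVec {g : ℕ} (u v : Hyp g) :
    pairing g u v = -(u ⬝ᵥ (Matrix.J (Fin g) ℚ).mulVec v) := by
  rw [pairing_eq_sum, pairingMatrix_eq]
  simp only [dotProduct, Matrix.mulVec, Matrix.neg_apply, Finset.mul_sum,
    ← Finset.sum_neg_distrib]
  exact Finset.sum_congr rfl fun p _ => Finset.sum_congr rfl fun q _ => by ring

theorem isIsometric_symplectic {g : ℕ} (A : Matrix.symplecticGroup (Fin g) ℚ) :
    IsIsometric (A : Matrix (Fin g ⊕ Fin g) (Fin g ⊕ Fin g) ℚ).mulVecLin := by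
  intro u v
  rw [pairing_eq_mulVec, pairing_eq_mulVec, Matrix.mulVecLin_apply, Matrix.mulVecLin_apply,
    Matrix.mulVec_mulVec, ← Matrix.vecMul_transpose, ← Matrix.dotProduct_mulVec,
    Matrix.mulVec_mulVec, ← Matrix.mul_assoc, SymplecticGroup.mem_iff'.1 A.2]

theorem act_proj {g : ℕ} (A : Matrix.symplecticGroup (Fin g) ℚ) (a : ⋀[ℚ]^2 (Hyp g)) :
    act A (proj g a) =
      proj g (exteriorPower.map 2 (A : Matrix (Fin g ⊕ Fin g) (Fin g ⊕ Fin g) ℚ).mulVecLin a) :=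
  rfl

theorem act_eq_induced {g : ℕ} (A : Matrix.symplecticGroup (Fin g) ℚ) :
    (act A : V g →ₗ[ℚ] V g) =
      induced (A : Matrix (Fin g ⊕ Fin g) (Fin g ⊕ Fin g) ℚ).mulVecLin := by
  ext v
  change act A v = _
  conv_lhs => rw [← proj_splitting v, act_proj]
  rfl

theorem inclL_apply {g h : ℕ} (u : Hyp g) (a : Fin (g + h) ⊕ Fin (g + h)) : inclL g h u a =
    ∑ i, u i * if a = Sum.map (Fin.castAdd h) (Fin.castAdd h) i then 1 else 0 := by
  simp [inclL, Module.Basis.constr_apply_fintype, Pi.single_apply]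

theorem inclR_apply {g h : ℕ} (u : Hyp h) (a : Fin (g + h) ⊕ Fin (g + h)) : inclR g h u a =
    ∑ i, u i * if a = Sum.map (Fin.natAdd g) (Fin.natAdd g) i then 1 else 0 := by
  simp [inclR, Module.Basis.constr_apply_fintype, Pi.single_apply]

theorem castAdd_ne_natAdd {g h : ℕ} (i : Fin g) (j : Fin h) : Fin.castAdd h i ≠ Fin.natAdd g j := by
  intro hij
  have := congrArg Fin.val hij
  simp only [Fin.val_castAdd, Fin.val_natAdd] at this
  omega

theorem isIsometric_inclL (g h : ℕ) : IsIsometric (inclL g h) := by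
  intro u v
  simp [pairing, inclL_apply, Fin.sum_univ_add, Fintype.sum_sum_type,
    (castAdd_ne_natAdd _ _).symm]

theorem isIsometric_inclR (g h : ℕ) : IsIsometric (inclR g h) := by
  intro u v
  simp [pairing, inclR_apply, Fin.sum_univ_add, Fintype.sum_sum_type, castAdd_ne_natAdd]

theorem pairing_inclL_inclR {g h : ℕ} (u : Hyp g) (v : Hyp h) :
    pairing (g + h) (inclL g h u) (inclR g h v) = 0 := by
  simp [pairing, inclL_apply, inclR_apply, Fin.sum_univ_add, Fintype.sum_sum_type,
    castAdd_ne_natAdd, (castAdd_ne_natAdd _ _).symm]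

/-! ### Invariants are generated by the trace forms -/

theorem wedge_add_left {g : ℕ} (u u' v : Hyp g) : wedge (u + u') v = wedge u v + wedge u' v :=
  Subtype.ext (by rw [Submodule.coe_add, coe_wedge, coe_wedge, coe_wedge, map_add, add_mul])

theorem wedge_add_right {g : ℕ} (u v v' : Hyp g) : wedge u (v + v') = wedge u v + wedge u v' :=
  Subtype.ext (by rw [Submodule.coe_add, coe_wedge, coe_wedge, coe_wedge, map_add, mul_add])

theorem wedge_smul_left {g : ℕ} (c : ℚ) (u v : Hyp g) : wedge (c • u) v = c • wedge u v :=
  Subtype.ext (by rw [Submodule.coe_smul, coe_wedge, coe_wedge, map_smul, smul_mul_assoc])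

theorem wedge_smul_right {g : ℕ} (c : ℚ) (u v : Hyp g) : wedge u (c • v) = c • wedge u v :=
  Subtype.ext (by rw [Submodule.coe_smul, coe_wedge, coe_wedge, map_smul, mul_smul_comm])

theorem wedge_update {g k : ℕ} [DecidableEq (Fin k × Fin 2)] (v : Fin k × Fin 2 → Hyp g) (a : Fin k)
    (b : Fin 2) (x : Hyp g) :
    (fun a' => proj g (wedge (Function.update v (a, b) x (a', 0))
      (Function.update v (a, b) x (a', 1)))) =
    Function.update (fun a' => proj g (wedge (v (a', 0)) (v (a', 1)))) a
      (proj g (![wedge x (v (a, 1)), wedge (v (a, 0)) x] b)) := by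
  funext a'
  by_cases h : a' = a
  · subst h
    rw [Function.update_self]
    match b with
    | 0 => simp
    | 1 => simp
  · rw [Function.update_of_ne h, Function.update_of_ne (by simp [h]),
      Function.update_of_ne (by simp [h])]

/-- The multilinear form obtained by inserting bivectors `u ∧ v` into a multilinear form on
`V_g`. -/
def precompWedge {g k : ℕ} (F : MultilinearMap ℚ (fun _ : Fin k => V g) ℚ) :
    MultilinearMap ℚ (fun _ : Fin k × Fin 2 => Hyp g) ℚ where
  toFun v := F fun a => proj g (wedge (v (a, 0)) (v (a, 1)))
  map_update_add' := by
    rintro _ v ⟨a, b⟩ x y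
    rw [wedge_update, wedge_update, wedge_update, ← F.map_update_add, ← map_add]
    match b with
    | 0 => simp [wedge_add_left]
    | 1 => simp [wedge_add_right]
  map_update_smul' := by
    rintro _ v ⟨a, b⟩ c x
    rw [wedge_update, wedge_update, ← F.map_update_smul, ← map_smul]
    match b with
    | 0 => simp [wedge_smul_left]
    | 1 => simp [wedge_smul_right]

theorem precompWedge_apply {g k : ℕ} (F : MultilinearMap ℚ (fun _ : Fin k => V g) ℚ)
    (v : Fin k × Fin 2 → Hyp g) :
    precompWedge F v = F fun a => proj g (wedge (v (a, 0)) (v (a, 1))) := rfl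

/-- The multilinear form on `V_g` given by the full contractions of a form of degree `k`. -/
def polarForm {g : ℕ} (k : ℕ) (F : LieCoh.Cochain (V g)) :
    MultilinearMap ℚ (fun _ : Fin k => V g) ℚ :=
  ExteriorAlgebra.algebraMapInv.toLinearMap.compMultilinearMap
    ((contractMulti k F).compLinearMap fun _ => Module.Dual.eval ℚ (V g))

theorem algebraMap_polarForm {g k : ℕ} {F : LieCoh.Cochain (V g)}
    (hF : F ∈ ⋀[ℚ]^k (Module.Dual ℚ (V g))) (v : Fin k → V g) :
    algebraMap ℚ (LieCoh.Cochain (V g)) (polarForm k F v) =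
      contractMulti k F fun a => Module.Dual.eval ℚ (V g) (v a) :=
  mem_exteriorPower_zero (contractMulti_mem hF _)

theorem polarForm_comp {g k : ℕ} {F : LieCoh.Cochain (V g)} {φ : V g →ₗ[ℚ] V g}
    (hF : ExteriorAlgebra.map φ.dualMap F = F) (v : Fin k → V g) :
    polarForm k F (fun a => φ (v a)) = polarForm k F v := by
  have h1 : ∀ x : LieCoh.Cochain (V g), ExteriorAlgebra.algebraMapInv
      (ExteriorAlgebra.map φ.dualMap x) = ExteriorAlgebra.algebraMapInv x := by
    have h2 : ExteriorAlgebra.algebraMapInv.comp (ExteriorAlgebra.map φ.dualMap) =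
        (ExteriorAlgebra.algebraMapInv : LieCoh.Cochain (V g) →ₐ[ℚ] ℚ) :=
      ExteriorAlgebra.hom_ext (LinearMap.ext fun ξ => by
        simp [ExteriorAlgebra.algebraMapInv])
    exact fun x => DFunLike.congr_fun h2 x
  change ExteriorAlgebra.algebraMapInv (contractMulti k F fun a =>
    Module.Dual.eval ℚ (V g) (φ (v a))) = ExteriorAlgebra.algebraMapInv (contractMulti k F fun a =>
    Module.Dual.eval ℚ (V g) (v a))
  conv_rhs => rw [← hF, contractMulti_map, h1]
  rfl

/-- The word of the product of the entries of `Θ` at the pairs of labels `(a, 0)`, `(a, 1)`. -/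
def standardWord (k : ℕ) : List (ℕ × (Fin k × Fin 2) × (Fin k × Fin 2)) :=
  List.ofFn fun a => (0, (a, 0), (a, 1))

theorem wordLabels_standardWord (k : ℕ) : wordLabels (standardWord k) = Finset.univ.val := by
  rw [wordLabels, standardWord, List.map_ofFn, List.sum_ofFn]
  ext ⟨a, b⟩
  rw [Multiset.count_sum', Multiset.count_eq_one_of_mem Finset.univ.nodup (Finset.mem_univ _)]
  have h : ∀ i : Fin k, Multiset.count (a, b)
      ((((fun w : ℕ × (Fin k × Fin 2) × (Fin k × Fin 2) => w.2.1 ::ₘ w.2.2 ::ₘ 0) ∘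
        fun a => (0, (a, 0), (a, 1))) i)) = if a = i then 1 else 0 := by
    intro i
    by_cases hi : a = i
    · subst hi
      match b with
      | 0 => simp
      | 1 => simp
    · simp [hi]
  refine (Finset.sum_congr rfl fun i _ => h i).trans ?_
  simp

theorem wordDegree_standardWord (k : ℕ) : wordDegree (standardWord k) = k := by
  simp [wordDegree, standardWord, List.map_ofFn, List.sum_ofFn]

theorem wordProd_standardWord {g : ℕ} (k : ℕ) (p : Fin k × Fin 2 → Fin g ⊕ Fin g) :
    wordProd (generic g) (pairingMatrix g) (standardWord k) p =
      (List.ofFn fun a => generic g (p (a, 0)) (p (a, 1))).prod := by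
  simp [wordProd, standardWord, List.map_ofFn, link, Function.comp_def]

/-- A form is recovered from the values of its polarization on the bivectors `e_p ∧ e_q`, which
multiply the corresponding products of entries of the generic matrix. Each entry contributes a
factor `1/2`, since every basis bivector of `Λ² H` occurs twice up to sign. -/
theorem factorial_smul_eq_sum {g k : ℕ} {F : LieCoh.Cochain (V g)}
    (hF : F ∈ ⋀[ℚ]^k (Module.Dual ℚ (V g))) :
    (k.factorial : ℚ) • F = (1 / 2 : ℚ) ^ k • ∑ p : Fin k × Fin 2 → Fin g ⊕ Fin g,
      precompWedge (polarForm k F) (fun a => Pi.single (p a) 1) •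
        wordProd (generic g) (pairingMatrix g) (standardWord k) p := by
  have hres : ∀ η : Module.Dual ℚ (V g), ∑ i : (Fin g ⊕ Fin g) × (Fin g ⊕ Fin g),
      Module.Dual.eval ℚ (V g) (proj g (wedge (Pi.single i.1 1) (Pi.single i.2 1))) η •
        ((1 / 2 : ℚ) • entryForm g i.1 i.2) = η := by
    intro η
    ext v
    conv_rhs => rw [← proj_splitting v, ← eq_sum_skewMatrix (splitting g v)]
    rw [Fintype.sum_prod_type]
    simp only [LinearMap.sum_apply, map_sum, map_smul, LinearMap.smul_apply, smul_eq_mul,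
      Module.Dual.eval_apply, entryForm_apply]
    exact Finset.sum_congr rfl fun p _ => Finset.sum_congr rfl fun q _ => mul_comm _ _
  have h := euler_multi (fun i : (Fin g ⊕ Fin g) × (Fin g ⊕ Fin g) =>
    (1 / 2 : ℚ) • entryForm g i.1 i.2) _ hres hF
  rw [← h, Finset.smul_sum]
  let e : (Fin k → (Fin g ⊕ Fin g) × (Fin g ⊕ Fin g)) ≃ (Fin k × Fin 2 → Fin g ⊕ Fin g) :=
    { toFun := fun s x => ![(s x.1).1, (s x.1).2] x.2
      invFun := fun p a => (p (a, 0), p (a, 1))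
      left_inv := fun s => rfl
      right_inv := fun p => by
        ext ⟨a, b⟩
        match b with
        | 0 => rfl
        | 1 => rfl }
  rw [← e.sum_comp]
  refine Finset.sum_congr rfl fun s _ => ?_
  rw [← algebraMap_polarForm hF fun a =>
      proj g (wedge (Pi.single (s a).1 1) (Pi.single (s a).2 1)),
    ← Algebra.commutes, ← Algebra.smul_def, smul_comm, wordProd_standardWord]
  refine congrArg₂ (· • ·) rfl ?_
  have h2 : ∀ l : List ((Fin g ⊕ Fin g) × (Fin g ⊕ Fin g)),
      (l.map fun i => ExteriorAlgebra.ι ℚ ((1 / 2 : ℚ) • entryForm g i.1 i.2)).prod =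
        (1 / 2 : ℚ) ^ l.length • (l.map fun i => generic g i.1 i.2).prod := by
    intro l
    induction l with
    | nil => simp
    | cons i l ih =>
      rw [List.map_cons, List.prod_cons, ih, List.map_cons, List.prod_cons, map_smul,
        smul_mul_smul_comm, List.length_cons, pow_succ']
      rfl
  have h3 := h2 (List.ofFn s)
  rw [List.map_ofFn, List.map_ofFn, List.length_ofFn] at h3
  exact h3

/-- Invariant forms of degree `k` are polynomials in the trace forms, if `g` is large. -/
theorem mem_map_traceHom {g k : ℕ} (hg : 2 * k ≤ g) (hg1 : 1 ≤ g) {F : LieCoh.Cochain (V g)}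
    (hF : F ∈ ⋀[ℚ]^k (Module.Dual ℚ (V g)))
    (hinv : ∀ A : Matrix.symplecticGroup (Fin g) ℚ,
      ExteriorAlgebra.map (act A : V g →ₗ[ℚ] V g).dualMap F = F) :
    F ∈ (SphereProduct.degree k).map (traceHom g).toLinearMap := by
  have hne : Nonempty (Fin g ⊕ Fin g) := ⟨Sum.inl ⟨0, hg1⟩⟩
  have hk : (k.factorial : ℚ) ≠ 0 := by exact_mod_cast k.factorial_ne_zero
  rw [← Submodule.smul_mem_iff _ hk, factorial_smul_eq_sum hF]
  refine Submodule.smul_mem _ _ ?_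
  obtain ⟨e⟩ : Nonempty (Fin k × Fin 2 ↪ Fin g) :=
    Function.Embedding.nonempty_of_card_le (by simp; omega)
  have h := mem_span_matchings e (precompWedge (polarForm k F)) fun A v => by
    rw [precompWedge_apply, precompWedge_apply]
    refine Eq.trans ?_ (polarForm_comp (hinv A) _)
    congr 1
    funext a
    rw [LieHom.coe_toLinearMap, act_proj, map_wedge]
  generalize ((precompWedge (polarForm k F) :
    MultilinearMap ℚ (fun _ : Fin k × Fin 2 => Hyp g) ℚ) : (Fin k × Fin 2 → Hyp g) → ℚ) = f at h ⊢
  induction h using Submodule.span_induction with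
  | mem f hf =>
    obtain ⟨E, hE, rfl⟩ := hf
    have h1 := contraction_mem (generic_homogeneous g) (generic_transpose g)
      (pairingMatrix_transpose g) (fun n => (SphereProduct.degree n).map (traceHom g).toLinearMap)
      ⟨1, SphereProduct.one_mem_degree, map_one (traceHom g)⟩
      (by
        rintro i j _ _ ⟨x, hx, rfl⟩ ⟨y, hy, rfl⟩
        exact ⟨x * y, SphereProduct.mul_mem_degree hx hy, map_mul (traceHom g) x y⟩)
      (fun n hn => traceForm_mem_map g hn) E (standardWord k)
      (hE.trans (wordLabels_standardWord k).symm) (hE ▸ Finset.univ.nodup)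
    rw [wordDegree_standardWord] at h1
    exact h1
  | zero => simp
  | add f f' _ _ hf hf' =>
    simp only [Pi.add_apply, add_smul, Finset.sum_add_distrib]
    exact add_mem hf hf'
  | smul c f _ hf =>
    simp only [Pi.smul_apply, smul_eq_mul, mul_smul, ← Finset.smul_sum]
    exact Submodule.smul_mem _ _ hf

end Symp

/-! ### Algebraic independence of the trace forms -/

namespace Symp

open ExteriorMatrix ExteriorAux

/-- The disjoint union of cycles of lengths `5, 9, …, 4r + 1`. -/
abbrev CyclePoint (r : ℕ) : Type := Σ i : Fin r, Fin (4 * (i : ℕ) + 5)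

namespace CyclePoint

variable {r : ℕ}

/-- The successor in the cycle. -/
def next (p : CyclePoint r) : CyclePoint r := ⟨p.1, p.2 + 1⟩

theorem next_iterate (n : ℕ) (p : CyclePoint r) :
    next^[n] p = ⟨p.1, p.2 + Fin.ofNat (4 * (p.1 : ℕ) + 5) n⟩ := by
  induction n with
  | zero =>
    obtain ⟨i, a⟩ := p
    simp
  | succ n ih =>
    rw [Function.iterate_succ_apply', ih, next]
    simp only [Sigma.mk.injEq, heq_eq_eq, true_and]
    rw [add_assoc]
    congr 1
    ext
    simp [Fin.val_add]

theorem next_iterate_eq_iff (n : ℕ) (p : CyclePoint r) :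
    next^[n] p = p ↔ 4 * (p.1 : ℕ) + 5 ∣ n := by
  obtain ⟨i, a⟩ := p
  rw [next_iterate]
  simp only [Sigma.mk.injEq, heq_eq_eq, true_and, add_eq_left]
  rw [Fin.ext_iff, Nat.dvd_iff_mod_eq_zero]
  simp

theorem next_ne (p : CyclePoint r) : next p ≠ p := by
  intro h
  have := (next_iterate_eq_iff 1 p).1 h
  have := Nat.le_of_dvd one_pos this
  omega

variable (r)

/-- The exterior algebra on the coordinates of `ℚ^P`, for the set `P` of points of the cycles. -/
abbrev Coord : Type := ExteriorAlgebra ℚ (Module.Dual ℚ (CyclePoint r → ℚ))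

variable {r}

/-- The coordinate at a point. -/
def coord (p : CyclePoint r) : Coord r := ExteriorAlgebra.ι ℚ (LinearMap.proj p)

/-- The product of `n` successive coordinates along a cycle. -/
def arc : ℕ → CyclePoint r → Coord r
  | 0, _ => 1
  | n + 1, p => coord p * arc n (next p)

theorem arc_succ' (n : ℕ) (p : CyclePoint r) : arc (n + 1) p = arc n p * coord (next^[n] p) := by
  induction n generalizing p with
  | zero => simp [arc]
  | succ n ih =>
    rw [arc, ih, ← mul_assoc, Function.iterate_succ_apply]
    rfl

theorem arc_mem (n : ℕ) (p : CyclePoint r) :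
    arc n p ∈ ⋀[ℚ]^n (Module.Dual ℚ (CyclePoint r → ℚ)) := by
  induction n generalizing p with
  | zero => exact SetLike.GradedOne.one_mem (A := fun i : ℕ => ⋀[ℚ]^i _)
  | succ n ih =>
    rw [arc, add_comm]
    exact mul_mem_exteriorPower (ι_mem _) (ih _)

theorem arc_eq_prod (n : ℕ) (p : CyclePoint r) :
    arc n p = ((List.ofFn fun s : Fin n => next^[s] p).map coord).prod := by
  induction n generalizing p with
  | zero => simp [arc]
  | succ n ih => rw [arc, ih]; simp [List.ofFn_succ]

/-- An arc that is longer than the cycle passes through a point twice. -/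
theorem arc_eq_zero {n : ℕ} {p : CyclePoint r} (h : 4 * (p.1 : ℕ) + 5 < n) : arc n p = 0 := by
  have h1 : arc n p = ExteriorAlgebra.ιMulti ℚ n fun s : Fin n =>
      (LinearMap.proj (next^[s] p) : Module.Dual ℚ (CyclePoint r → ℚ)) := by
    rw [arc_eq_prod, ExteriorAlgebra.ιMulti_apply, List.map_ofFn]
    rfl
  rw [h1]
  refine AlternatingMap.map_eq_zero_of_eq _ _ (i := ⟨0, by omega⟩) (j := ⟨_, h⟩) ?_ ?_
  · simp only
    rw [(next_iterate_eq_iff (4 * (p.1 : ℕ) + 5) p).2 dvd_rfl, Function.iterate_zero_apply]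
  · simp [Fin.ext_iff]

/-- A closed arc of odd length does not depend on the starting point. -/
theorem arc_next {n : ℕ} (hn : Odd n) {p : CyclePoint r} (hp : next^[n] p = p) :
    arc n (next p) = arc n p := by
  obtain ⟨m, rfl⟩ := hn
  rw [arc_succ', ← Function.iterate_succ_apply next, Nat.succ_eq_add_one, hp,
    show arc (2 * m + 1) p = coord p * arc (2 * m) (next p) from rfl,
    graded_comm (y := coord p) (arc_mem _ _) (ι_mem _)]
  simp

theorem arc_eq {j : ℕ} (hj : j < r) (a : Fin (4 * j + 5)) :
    arc (4 * j + 5) (⟨⟨j, hj⟩, a⟩ : CyclePoint r) =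
      arc (4 * j + 5) (⟨⟨j, hj⟩, 0⟩ : CyclePoint r) := by
  have h : ∀ s : ℕ, arc (4 * j + 5) (next^[s] (⟨⟨j, hj⟩, 0⟩ : CyclePoint r)) =
      arc (4 * j + 5) (⟨⟨j, hj⟩, 0⟩ : CyclePoint r) := by
    intro s
    induction s with
    | zero => rfl
    | succ s ih =>
      rw [Function.iterate_succ_apply', arc_next ⟨2 * j + 2, by ring⟩, ih]
      rw [next_iterate_eq_iff, next_iterate]
  have h1 := h a
  rw [next_iterate] at h1
  simpa using h1

/-- The weighted permutation matrix of the cycles. -/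
def cycleMatrix (r : ℕ) : Matrix (CyclePoint r) (CyclePoint r) (Coord r) :=
  Matrix.of fun p q => if q = next p then coord p else 0

theorem cycleMatrix_homogeneous (r : ℕ) : Homogeneous 1 (cycleMatrix r) := by
  intro p q
  rw [cycleMatrix, Matrix.of_apply]
  split_ifs
  · exact ι_mem _
  · exact zero_mem _

theorem cycleMatrix_pow (n : ℕ) (p q : CyclePoint r) :
    (cycleMatrix r ^ n) p q = if q = next^[n] p then arc n p else 0 := by
  induction n generalizing p with
  | zero => simp [Matrix.one_apply, arc, eq_comm (a := q)]
  | succ n ih =>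
    rw [pow_succ', Matrix.mul_apply, Finset.sum_eq_single (next p)]
    · rw [ih, Function.iterate_succ_apply]
      simp [cycleMatrix, arc]
    · intro b _ hb
      simp [cycleMatrix, hb]
    · simp

theorem trace_cycleMatrix_pow {j : ℕ} (hj : j < r) :
    (cycleMatrix r ^ (4 * j + 5)).trace =
      ((4 * j + 5 : ℕ) : ℚ) • arc (4 * j + 5) (⟨⟨j, hj⟩, 0⟩ : CyclePoint r) := by
  rw [Matrix.trace, Fintype.sum_sigma, Finset.sum_eq_single ⟨j, hj⟩]
  · have h : ∀ a : Fin (4 * j + 5), (cycleMatrix r ^ (4 * j + 5)).diag ⟨⟨j, hj⟩, a⟩ =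
        arc (4 * j + 5) (⟨⟨j, hj⟩, 0⟩ : CyclePoint r) := by
      intro a
      rw [Matrix.diag_apply, cycleMatrix_pow, if_pos, arc_eq]
      exact ((next_iterate_eq_iff _ _).2 dvd_rfl).symm
    refine (Finset.sum_congr rfl fun a _ => h a).trans ?_
    rw [Finset.sum_const, Finset.card_univ, Fintype.card_fin, Nat.cast_smul_eq_nsmul]
  · intro i _ hi
    refine Finset.sum_eq_zero fun a _ => ?_
    rw [Matrix.diag_apply, cycleMatrix_pow]
    split_ifs with h
    · have h1 := (next_iterate_eq_iff _ _).1 h.symm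
      have h2 := Nat.le_of_dvd (by omega) h1
      have h3 : (i : ℕ) ≠ j := fun h => hi (Fin.ext h)
      refine arc_eq_zero ?_
      simp only at h2 ⊢
      omega
    · rfl
  · simp

end CyclePoint

open CyclePoint

variable {g r : ℕ}

/-- The linear map `ℚ^P → V_g` that sends the basis vector at `p` to `[x_p ∧ y_{next p}]`. -/
def cycleMap (e : CyclePoint r ↪ Fin g) : (CyclePoint r → ℚ) →ₗ[ℚ] V g :=
  Fintype.linearCombination ℚ fun p =>
    proj g (wedge (Pi.single (Sum.inl (e p)) 1) (Pi.single (Sum.inr (e (next p))) 1))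

theorem entryForm_cycleMap (e : CyclePoint r ↪ Fin g) (x y : Fin g ⊕ Fin g) :
    ExteriorAlgebra.ι ℚ (entryForm g x y ∘ₗ cycleMap e) = ∑ p, (
      (if x = Sum.inl (e p) then 1 else 0) * (if y = Sum.inr (e (next p)) then 1 else 0) -
      (if x = Sum.inr (e (next p)) then 1 else 0) * (if y = Sum.inl (e p) then 1 else 0) : ℚ) •
        coord p := by
  simp only [coord, ← map_smul, ← map_sum]
  congr 1
  refine LinearMap.pi_ext' fun p => LinearMap.ext_ring ?_
  have h0 : contraction g (wedge (Pi.single (Sum.inl (e p)) 1 : Hyp g)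
      (Pi.single (Sum.inr (e (next p))) 1)) = 0 := by
    have : e p ≠ e (next p) := fun h => next_ne p (e.injective h).symm
    simp [contraction_wedge, pairing, Pi.single_apply, this.symm]
  simp only [LinearMap.comp_apply, LinearMap.single_apply, cycleMap,
    Fintype.linearCombination_apply_single, one_smul, entryForm_apply,
    splitting_proj_of_contraction h0, skewMatrix_wedge, Pi.single_apply, LinearMap.sum_apply,
    LinearMap.smul_apply, LinearMap.proj_apply]
  rw [Finset.sum_eq_single p]
  · simp
  · intro b _ hb
    simp [hb]
  · simp

/-- The pullback of a trace form along `cycleMap` is a nonzero multiple of a closed arc. -/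
theorem trace_cycleMap (e : CyclePoint r ↪ Fin g) {j : ℕ} (hj : j < r) :
    ∃ c : ℚ, c ≠ 0 ∧ ExteriorAlgebra.map (cycleMap e).dualMap (traceForm g (4 * j + 5)) =
      c • arc (4 * j + 5) (⟨⟨j, hj⟩, 0⟩ : CyclePoint r) := by
  let B₁ : Matrix (Fin g ⊕ Fin g) (CyclePoint r) ℚ :=
    Matrix.of fun x p => if x = Sum.inl (e p) then 1 else 0
  let B₂ : Matrix (Fin g ⊕ Fin g) (CyclePoint r) ℚ :=
    Matrix.of fun x p => if x = Sum.inr (e p) then 1 else 0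
  have hB : ∀ (s t : CyclePoint r → Fin g ⊕ Fin g),
      (Matrix.of fun x p => if x = s p then (1 : ℚ) else 0).transpose * pairingMatrix g *
        (Matrix.of fun x p => if x = t p then (1 : ℚ) else 0) =
      Matrix.of fun p q => pairingMatrix g (s p) (t q) := by
    intro s t
    ext p q
    simp [Matrix.mul_apply]
  have h11 : B₁.transpose * pairingMatrix g * B₁ = 0 := by
    rw [hB, pairingMatrix_eq]
    ext p q
    simp [Matrix.J]
  have h22 : B₂.transpose * pairingMatrix g * B₂ = 0 := by
    rw [hB, pairingMatrix_eq]
    ext p q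
    simp [Matrix.J]
  have h12 : B₁.transpose * pairingMatrix g * B₂ = 1 := by
    rw [hB, pairingMatrix_eq]
    ext p q
    simp [Matrix.J, Matrix.one_apply]
  have h21 : B₂.transpose * pairingMatrix g * B₁ = -1 := by
    rw [hB, pairingMatrix_eq]
    ext p q
    simp [Matrix.J, Matrix.one_apply]
  set W := Module.Dual ℚ (CyclePoint r → ℚ) with hW
  have hgen : genericOn (cycleMap e) = const W B₁ * cycleMatrix r * const W B₂.transpose +
      -(const W B₂ * (cycleMatrix r).transpose * const W B₁.transpose) := by
    ext x y
    rw [genericOn, Matrix.of_apply, entryForm_cycleMap, Matrix.add_apply, Matrix.neg_apply,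
      const_mul_mul_const_apply, const_mul_mul_const_apply, ← sub_eq_add_neg]
    simp only [sub_smul, Finset.sum_sub_distrib]
    refine congrArg₂ (· - ·) (Finset.sum_congr rfl fun p _ => ?_) ?_
    · rw [Finset.sum_eq_single (next p)]
      · simp [cycleMatrix, B₁, B₂]
      · intro b _ hb
        simp [cycleMatrix, hb]
      · simp
    · rw [Finset.sum_comm]
      refine Finset.sum_congr rfl fun p _ => ?_
      rw [Finset.sum_eq_single (next p)]
      · simp [cycleMatrix, B₁, B₂]
      · intro b _ hb
        simp [cycleMatrix, hb]
      · simp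
  have hneg : const W (-1 : Matrix (CyclePoint r) (CyclePoint r) ℚ) = -1 := by
    ext p q
    simp [const, Matrix.one_apply, apply_ite]
  have hone : const W (1 : Matrix (CyclePoint r) (CyclePoint r) ℚ) = 1 := by
    ext p q
    simp [const, Matrix.one_apply, apply_ite]
  have hzero : const W (0 : Matrix (CyclePoint r) (CyclePoint r) ℚ) = 0 := by
    ext p q
    simp [const]
  have hodd : Odd (4 * j + 5) := ⟨2 * j + 2, by ring⟩
  have hn : 4 * j + 5 ≠ 0 := by omega
  have hA := cycleMatrix_homogeneous r
  have hA' : Homogeneous 1 (cycleMatrix r).transpose := fun p q => hA q p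
  have hU : Homogeneous (0 + 1) (const W B₁ * cycleMatrix r) := (const_homogeneous B₁).mul hA
  have hV : Homogeneous (0 + 1) (const W B₂ * (cycleMatrix r).transpose) :=
    (const_homogeneous B₂).mul hA'
  have hV' : Homogeneous (0 + 1) (-(const W B₂ * (cycleMatrix r).transpose)) := fun p q =>
    neg_mem (hV p q)
  -- the generic matrix times `Ω` is a sum of two matrices whose products vanish
  have hsplit : genericOn (cycleMap e) * const W (pairingMatrix g) =
      (const W B₁ * cycleMatrix r) * const W (B₂.transpose * pairingMatrix g) +
        -(const W B₂ * (cycleMatrix r).transpose) * const W (B₁.transpose * pairingMatrix g) := by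
    rw [hgen, Matrix.add_mul, const_mul, const_mul]
    simp only [Matrix.mul_assoc, Matrix.neg_mul]
  have hUV : (const W B₁ * cycleMatrix r) * const W (B₂.transpose * pairingMatrix g) *
      (-(const W B₂ * (cycleMatrix r).transpose) * const W (B₁.transpose * pairingMatrix g)) =
      0 := by
    rw [Matrix.mul_assoc, ← Matrix.mul_assoc (const W (B₂.transpose * pairingMatrix g)),
      Matrix.mul_neg, ← Matrix.mul_assoc (const W (B₂.transpose * pairingMatrix g)), ← const_mul,
      h22, hzero]
    simp
  have hVU : (-(const W B₂ * (cycleMatrix r).transpose) *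
      const W (B₁.transpose * pairingMatrix g)) *
      ((const W B₁ * cycleMatrix r) * const W (B₂.transpose * pairingMatrix g)) = 0 := by
    rw [Matrix.mul_assoc, ← Matrix.mul_assoc (const W (B₁.transpose * pairingMatrix g)),
      ← Matrix.mul_assoc (const W (B₁.transpose * pairingMatrix g)), ← const_mul, h11, hzero]
    simp
  have htr : ((cycleMatrix r).transpose ^ (4 * j + 5)).trace =
      (cycleMatrix r ^ (4 * j + 5)).trace := by
    have heven : Even ((4 * j + 5).choose 2) := by
      rw [Nat.choose_two_right, show 4 * j + 5 - 1 = 2 * (2 * j + 2) by omega,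
        show (4 * j + 5) * (2 * (2 * j + 2)) = 2 * (2 * ((j + 1) * (4 * j + 5))) by ring]
      simp
    rw [← Matrix.trace_transpose (cycleMatrix r ^ _), transpose_pow hA, heven.neg_one_pow, one_smul]
  refine ⟨-2 * ((4 * j + 5 : ℕ) : ℚ), mul_ne_zero (by norm_num) (by exact_mod_cast hn), ?_⟩
  rw [map_traceForm, hsplit, add_pow_of_mul_eq_zero hUV hVU hn, Matrix.trace_add,
    trace_pow_const_comm hU _ hn, trace_pow_const_comm hV' _ hn, Matrix.mul_neg,
    ← Matrix.mul_assoc, ← Matrix.mul_assoc, ← const_mul, ← const_mul, h12, h21, hneg, hone,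
    Matrix.one_mul, Matrix.neg_mul, Matrix.one_mul, hodd.neg_pow, hodd.neg_pow, Matrix.trace_neg,
    Matrix.trace_neg, htr, trace_cycleMatrix_pow hj, mul_smul, neg_smul, two_smul, neg_add]

/-- The product of the first `r` trace forms does not vanish if `g` is large. -/
theorem traceHom_top_ne_zero (hg : Fintype.card (CyclePoint r) ≤ g) :
    traceHom g (SphereProduct.top r) ≠ 0 := by
  obtain ⟨e⟩ : Nonempty (CyclePoint r ↪ Fin g) :=
    Function.Embedding.nonempty_of_card_le (by simpa using hg)
  have key : ∀ t ≤ r, ∃ c : ℚ, c ≠ 0 ∧ ∃ l : List (CyclePoint r), l.Nodup ∧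
      (∀ p ∈ l, (p.1 : ℕ) < t) ∧ ExteriorAlgebra.map (cycleMap e).dualMap
        (traceHom g (SphereProduct.top t)) = c • (l.map coord).prod := by
    intro t
    induction t with
    | zero => exact fun _ => ⟨1, one_ne_zero, [], List.nodup_nil, by simp, by
        simp [SphereProduct.top]⟩
    | succ t ih =>
      intro ht
      obtain ⟨c, hc, l, hl, hlt, h⟩ := ih (by omega)
      obtain ⟨c', hc', h'⟩ := trace_cycleMap e (j := t) (by omega)
      refine ⟨c' * c, mul_ne_zero hc' hc, List.ofFn (fun s : Fin (4 * t + 5) =>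
        next^[s] (⟨⟨t, by omega⟩, 0⟩ : CyclePoint r)) ++ l, ?_, ?_, ?_⟩
      · rw [List.nodup_append']
        refine ⟨?_, hl, ?_⟩
        · rw [List.nodup_ofFn]
          intro a b hab
          simpa [next_iterate] using hab
        · intro p hp hp'
          obtain ⟨s, rfl⟩ := (List.mem_ofFn' _ _).1 hp
          have := hlt _ hp'
          simp [next_iterate] at this
      · intro p hp
        rw [List.mem_append] at hp
        rcases hp with hp | hp
        · obtain ⟨s, rfl⟩ := (List.mem_ofFn' _ _).1 hp
          simp [next_iterate]
        · have := hlt p hp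
          omega
      · rw [SphereProduct.top, map_mul, map_mul, h, traceHom_gen, h', List.map_append,
          List.prod_append, smul_mul_smul_comm, arc_eq_prod]
  obtain ⟨c, hc, l, hl, -, h⟩ := key r le_rfl
  intro h0
  rw [h0, map_zero] at h
  have h1 := (smul_eq_zero.1 h.symm).resolve_left hc
  refine prod_ι_ne_zero (fun p : CyclePoint r => (LinearMap.proj p : Module.Dual ℚ _))
    (fun p => Module.Dual.eval ℚ (CyclePoint r → ℚ) (Pi.single p 1)) (by simp) ?_ l hl h1
  intro p q hpq
  simp [hpq.symm]

end Symp

/-! ### Stable cohomology -/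

namespace LieCoh

variable (L : Type*) [LieRing L] [LieAlgebra ℚ L] [Module.Finite ℚ L]

theorem d_eq_zero_of_abelian [IsLieAbelian L] (a : Cochain L) : d L a = 0 := by
  have h : ∀ x y : L, ⁅x, y⁆ = 0 := fun x y => trivial_lie_zero L L x y
  simp [d_apply, h]

/-- The cohomology of an abelian Lie algebra is the algebra of cochains. -/
def abelianEquiv [IsLieAbelian L] : Cochain L ≃ₐ[ℚ] H L :=
  AlgEquiv.ofBijective
    ((toH L).comp ((AlgHom.id ℚ (Cochain L)).codRestrict (cocycles L) (d_eq_zero_of_abelian L))) <| by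
    constructor
    · rw [injective_iff_map_eq_zero]
      intro a ha
      obtain ⟨b, hb⟩ := Ideal.Quotient.eq_zero_iff_mem.1 ha
      rw [d_eq_zero_of_abelian] at hb
      exact hb.symm
    · intro y
      obtain ⟨x, rfl⟩ := Ideal.Quotient.mk_surjective y
      exact ⟨x, rfl⟩

theorem map_abelianEquiv {L L' : Type*} [LieRing L] [LieAlgebra ℚ L] [Module.Finite ℚ L]
    [LieRing L'] [LieAlgebra ℚ L'] [Module.Finite ℚ L'] [IsLieAbelian L] [IsLieAbelian L']
    (φ : L →ₗ⁅ℚ⁆ L') (x : Cochain L') :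
    map φ (abelianEquiv L' x) =
      abelianEquiv L (ExteriorAlgebra.map (φ : L →ₗ[ℚ] L').dualMap x) := rfl

theorem mem_degree_iff [IsLieAbelian L] (k : ℕ) (x : Cochain L) :
    abelianEquiv L x ∈ degree L k ↔ x ∈ ⋀[ℚ]^k (Module.Dual ℚ L) := by
  constructor
  · rintro ⟨a, ha, h⟩
    have h1 : abelianEquiv L (a : Cochain L) = abelianEquiv L x := h
    rw [← (abelianEquiv L).injective h1]
    exact ha
  · intro hx
    exact ⟨⟨x, d_eq_zero_of_abelian L x⟩, hx, rfl⟩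

end LieCoh

namespace Symp

open ExteriorMatrix ExteriorAux LieCoh

instance (g : ℕ) : IsLieAbelian (V g) := ⟨fun _ _ => rfl⟩

instance (g h : ℕ) : IsLieAbelian (V g × V h) := ⟨fun _ _ => rfl⟩

/-- The homomorphism from the exterior algebra on `e_0, e_1, …` to families of cohomology classes
given by the trace forms. -/
def familyHom : SphereProduct →ₐ[ℚ] ∀ g, H (V g) :=
  AlgHom.pi fun g => (abelianEquiv (V g) : Cochain (V g) →ₐ[ℚ] H (V g)).comp (traceHom g)

theorem familyHom_apply (s : SphereProduct) (g : ℕ) :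
    familyHom s g = abelianEquiv (V g) (traceHom g s) := rfl

theorem eq_zero_of_traceHom_eq_zero {r g : ℕ} (hg : Fintype.card (CyclePoint r) ≤ g)
    {s : SphereProduct} (hs : s ∈ SphereProduct.below r) (h : traceHom g s = 0) : s = 0 :=
  SphereProduct.eq_zero_of_map_eq_zero (traceHom g) (traceHom_top_ne_zero hg) hs h

theorem familyHom_injective : Function.Injective familyHom := by
  rw [injective_iff_map_eq_zero]
  intro s hs
  obtain ⟨r, hr⟩ := SphereProduct.exists_mem_below s
  refine eq_zero_of_traceHom_eq_zero le_rfl hr ?_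
  have h := congrFun hs (Fintype.card (CyclePoint r))
  rw [familyHom_apply] at h
  exact (abelianEquiv _).injective (h.trans (map_zero _).symm)

theorem familyHom_mem_invariants {k : ℕ} {s : SphereProduct} (hs : s ∈ SphereProduct.degree k)
    (g : ℕ) : familyHom s g ∈ invariants g k := by
  refine ⟨(mem_degree_iff _ _ _).2 (traceHom_mem g hs), (Submodule.mem_iInf _).2 fun A => ?_⟩
  change LieCoh.map (act A) (abelianEquiv (V g) (traceHom g s)) = abelianEquiv (V g) (traceHom g s)
  rw [map_abelianEquiv, act_eq_induced, map_induced_traceHom (isIsometric_symplectic A)]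

theorem map_stab_familyHom (s : SphereProduct) (g : ℕ) :
    LieCoh.map (stab g) (familyHom s (g + 1)) = familyHom s g := by
  rw [familyHom_apply, map_abelianEquiv]
  exact congrArg _ (map_induced_traceHom (isIsometric_inclL g 1) s)

theorem familyHom_mem_stable {k : ℕ} {s : SphereProduct} (hs : s ∈ SphereProduct.degree k) :
    familyHom s ∈ stable k := fun g => ⟨familyHom_mem_invariants hs g, map_stab_familyHom s g⟩

theorem exists_of_mem_invariants {k g : ℕ} (hg : 2 * k ≤ g) (hg1 : 1 ≤ g) {x : H (V g)}
    (hx : x ∈ invariants g k) : ∃ s ∈ SphereProduct.degree k, familyHom s g = x := by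
  obtain ⟨F, rfl⟩ := (abelianEquiv (V g)).surjective x
  obtain ⟨s, hs, h⟩ := mem_map_traceHom hg hg1 ((mem_degree_iff _ _ _).1 hx.1) fun A => by
    have h : LieCoh.map (act A) (abelianEquiv (V g) F) = abelianEquiv (V g) F :=
      (Submodule.mem_iInf _).1 hx.2 A
    rw [map_abelianEquiv] at h
    exact (abelianEquiv (V g)).injective h
  exact ⟨s, hs, congrArg (abelianEquiv (V g)) h⟩

/-- A bound for the stable range in degree `k`. -/
def stableBound (k : ℕ) : ℕ := max (2 * k + 1) (Fintype.card (CyclePoint k))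

theorem familyHom_apply_injective {k g : ℕ} (hg : stableBound k ≤ g) {s t : SphereProduct}
    (hs : s ∈ SphereProduct.degree k) (ht : t ∈ SphereProduct.degree k)
    (h : familyHom s g = familyHom t g) : s = t := by
  have h1 := (abelianEquiv (V g)).injective h
  rw [← sub_eq_zero, ← map_sub] at h1
  exact sub_eq_zero.1 (eq_zero_of_traceHom_eq_zero ((le_max_right _ _).trans hg)
    (SphereProduct.degree_le_below k (sub_mem hs ht)) h1)

/-- The stable classes are the families given by the trace forms. -/
theorem exists_of_mem_stable {k : ℕ} {x : ∀ g, H (V g)} (hx : x ∈ stable k) :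
    ∃ s ∈ SphereProduct.degree k, familyHom s = x := by
  have hlarge : ∀ g, stableBound k ≤ g → 2 * k ≤ g ∧ 1 ≤ g := fun g hg => by
    have := (le_max_left _ _).trans hg
    omega
  obtain ⟨s, hs, h⟩ := exists_of_mem_invariants (hlarge _ le_rfl).1 (hlarge _ le_rfl).2
    (hx (stableBound k)).1
  refine ⟨s, hs, ?_⟩
  have hup : ∀ n, familyHom s (stableBound k + n) = x (stableBound k + n) := by
    intro n
    induction n with
    | zero => exact h
    | succ n ih =>
      obtain ⟨t, ht, h'⟩ := exists_of_mem_invariants (hlarge (stableBound k + (n + 1)) (by omega)).1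
        (hlarge _ (by omega)).2 (hx (stableBound k + (n + 1))).1
      have h1 : familyHom t (stableBound k + n) = familyHom s (stableBound k + n) := by
        rw [ih, ← map_stab_familyHom, ← (hx (stableBound k + n)).2]
        exact congrArg _ h'
      rw [← familyHom_apply_injective (by omega) ht hs h1, h']
  have hdown : ∀ n g, g + n = stableBound k → familyHom s g = x g := by
    intro n
    induction n with
    | zero =>
      rintro g rfl
      exact h
    | succ n ih =>
      intro g hg
      rw [← map_stab_familyHom, ih (g + 1) (by omega), (hx g).2]
  funext g
  rcases le_total (stableBound k) g with hg | hg
  · obtain ⟨n, rfl⟩ := Nat.exists_eq_add_of_le hg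
    exact hup n
  · exact hdown (stableBound k - g) g (by omega)

theorem eval_bijective {k g : ℕ} (hg : stableBound k ≤ g) : Function.Bijective (eval k g) := by
  constructor
  · intro x y hxy
    obtain ⟨s, hs, h⟩ := exists_of_mem_stable x.2
    obtain ⟨t, ht, h'⟩ := exists_of_mem_stable y.2
    have h1 : familyHom s g = familyHom t g := by
      rw [h, h']
      exact congrArg Subtype.val hxy
    rw [familyHom_apply_injective hg hs ht h1] at h
    exact Subtype.ext (h.symm.trans h')
  · rintro ⟨y, hy⟩
    have := (le_max_left _ _).trans hg
    obtain ⟨s, hs, h⟩ := exists_of_mem_invariants (by omega) (by omega) hy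
    exact ⟨⟨familyHom s, familyHom_mem_stable hs⟩, Subtype.ext h⟩

/-- The projection of families of cohomology classes to the classes of degree `k`. -/
def degreeProj (k : ℕ) : (∀ g, H (V g)) →ₗ[ℚ] ∀ g, H (V g) :=
  LinearMap.pi fun g => (abelianEquiv (V g)).toLinearMap ∘ₗ
    GradedAlgebra.proj (fun i : ℕ => ⋀[ℚ]^i (Module.Dual ℚ (V g))) k ∘ₗ
      (abelianEquiv (V g)).symm.toLinearMap ∘ₗ LinearMap.proj g

theorem degreeProj_of_mem {j k : ℕ} {x : ∀ g, H (V g)} (hx : x ∈ stable j) :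
    degreeProj k x = if j = k then x else 0 := by
  funext g
  obtain ⟨F, hF⟩ := (abelianEquiv (V g)).surjective (x g)
  have hF' : F ∈ ⋀[ℚ]^j (Module.Dual ℚ (V g)) := by
    rw [← mem_degree_iff, hF]
    exact (hx g).1.1
  have h1 : degreeProj k x g = abelianEquiv (V g)
      (GradedAlgebra.proj (fun i : ℕ => ⋀[ℚ]^i (Module.Dual ℚ (V g))) k F) := by
    change abelianEquiv (V g) (GradedAlgebra.proj (fun i : ℕ => ⋀[ℚ]^i (Module.Dual ℚ (V g))) k
      ((abelianEquiv (V g)).symm (x g))) = _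
    rw [← hF, AlgEquiv.symm_apply_apply]
  rw [h1, GradedAlgebra.proj_apply]
  split_ifs with h
  · subst h
    rw [DirectSum.decompose_of_mem_same (fun i : ℕ => ⋀[ℚ]^i (Module.Dual ℚ (V g))) hF', hF]
  · rw [DirectSum.decompose_of_mem_ne (fun i : ℕ => ⋀[ℚ]^i (Module.Dual ℚ (V g))) hF' h, map_zero]
    rfl

theorem coeAlgHom_injective : Function.Injective (DirectSum.coeAlgHom stable) := by
  have h : ∀ (x : ⨁ k, stable k) k, degreeProj k (DirectSum.coeAlgHom stable x) = x k := by
    intro x k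
    induction x using DirectSum.induction_on with
    | zero => simp
    | of j y =>
      rw [DirectSum.coeAlgHom_of, degreeProj_of_mem y.2]
      split_ifs with h
      · subst h
        rw [DirectSum.of_eq_same]
      · rw [DirectSum.of_eq_of_ne _ _ _ (Ne.symm h)]
        rfl
    | add x y hx hy => rw [map_add, map_add, hx, hy, DirectSum.add_apply, Submodule.coe_add]
  intro x y hxy
  refine DFinsupp.ext fun k => Subtype.ext ?_
  exact (h x k).symm.trans ((congrArg (degreeProj k) hxy).trans (h y k))

theorem familyHom_mem_range (s : SphereProduct) :
    familyHom s ∈ (DirectSum.coeAlgHom stable).range := by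
  have hs : s ∈ ⨆ k, SphereProduct.degree k := by
    rw [SphereProduct.iSup_degree]
    trivial
  induction hs using Submodule.iSup_induction' with
  | mem k s hs =>
    exact ⟨DirectSum.of (fun k => stable k) k ⟨_, familyHom_mem_stable hs⟩,
      DirectSum.coeAlgHom_of _ _ _⟩
  | zero => rw [map_zero]; exact zero_mem _
  | add s t _ _ hs ht => rw [map_add]; exact add_mem hs ht

theorem exists_familyHom_eq (y : ⨁ k, stable k) :
    ∃ s, familyHom s = DirectSum.coeAlgHom stable y := by
  induction y using DirectSum.induction_on with
  | zero => exact ⟨0, by rw [map_zero, map_zero]⟩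
  | of j y =>
    obtain ⟨s, _, h⟩ := exists_of_mem_stable y.2
    exact ⟨s, by rw [h, DirectSum.coeAlgHom_of]⟩
  | add x y hx hy =>
    obtain ⟨s, hs⟩ := hx
    obtain ⟨t, ht⟩ := hy
    exact ⟨s + t, by rw [map_add, map_add, hs, ht]⟩

/-- The homomorphism from the exterior algebra to the stable cohomology algebra. -/
def toStable : SphereProduct →ₐ[ℚ] ⨁ k, stable k :=
  ((AlgEquiv.ofInjective _ coeAlgHom_injective).symm : _ →ₐ[ℚ] ⨁ k, stable k).comp
    (familyHom.codRestrict _ familyHom_mem_range)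

theorem coeAlgHom_toStable (s : SphereProduct) :
    DirectSum.coeAlgHom stable (toStable s) = familyHom s :=
  congrArg Subtype.val ((AlgEquiv.ofInjective _ coeAlgHom_injective).apply_symm_apply
    (familyHom.codRestrict _ familyHom_mem_range s))

theorem toStable_bijective : Function.Bijective toStable := by
  constructor
  · intro s t h
    apply familyHom_injective
    rw [← coeAlgHom_toStable, h, coeAlgHom_toStable]
  · intro y
    obtain ⟨s, hs⟩ := exists_familyHom_eq y
    exact ⟨s, coeAlgHom_injective (by rw [coeAlgHom_toStable, hs])⟩

theorem map_degree_toStable (k : ℕ) : (SphereProduct.degree k).map toStable.toLinearMap =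
    LinearMap.range (DirectSum.lof ℚ ℕ (fun k => stable k) k) := by
  ext y
  constructor
  · rintro ⟨s, hs, rfl⟩
    refine ⟨⟨_, familyHom_mem_stable hs⟩, coeAlgHom_injective ?_⟩
    refine Eq.trans ?_ (coeAlgHom_toStable s).symm
    exact DirectSum.coeAlgHom_of _ _ _
  · rintro ⟨x, rfl⟩
    obtain ⟨s, hs, h⟩ := exists_of_mem_stable x.2
    refine ⟨s, hs, coeAlgHom_injective ?_⟩
    refine (coeAlgHom_toStable s).trans (h.trans ?_)
    exact (DirectSum.coeAlgHom_of _ _ _).symm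

/-! ### Primitive classes -/

theorem cross_tmul_one_add (g h : ℕ) (x : H (V g)) (y : H (V h)) :
    cross (V g) (V h) (x ⊗ₜ 1 + 1 ⊗ₜ y) = LieCoh.map (LieHom.fst ℚ (V g) (V h)) x +
      LieCoh.map (LieHom.snd ℚ (V g) (V h)) y := by
  simp [cross]

theorem familyHom_gen_primitive (i g h : ℕ) :
    LieCoh.map (orthogonalSum g h) (familyHom (SphereProduct.gen i) (g + h)) =
      cross (V g) (V h) (familyHom (SphereProduct.gen i) g ⊗ₜ 1 +
        1 ⊗ₜ familyHom (SphereProduct.gen i) h) := by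
  rw [cross_tmul_one_add]
  simp only [familyHom_apply, traceHom_gen, map_abelianEquiv]
  rw [← map_add]
  exact congrArg _ (map_coprod_traceForm (isIsometric_inclL g h) (isIsometric_inclR g h)
    pairing_inclL_inclR (by omega))

/-- Restriction along the diagonal `V_g → V_g ⊕ V_g → V_{2g}` doubles the generators. -/
theorem map_diag_traceHom (g : ℕ) (s : SphereProduct) :
    ExteriorAlgebra.map (LinearMap.prod LinearMap.id LinearMap.id : V g →ₗ[ℚ] V g × V g).dualMap
      (ExteriorAlgebra.map ((induced (inclL g g)).coprod (induced (inclR g g))).dualMap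
        (traceHom (g + g) s)) = traceHom g (SphereProduct.double s) := by
  have h : ((ExteriorAlgebra.map
      (LinearMap.prod LinearMap.id LinearMap.id : V g →ₗ[ℚ] V g × V g).dualMap).comp
      (ExteriorAlgebra.map ((induced (inclL g g)).coprod (induced (inclR g g))).dualMap)).comp
        (traceHom (g + g)) = (traceHom g).comp SphereProduct.double := by
    refine sphereProduct_hom_ext fun i => ?_
    rw [AlgHom.comp_apply, AlgHom.comp_apply, AlgHom.comp_apply, traceHom_gen,
      map_coprod_traceForm (isIsometric_inclL g g) (isIsometric_inclR g g) pairing_inclL_inclR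
        (by omega), SphereProduct.double_gen, map_smul, traceHom_gen, map_add,
      ← AlgHom.comp_apply, ← AlgHom.comp_apply, ExteriorAlgebra.map_comp_map,
      ExteriorAlgebra.map_comp_map, two_smul]
    have h1 : (LinearMap.prod LinearMap.id LinearMap.id : V g →ₗ[ℚ] V g × V g).dualMap ∘ₗ
        (LinearMap.fst ℚ (V g) (V g)).dualMap = LinearMap.id := rfl
    have h2 : (LinearMap.prod LinearMap.id LinearMap.id : V g →ₗ[ℚ] V g × V g).dualMap ∘ₗ
        (LinearMap.snd ℚ (V g) (V g)).dualMap = LinearMap.id := rfl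
    rw [h1, h2, ExteriorAlgebra.map_id]
    rfl
  exact DFunLike.congr_fun h s

/-- A primitive class `x` restricts to `2x` along the diagonal `V_g → V_g ⊕ V_g → V_{2g}`. -/
theorem double_eq_of_primitive {k : ℕ} {x : stable k} (hx : x ∈ primitive k) {s : SphereProduct}
    (hs : familyHom s = x) : SphereProduct.double s = (2 : ℚ) • s := by
  apply familyHom_injective
  funext g
  have h := hx g g
  rw [← hs, cross_tmul_one_add] at h
  simp only [familyHom_apply, map_abelianEquiv] at h
  rw [← map_add] at h
  have h1 := congrArg (ExteriorAlgebra.map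
    (LinearMap.prod LinearMap.id LinearMap.id : V g →ₗ[ℚ] V g × V g).dualMap)
    ((abelianEquiv _).injective h)
  have h2 := (map_diag_traceHom g s).symm.trans h1
  have key : ∀ (f : V g × V g →ₗ[ℚ] V g) (y : Cochain (V g)),
      (LinearMap.prod LinearMap.id LinearMap.id : V g →ₗ[ℚ] V g × V g).dualMap ∘ₗ f.dualMap =
        LinearMap.id →
      ExteriorAlgebra.map
        (LinearMap.prod LinearMap.id LinearMap.id : V g →ₗ[ℚ] V g × V g).dualMap
        (ExteriorAlgebra.map f.dualMap y) = y := by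
    intro f y hf
    rw [← AlgHom.comp_apply, ExteriorAlgebra.map_comp_map, hf, ExteriorAlgebra.map_id]
    rfl
  rw [familyHom_apply, h2, map_smul, Pi.smul_apply, familyHom_apply, ← map_smul, map_add,
    key _ _ rfl, key _ _ rfl, two_smul]

/-- The stable primitive classes are the combinations of the generators of the given degree. -/
theorem exists_of_mem_primitive {k : ℕ} {x : stable k} (hx : x ∈ primitive k) :
    ∃ s ∈ Submodule.span ℚ {a | ∃ i, 4 * i + 5 = k ∧ a = SphereProduct.gen i}, familyHom s = x := by
  obtain ⟨s, hs, h⟩ := exists_of_mem_stable x.2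
  exact ⟨s, SphereProduct.mem_span_gen_of_double hs (double_eq_of_primitive hx h), h⟩

/-- The stable class of degree `4i + 5` given by the trace forms. -/
def stableGen (i : ℕ) : stable (4 * i + 5) :=
  ⟨familyHom (SphereProduct.gen i), familyHom_mem_stable (SphereProduct.gen_mem_degree i)⟩

theorem primitive_eq_span (i : ℕ) : primitive (4 * i + 5) = Submodule.span ℚ {stableGen i} := by
  refine le_antisymm (fun x hx => ?_) ?_
  · obtain ⟨s, hs, h⟩ := exists_of_mem_primitive hx
    have h1 : {a | ∃ j, 4 * j + 5 = 4 * i + 5 ∧ a = SphereProduct.gen j} =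
        {SphereProduct.gen i} := by
      ext a
      constructor
      · rintro ⟨j, hj, rfl⟩
        rw [show j = i by omega]
        rfl
      · rintro rfl
        exact ⟨i, rfl, rfl⟩
    rw [h1, Submodule.mem_span_singleton] at hs
    obtain ⟨c, rfl⟩ := hs
    refine Submodule.mem_span_singleton.2 ⟨c, Subtype.ext ?_⟩
    rw [← h, map_smul]
    rfl
  · rw [Submodule.span_singleton_le_iff_mem]
    exact fun g h => familyHom_gen_primitive i g h

theorem stableGen_ne_zero (i : ℕ) : stableGen i ≠ 0 := by
  intro h
  have h1 : familyHom (SphereProduct.gen i) = familyHom 0 :=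
    (congrArg Subtype.val h).trans (map_zero _).symm
  have h2 := familyHom_injective h1
  rw [SphereProduct.gen, ExteriorAlgebra.ι_eq_zero_iff] at h2
  simp at h2

theorem primitive_eq_bot {k : ℕ} (hk : ¬ (k % 4 = 1 ∧ k ≠ 1)) : primitive k = ⊥ := by
  rw [eq_bot_iff]
  intro x hx
  obtain ⟨s, hs, h⟩ := exists_of_mem_primitive hx
  have h1 : {a | ∃ i, 4 * i + 5 = k ∧ a = SphereProduct.gen i} = ∅ := by
    ext a
    simp only [Set.mem_ofPred_eq, Set.mem_empty_iff_false, iff_false]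
    rintro ⟨i, rfl, rfl⟩
    omega
  rw [h1, Submodule.span_empty, Submodule.mem_bot] at hs
  rw [hs, map_zero] at h
  exact Subtype.ext h.symm

end Symp

theorem proposition5p2 :
    -- stability: in each degree the invariant part does not depend on `g` for large `g`
    (∀ k : ℕ, ∃ g₀ : ℕ, ∀ g, g₀ ≤ g → Function.Bijective (Symp.eval k g)) ∧
    -- the stable invariant cohomology is the cohomology ring of `S⁵ × S⁹ × S¹³ × ⋯`
    (∃ e : SphereProduct ≃ₐ[ℚ] ⨁ k, Symp.stable k,
      ∀ k : ℕ, (SphereProduct.degree k).map e.toLinearMap =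
        LinearMap.range (DirectSum.lof ℚ ℕ (fun k => Symp.stable k) k)) ∧
    -- the stable primitive part
    (∀ k : ℕ, k % 4 = 1 ∧ k ≠ 1 → Nonempty (Symp.primitive k ≃ₗ[ℚ] ℚ)) ∧
    (∀ k : ℕ, ¬ (k % 4 = 1 ∧ k ≠ 1) → Symp.primitive k = ⊥) := by
  refine ⟨fun k => ⟨Symp.stableBound k, fun g hg => Symp.eval_bijective hg⟩,
    ⟨AlgEquiv.ofBijective Symp.toStable Symp.toStable_bijective, Symp.map_degree_toStable⟩,
    fun k hk => ?_, fun k hk => Symp.primitive_eq_bot hk⟩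
  obtain ⟨i, rfl⟩ : ∃ i, k = 4 * i + 5 := ⟨(k - 5) / 4, by omega⟩
  exact ⟨(LinearEquiv.ofEq _ _ (Symp.primitive_eq_span i)).trans
    (LinearEquiv.toSpanNonzeroSingleton ℚ _ _ (Symp.stableGen_ne_zero i)).symm⟩

end
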